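/- Let $m,d,k,N$ be natural numbers, $m\ge 1$, $n=dk$. Let $\mathbf x_1,\dots,\mathbf x_m\in\{0,1\}^n$ be data points with $d$ coordinates of $k$ bits each, $y_1,\dots,y_m\in\{\pm1\}$ labels, and $\Phi:\{0,1\}^n\to\mathbb R^{2^N}$ a feature map realized by a quantum feature map, i.e. a unitary $U_\Phi$ on $n+N$ qubits with $U_\Phi|\mathbf x\rangle|0\rangle=|\mathbf x\rangle\,\|\Phi(\mathbf x)\|^{-1}\sum_b\Phi(\mathbf x)_b|b\rangle$ whenever $\Phi(\mathbf x)\ne0$. Its running time is $T_\Phi\ge1$; as each of its $n+N$ qubits is touched by an at most two-qubit gate, $n+N\le 2T_\Phi$. For $\mathbf c\in\{0,1\}^m$ put $$\Psi_{\mathbf c}=\frac1m\sum_{j=1}^m c_jy_j\Phi(\mathbf x_j),\qquad \eta_{\mathbf c}=\sqrt{\tfrac1m\sum_{j=1}^m c_j\|\Phi(\mathbf x_j)\|^2},\qquad R=\max_j\|\Phi(\mathbf x_j)\| .$$ Let $\emptyset\ne W\subseteq\{0,1\}^m$ with $\Psi_{\mathbf c}\neq0$ for all $\mathbf c\in W$,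 let $\alpha_{\mathbf c}\ge0$ $(\mathbf c\in W)$ with $\sum_{\mathbf c\in W}\alpha_{\mathbf c}\le C$, let $\epsilon>0$, $0<\delta<1$ and $i\in\{1,\dots,m\}$. Suppose that the $\mathbf x_j$, and for every $\mathbf c\in W$ the vector with entries $\frac{c_jy_j}{\sqrt m}\|\Phi(\mathbf x_j)\|$, are stored in qRAM: in time at most $A\log^\kappa(2+md)$ each ($A,\kappa$ constants) one can apply a unitary that maps $|j\rangle|0\rangle\mapsto|j\rangle|\mathbf x_j\rangle$ for all $j$, and, given (the number of) $\mathbf c\in W$, a unitary that maps $|0\rangle\mapsto\eta_{\mathbf c}^{-1}\sum_j\frac{c_jy_j}{\sqrt m}\|\Phi(\mathbf x_j)\||j\rangle$; nothing else is assumed of these unitaries. Suppose further that $\eta_{\mathbf c},\alpha_{\mathbf c}$ $(\mathbf c\in W)$, $C,\epsilon,\delta,R,i,y_i,\|\Phi(\mathbf x_i)\|$ and the sizes $m,n,N,|W|$ and the length $\lceil\log_2 m\rceil$ of the index register are known (part of the classical input). Then there is a quantum algorithm which outputs a number $s$ such that, with probability at least $1-\delta$, $$\Big|s-\sum_{\mathbf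 c\in W}\alpha_{\mathbf c}\langle\Psi_{\mathbf c},y_i\Phi(\mathbf x_i)\rangle\Big|\le\epsilon,$$ in time $$\tilde O\Big(\frac{\log(1/\delta)}{\epsilon}\,\frac{C R^3|W|}{\min_{\mathbf c\in W}\|\Psi_{\mathbf c}\|}\,T_\Phi\Big).$$ Here the algorithm is a single program, the same for all inputs, of a classical random access machine with integer and real cells that controls a register of qubits initially in state $|0\cdots0\rangle$; each classical instruction, test, elementary gate ($X$, $H$, phase gates, with a bounded number of control qubits) and one-qubit measurement takes unit time, and $U_\Phi$ and the two qRAM unitaries are black boxes which may be inverted and controlled, and whose calls take one unit more than the times above. The $\tilde O$-bound holds on every computation path and means at most $K(1+T)\log^p(3+m+d+T)$, where $T=\frac{\max\{1,\log(1/\delta)\}}{\epsilon}\frac{CR^3|W|}{\min_{\mathbf c\in W}\|\Psi_{\mathbf c}\|}T_\Phi$ and $K,p$ depend only on $A,\kappa$. -/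

import Mathlib

/-! ## Bit strings and the classical part of the machine -/

/-- Bit strings of length `n`; they label the computational basis of `n` qubits. -/
abbrev Bits (n : ℕ) : Type := Fin n → Bool

/-- The binary expansion of `j` on `l` bits, least significant bit first. -/
def binary (l j : ℕ) : Bits l := fun k => Nat.testBit j k

/-- The all-zero bit string (on any finite set of qubits). -/
def zeros (ι : Type) : ι → Bool := fun _ => false

/-- The classical memory: countably many integer cells and countably many real cells. -/
structure Mem where
  nat : ℕ → ℕ
  real : ℕ → ℝ

/-- Integer expressions; `get a` reads the integer cell whose address is the value of `a`. -/
inductive NExp : Type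
  | lit (a : ℕ)
  | get (a : NExp)
  | add (a b : NExp)
  | sub (a b : NExp)
  | half (a : NExp)

/-- Real expressions; `get a` reads the real cell whose address is the value of `a`. -/
inductive RExp : Type
  | get (a : NExp)
  | ofNat (a : NExp)
  | add (x y : RExp)
  | sub (x y : RExp)
  | mul (x y : RExp)
  | div (x y : RExp)
  | sqrt (x : RExp)

/-- Tests. -/
inductive BExp : Type
  | ltN (a b : NExp)
  | ltR (x y : RExp)
  | not (t : BExp)

/-- The value of an integer expression. -/
def NExp.eval (M : Mem) : NExp → ℕ
  | .lit a => a
  | .get a => M.nat (a.eval M)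
  | .add a b => a.eval M + b.eval M
  | .sub a b => a.eval M - b.eval M
  | .half a => a.eval M / 2

/-- The value of a real expression. -/
noncomputable def RExp.eval (M : Mem) : RExp → ℝ
  | .get a => M.real (a.eval M)
  | .ofNat a => (a.eval M : ℝ)
  | .add x y => x.eval M + y.eval M
  | .sub x y => x.eval M - y.eval M
  | .mul x y => x.eval M * y.eval M
  | .div x y => x.eval M / y.eval M
  | .sqrt x => Real.sqrt (x.eval M)

/-- The truth of a test. -/
def BExp.holds (M : Mem) : BExp → Prop
  | .ltN a b => a.eval M < b.eval M
  | .ltR x y => x.eval M < y.eval M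
  | .not t => ¬ t.holds M

/-- Write an integer cell. -/
def Mem.setNat (M : Mem) (a v : ℕ) : Mem := { M with nat := Function.update M.nat a v }

/-- Write a real cell. -/
noncomputable def Mem.setReal (M : Mem) (a : ℕ) (v : ℝ) : Mem :=
  { M with real := Function.update M.real a v }

/-! ## Quantum part of the machine -/

/-- Elementary one-qubit gates. The angle of `phase` is measured in full turns. -/
inductive Gate : Type
  | X
  | H
  | phase (θ : RExp)

/-- The `2 × 2` matrices of the elementary gates. -/
noncomputable def Gate.matrix (M : Mem) : Gate → Matrix Bool Bool ℂ
  | .X => fun a b => if a = b then 0 else 1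
  | .H => fun a b => if a && b then -((1 / Real.sqrt 2 : ℝ) : ℂ) else ((1 / Real.sqrt 2 : ℝ) : ℂ)
  | .phase θ => fun a b =>
      if a = b then
        (if a then Complex.exp (2 * Real.pi * Complex.I * ((θ.eval M : ℝ) : ℂ)) else 1)
      else 0

/-- A one-qubit matrix as a matrix on the bit strings of length one. -/
def onOne (G : Matrix Bool Bool ℂ) : Matrix (Fin 1 → Bool) (Fin 1 → Bool) ℂ :=
  fun u v => G (u 0) (v 0)

/-- `U` itself, or its adjoint when the flag is set. -/
def adj {ι : Type} (inv : Bool) (U : Matrix ι ι ℂ) : Matrix ι ι ℂ :=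
  if inv then U.conjTranspose else U

/-- Apply the matrix `U` to the qubits `r i` (`i : ι`) of a `Q`-qubit register, controlled on all
the qubits in `cs` being `1`. The state is given by its amplitudes. -/
noncomputable def actOn {Q : ℕ} {ι : Type} [Fintype ι] [DecidableEq ι]
    (cs : List (Fin Q)) (r : ι ↪ Fin Q) (U : Matrix (ι → Bool) (ι → Bool) ℂ)
    (ψ : Bits Q → ℂ) : Bits Q → ℂ :=
  fun b => if ∀ p ∈ cs, b p = true then
      ∑ v : ι → Bool, U (fun i => b (r i)) v * ψ (Function.extend r v b)
    else ψ b

/-- The projection onto the outcome `o` of a measurement of the qubit `q` (not normalized). -/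
def project {Q : ℕ} (q : Fin Q) (o : Bool) (ψ : Bits Q → ℂ) : Bits Q → ℂ :=
  fun b => if b q = o then ψ b else 0

/-- Black boxes that a program may call, with the time that a call takes:
`load` acts on an index register of `l` qubits and a data register of `n` qubits,
`prep t` (`t < w`) on an index register, and `feat` on a data register and a feature register
of `N` qubits. -/
structure BlackBoxes (l n N w : ℕ) where
  load : Matrix (Fin l ⊕ Fin n → Bool) (Fin l ⊕ Fin n → Bool) ℂ
  prep : Fin w → Matrix (Fin l → Bool) (Fin l → Bool) ℂ
  feat : Matrix (Fin n ⊕ Fin N → Bool) (Fin n ⊕ Fin N → Bool) ℂ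
  queryTime : ℝ
  featTime : ℝ

/-- Programs of a classical random access machine that controls a quantum register.
Every operation on qubits carries a list of control qubits; the black boxes are applied to
contiguous blocks of qubits given by their first addresses, and can be inverted. -/
inductive Program : Type
  | setN (a v : NExp)
  | setR (a : NExp) (v : RExp)
  | gate (cs : List NExp) (g : Gate) (q : NExp)
  | load (inv : Bool) (cs : List NExp) (a b : NExp)
  | prep (inv : Bool) (cs : List NExp) (t a : NExp)
  | feat (inv : Bool) (cs : List NExp) (a b : NExp)
  | measure (q a : NExp)
  | seq (P P₁ : Program)
  | ite (t : BExp) (P P₁ : Program)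
  | loop (t : BExp) (P : Program)

/-- A branch of a computation: the classical memory, the unnormalized state of the `Q` qubits
(its squared norm is the probability of the branch), and the time spent so far. -/
structure Branch (Q : ℕ) where
  mem : Mem
  state : Bits Q → ℂ
  time : ℝ

/-- The probability of a branch. -/
noncomputable def Branch.weight {Q : ℕ} (s : Branch Q) : ℝ := ∑ b : Bits Q, ‖s.state b‖ ^ 2

/-- Let the clock advance. -/
def Branch.spend {Q : ℕ} (s : Branch Q) (t : ℝ) : Branch Q := { s with time := s.time + t }

/-- Transform the quantum state in time `t`. -/
noncomputable def Branch.apply {Q : ℕ} {ι : Type} [Fintype ι] [DecidableEq ι] (s : Branch Q)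
    (cs : List (Fin Q)) (r : ι ↪ Fin Q) (U : Matrix (ι → Bool) (ι → Bool) ℂ) (t : ℝ) :
    Branch Q :=
  ⟨s.mem, actOn cs r U s.state, s.time + t⟩

/-- The branch of outcome `o` when qubit `q` is measured and the outcome written to the integer
cell `a`. -/
def Branch.outcome {Q : ℕ} (s : Branch Q) (q : Fin Q) (a : ℕ) (o : Bool) : Branch Q :=
  ⟨s.mem.setNat a (if o then 1 else 0), project q o s.state, s.time + 1⟩

/-- The addresses of a block of `l` qubits that starts at `a`. -/
def block (l a : ℕ) : Fin l → ℕ := fun i => a + i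

/-- `Wired M cs cq addr r`: the expressions `cs` evaluate to the addresses of the control qubits
`cq`, the map `r` sends `i` to the qubit with address `addr i`, and no control is a target. -/
def Wired {Q : ℕ} {ι : Type} (M : Mem) (cs : List NExp) (cq : List (Fin Q))
    (addr : ι → ℕ) (r : ι ↪ Fin Q) : Prop :=
  cq.map (fun p => (p : ℕ)) = cs.map (fun a => a.eval M) ∧
    (∀ i, (r i : ℕ) = addr i) ∧ ∀ i, r i ∉ cq

/-- `Exec B P s L`: started in the branch `s`, the program `P` halts on every sequence of
measurement outcomes, and `L` lists the branches in which it ends. A classical instruction, a test,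
an elementary gate and a measurement take one unit of time. -/
inductive Exec {l n N w : ℕ} (B : BlackBoxes l n N w) {Q : ℕ} :
    Program → Branch Q → List (Branch Q) → Prop
  | setN (a v : NExp) (s : Branch Q) :
      Exec B (.setN a v) s [⟨s.mem.setNat (a.eval s.mem) (v.eval s.mem), s.state, s.time + 1⟩]
  | setR (a : NExp) (v : RExp) (s : Branch Q) :
      Exec B (.setR a v) s [⟨s.mem.setReal (a.eval s.mem) (v.eval s.mem), s.state, s.time + 1⟩]
  | gate (cs : List NExp) (g : Gate) (q : NExp) (s : Branch Q)
      (cq : List (Fin Q)) (r : Fin 1 ↪ Fin Q)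
      (h : Wired s.mem cs cq (fun _ => q.eval s.mem) r) :
      Exec B (.gate cs g q) s [s.apply cq r (onOne (g.matrix s.mem)) 1]
  | load (inv : Bool) (cs : List NExp) (a b : NExp) (s : Branch Q)
      (cq : List (Fin Q)) (r : Fin l ⊕ Fin n ↪ Fin Q)
      (h : Wired s.mem cs cq
        (Sum.elim (block l (a.eval s.mem)) (block n (b.eval s.mem))) r) :
      Exec B (.load inv cs a b) s [s.apply cq r (adj inv B.load) (1 + B.queryTime)]
  | prep (inv : Bool) (cs : List NExp) (t a : NExp) (s : Branch Q)
      (cq : List (Fin Q)) (r : Fin l ↪ Fin Q) (j : Fin w) (hj : (j : ℕ) = t.eval s.mem)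
      (h : Wired s.mem cs cq (block l (a.eval s.mem)) r) :
      Exec B (.prep inv cs t a) s [s.apply cq r (adj inv (B.prep j)) (1 + B.queryTime)]
  | feat (inv : Bool) (cs : List NExp) (a b : NExp) (s : Branch Q)
      (cq : List (Fin Q)) (r : Fin n ⊕ Fin N ↪ Fin Q)
      (h : Wired s.mem cs cq
        (Sum.elim (block n (a.eval s.mem)) (block N (b.eval s.mem))) r) :
      Exec B (.feat inv cs a b) s [s.apply cq r (adj inv B.feat) (1 + B.featTime)]
  | measure (q a : NExp) (s : Branch Q) (p : Fin Q) (hp : (p : ℕ) = q.eval s.mem) :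
      Exec B (.measure q a) s
        [s.outcome p (a.eval s.mem) false, s.outcome p (a.eval s.mem) true]
  | seq (P P₁ : Program) (s : Branch Q) (L : List (Branch Q)) (f : Branch Q → List (Branch Q))
      (h : Exec B P s L) (h₁ : ∀ u ∈ L, Exec B P₁ u (f u)) :
      Exec B (.seq P P₁) s (L.flatMap f)
  | iteTrue (t : BExp) (P P₁ : Program) (s : Branch Q) (L : List (Branch Q))
      (ht : t.holds s.mem) (h : Exec B P (s.spend 1) L) :
      Exec B (.ite t P P₁) s L
  | iteFalse (t : BExp) (P P₁ : Program) (s : Branch Q) (L : List (Branch Q))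
      (ht : ¬ t.holds s.mem) (h : Exec B P₁ (s.spend 1) L) :
      Exec B (.ite t P P₁) s L
  | loopDone (t : BExp) (P : Program) (s : Branch Q) (ht : ¬ t.holds s.mem) :
      Exec B (.loop t P) s [s.spend 1]
  | loopStep (t : BExp) (P : Program) (s : Branch Q) (L : List (Branch Q))
      (f : Branch Q → List (Branch Q)) (ht : t.holds s.mem)
      (h : Exec B P (s.spend 1) L) (h₁ : ∀ u ∈ L, Exec B (.loop t P) u (f u)) :
      Exec B (.loop t P) s (L.flatMap f)

open Classical in
/-- The probability that the final branch has the property `p`. -/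
noncomputable def probability {Q : ℕ} (L : List (Branch Q)) (p : Branch Q → Prop) : ℝ :=
  (L.map fun s => if p s then s.weight else 0).sum

/-- The initial branch: all qubits are `0`, no time has been spent. -/
def start (Q : ℕ) (M : Mem) : Branch Q :=
  ⟨M, fun b => if b = zeros (Fin Q) then 1 else 0, 0⟩

/-! ## What the black boxes do -/

/-- One query of a memory that holds the bit strings `x j`: `|j⟩|0⟩ ↦ |j⟩|x j⟩`. -/
def LoadsData {m l n : ℕ} (U : Matrix (Fin l ⊕ Fin n → Bool) (Fin l ⊕ Fin n → Bool) ℂ)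
    (x : Fin m → Bits n) : Prop :=
  U ∈ Matrix.unitaryGroup (Fin l ⊕ Fin n → Bool) ℂ ∧
    ∀ (j : Fin m) (u : Fin l ⊕ Fin n → Bool),
      U u (Sum.elim (binary l j) (zeros (Fin n))) =
        if u = Sum.elim (binary l j) (x j) then 1 else 0

/-- One query of a memory that holds the real vector `v`: `|0⟩ ↦ ‖v‖⁻¹ ∑ j, v j |j⟩`. -/
def PreparesVector {m l : ℕ} (U : Matrix (Fin l → Bool) (Fin l → Bool) ℂ)
    (v : EuclideanSpace ℝ (Fin m)) : Prop :=
  U ∈ Matrix.unitaryGroup (Fin l → Bool) ℂ ∧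
    ∀ b : Fin l → Bool, U b (zeros (Fin l)) =
      ((∑ j : Fin m, if binary l j = b then v j / ‖v‖ else 0 : ℝ) : ℂ)

/-- `U` is a quantum feature map realizing `Φ`: `U |x⟩|0⟩ = |x⟩ ‖Φ x‖⁻¹ ∑ b, (Φ x) b |b⟩`
for all `x` (there is no condition where `Φ x = 0`). -/
def IsQuantumFeatureMap {n N : ℕ} (U : Matrix (Fin n ⊕ Fin N → Bool) (Fin n ⊕ Fin N → Bool) ℂ)
    (Φ : Bits n → EuclideanSpace ℝ (Bits N)) : Prop :=
  U ∈ Matrix.unitaryGroup (Fin n ⊕ Fin N → Bool) ℂ ∧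
    ∀ x : Bits n, Φ x ≠ 0 → ∀ (z : Bits n) (b : Bits N),
      U (Sum.elim z b) (Sum.elim x (zeros (Fin N))) =
        if z = x then ((Φ x b / ‖Φ x‖ : ℝ) : ℂ) else 0

/-! ## The vectors attached to a data set -/

/-- A bit as a real number. -/
def bit (b : Bool) : ℝ := if b then 1 else 0

/-- A label `±1` as a real number. -/
def label (y : ℤˣ) : ℝ := ((y : ℤ) : ℝ)

/-- `Ψ_c = (1 / m) ∑ i, c i y i Φ(x i)`. -/
noncomputable def featureSum {m n N : ℕ} (x : Fin m → Bits n) (y : Fin m → ℤˣ)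
    (Φ : Bits n → EuclideanSpace ℝ (Bits N)) (c : Bits m) : EuclideanSpace ℝ (Bits N) :=
  (1 / (m : ℝ)) • ∑ i, (bit (c i) * label (y i)) • Φ (x i)

/-- `η_c = √((∑ i, c i ‖Φ(x i)‖²) / m)`. -/
noncomputable def eta {m n N : ℕ} (x : Fin m → Bits n)
    (Φ : Bits n → EuclideanSpace ℝ (Bits N)) (c : Bits m) : ℝ :=
  Real.sqrt ((∑ i, bit (c i) * ‖Φ (x i)‖ ^ 2) / m)

/-- The vector with entries `c i y i ‖Φ(x i)‖ / √m`. -/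
noncomputable def storedVector {m n N : ℕ} (x : Fin m → Bits n) (y : Fin m → ℤˣ)
    (Φ : Bits n → EuclideanSpace ℝ (Bits N)) (c : Bits m) : EuclideanSpace ℝ (Fin m) :=
  WithLp.toLp 2 fun i => bit (c i) * label (y i) / Real.sqrt m * ‖Φ (x i)‖

/-- The largest feature norm `R = max_j ‖Φ(x j)‖` (the index `i` shows that there is one). -/
noncomputable def maxNorm {m n N : ℕ} (x : Fin m → Bits n)
    (Φ : Bits n → EuclideanSpace ℝ (Bits N)) (i : Fin m) : ℝ :=
  Finset.univ.sup' ⟨i, Finset.mem_univ i⟩ fun j => ‖Φ (x j)‖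

/-- The classical input. Integer cells: the lengths `l, n, N` of the index, data and feature
registers, the numbers `m` and `w`, and the index `i`. Real cells: `C, ε, δ, R, y_i, ‖Φ(x_i)‖`, and,
for `t < w`, the values `α` and `η` of the `t`-th element of `W` in the cells `6 + 2 t`
and `7 + 2 t`. All other cells are `0`. -/
noncomputable def inputMem (l n N m w i : ℕ) (C ε δ R yi nu : ℝ) (α η : Fin w → ℝ) : Mem where
  nat a := match a with
    | 0 => l
    | 1 => n
    | 2 => N
    | 3 => m
    | 4 => w
    | 5 => i
    | _ => 0
  real a := match a with
    | 0 => C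
    | 1 => ε
    | 2 => δ
    | 3 => R
    | 4 => yi
    | 5 => nu
    | a + 6 =>
      if h : a / 2 < w then (if a % 2 = 0 then α ⟨a / 2, h⟩ else η ⟨a / 2, h⟩) else 0

/-!
For every `c ∈ W` the program estimates the inner product of `Ψ_c` and `Φ (x i)` on a fresh block
of qubits, and it adds up the estimates with the weights `α_c`.

*Two states.* One qubit of the block selects which of two states is prepared on the index register
and the feature register: with the qRAM and the feature map either
`∑ j, (v j / ‖v‖) |j⟩ |Φ (x j) / ‖Φ (x j)‖⟩`, where `v` is the stored vector of `c`, or the uniform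
superposition of all indices (and of two further qubits) together with `|Φ (x i) / ‖Φ (x i)‖⟩`.
The inner product of these states, `overlap`, is a known multiple of `⟪Ψ_c, Φ (x i)⟫`
(`mul_overlap`), and it is at most `1 / 2` in absolute value because `‖Ψ_c‖ ≤ η_c` and `m ≤ 2 ^ l`
(`abs_overlap_le`).

*A rotation.* Preparing both states in superposition, exchanging them and undoing the preparation
is an involution whose expectation in the zero state is the overlap (`mirrorU_apply`). Followed by
the sign change of the zero state it is a rotation of a plane by the angle `arccos (-overlap)`
(`walkU_plane`); thus the zero state is the sum of two eigenvectors of equal norm with opposite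
phases (`exists_eigenPair`, `exists_plane`).

*Phase estimation.* A Hadamard test of the power `K` of the rotation, with a phase gate that
subtracts the current estimate, has a bias which is the sine of `K` times the error of the estimate
(`norm_testAmp_sq`), and leaves the state in the plane (`Plane.outcome`). A round of logarithmically
many tests decides the sign of the bias, or that it is small (`leads_round`); this halves the
interval that contains the phase (`abs_sub_le_of_correct`), and then `K` is doubled
(`leads_estimate`). The machine has no trigonometric functions, so the cosines and sines of the
estimate and of the step are kept up to date by the addition and half-angle formulas. The powers of
the rotation add up to a multiple of the inverse of the precision of the cosine. As
`R ≥ η_c ≥ ‖Ψ_c‖`, a precision of the order of `ε / (C R ‖Φ (x i)‖)` for each of the `|W|` vectors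
is enough (`sum_error_le`) and stays within the bound of the running time (`total_time_le`). If
`ε ≥ C R ‖Φ (x i)‖`, then `0` is an admissible answer.

*Probabilities.* The branches of a computation carry unnormalized states, so a probability is a sum
of squared norms. `Leads` says that a program ends in branches over which a functional adds up to at
least a given number; such statements compose along programs and loops. Within a round the
functional is the weight of the good components minus an exponential of the deviation of the sum of
the outcomes from its mean, which is a supermartingale (`deviation_step`); it thus yields a
Chernoff bound for each of the two eigenvectors, although the tests are performed on a superposition
of them.
-/

open Matrix

/-! ### Unitary operations on a part of a register -/

/-- The unitary operators on the state space of `Q` qubits. -/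
abbrev UOp (Q : ℕ) := Matrix.unitaryGroup (Bits Q) ℂ

/-- The basis state `|b⟩`. -/
def ket {Q : ℕ} (b : Bits Q) : Bits Q → ℂ := Pi.single b 1

theorem ket_apply {Q : ℕ} (b b' : Bits Q) : ket b b' = if b' = b then 1 else 0 := by
  simp [ket, Pi.single_apply]

theorem eq_sum_ket {Q : ℕ} (ψ : Bits Q → ℂ) : ψ = ∑ b, ψ b • ket b := by
  ext b
  simp [Finset.sum_apply, ket_apply]

theorem mulVec_sum_smul {Q : ℕ} {J : Type*} (s : Finset J) (U : Matrix (Bits Q) (Bits Q) ℂ)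
    (c : J → ℂ) (f : J → Bits Q → ℂ) :
    U *ᵥ (∑ j ∈ s, c j • f j) = ∑ j ∈ s, c j • (U *ᵥ f j) := by
  rw [Matrix.mulVec_sum]
  exact Finset.sum_congr rfl fun j _ => Matrix.mulVec_smul _ _ _

section ActOn

variable {Q : ℕ} {ι : Type}

theorem extend_at (r : ι ↪ Fin Q) (v : ι → Bool) (b : Bits Q) (i : ι) :
    Function.extend r v b (r i) = v i := r.injective.extend_apply _ _ _

theorem extend_extend (r : ι ↪ Fin Q) (u v : ι → Bool) (b : Bits Q) :
    Function.extend r u (Function.extend r v b) = Function.extend r u b := by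
  ext p
  by_cases h : ∃ i, r i = p
  · obtain ⟨i, rfl⟩ := h
    simp [extend_at]
  · simp [Function.extend_apply' _ _ _ h]

theorem extend_self (r : ι ↪ Fin Q) (b : Bits Q) :
    Function.extend r (fun i => b (r i)) b = b := by
  ext p
  by_cases h : ∃ i, r i = p
  · obtain ⟨i, rfl⟩ := h
    simp [extend_at]
  · simp [Function.extend_apply' _ _ _ h]

theorem extend_of_notMem (r : ι ↪ Fin Q) (v : ι → Bool) (b : Bits Q) {p : Fin Q}
    (h : ∀ i, r i ≠ p) : Function.extend r v b p = b p :=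
  Function.extend_apply' _ _ _ (by rintro ⟨i, hi⟩; exact h i hi)

theorem controls_extend {cs : List (Fin Q)} {r : ι ↪ Fin Q} (hr : ∀ i, r i ∉ cs)
    (v : ι → Bool) (b : Bits Q) :
    (∀ p ∈ cs, Function.extend r v b p = true) ↔ ∀ p ∈ cs, b p = true := by
  refine forall₂_congr fun p hp => ?_
  rw [extend_of_notMem]
  rintro i rfl
  exact hr i hp

variable [Fintype ι] [DecidableEq ι]

/-- `actOn` as a linear map. -/
noncomputable def actLin (cs : List (Fin Q)) (r : ι ↪ Fin Q)
    (U : Matrix (ι → Bool) (ι → Bool) ℂ) : (Bits Q → ℂ) →ₗ[ℂ] (Bits Q → ℂ) where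
  toFun := actOn cs r U
  map_add' φ ψ := by
    ext b
    simp only [actOn, Pi.add_apply]
    split_ifs
    · rw [← Finset.sum_add_distrib]
      exact Finset.sum_congr rfl fun _ _ => by ring
    · rfl
  map_smul' c ψ := by
    ext b
    simp only [actOn, Pi.smul_apply, smul_eq_mul, RingHom.id_apply]
    split_ifs
    · rw [Finset.mul_sum]
      exact Finset.sum_congr rfl fun _ _ => by ring
    · rfl

theorem actOn_mul {cs : List (Fin Q)} {r : ι ↪ Fin Q} (hr : ∀ i, r i ∉ cs)
    (U V : Matrix (ι → Bool) (ι → Bool) ℂ) (ψ : Bits Q → ℂ) :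
    actOn cs r U (actOn cs r V ψ) = actOn cs r (U * V) ψ := by
  ext b
  simp only [actOn, controls_extend hr, extend_extend, extend_at]
  split_ifs with h
  · simp only [Matrix.mul_apply, Finset.mul_sum, Finset.sum_mul]
    rw [Finset.sum_comm]
    exact Finset.sum_congr rfl fun _ _ => Finset.sum_congr rfl fun _ _ => by ring
  · rfl

theorem actOn_one {cs : List (Fin Q)} {r : ι ↪ Fin Q} (ψ : Bits Q → ℂ) :
    actOn cs r 1 ψ = ψ := by
  ext b
  simp only [actOn]
  split_ifs with h
  · simp [Matrix.one_apply, extend_self]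
  · rfl

theorem actOn_ket {cs : List (Fin Q)} {r : ι ↪ Fin Q} (hr : ∀ i, r i ∉ cs)
    (U : Matrix (ι → Bool) (ι → Bool) ℂ) (b : Bits Q) :
    actOn cs r U (ket b) = if ∀ p ∈ cs, b p = true then
      ∑ u : ι → Bool, U u (fun i => b (r i)) • ket (Function.extend r u b) else ket b := by
  ext b'
  by_cases hb : ∃ u, b' = Function.extend r u b
  · obtain ⟨u, rfl⟩ := hb
    simp only [actOn, controls_extend hr, extend_extend, extend_at]
    split_ifs with h
    · simp only [ket_apply, Finset.sum_apply, Pi.smul_apply, smul_eq_mul, mul_ite, mul_one,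
        mul_zero]
      have h1 : ∀ v : ι → Bool, Function.extend r v b = b ↔ v = fun i => b (r i) := by
        intro v
        constructor
        · intro h
          funext i
          rw [← extend_at r v b i, h]
        · rintro rfl
          exact extend_self r b
      have h2 : ∀ v : ι → Bool, Function.extend r u b = Function.extend r v b ↔ u = v := by
        intro v
        constructor
        · intro h
          funext i
          rw [← extend_at r v b i, ← h, extend_at]
        · rintro rfl
          rfl
      simp [h1, h2]
    · rfl
  · have h1 : b' ≠ b := by
      rintro rfl
      exact hb ⟨_, (extend_self r b').symm⟩
    have h2 : ∀ v : ι → Bool, Function.extend r v b' ≠ b := by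
      rintro v rfl
      exact hb ⟨fun i => b' (r i), by rw [extend_extend, extend_self]⟩
    have h3 : ∀ v : ι → Bool, b' ≠ Function.extend r v b := fun v h => hb ⟨v, h⟩
    simp only [actOn, ket_apply]
    split_ifs <;> simp_all [ket_apply]

/-- The matrix of `actOn`. -/
noncomputable def actMat (cs : List (Fin Q)) (r : ι ↪ Fin Q)
    (U : Matrix (ι → Bool) (ι → Bool) ℂ) : Matrix (Bits Q) (Bits Q) ℂ :=
  LinearMap.toMatrix' (actLin cs r U)

theorem actMat_mulVec (cs : List (Fin Q)) (r : ι ↪ Fin Q)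
    (U : Matrix (ι → Bool) (ι → Bool) ℂ) (ψ : Bits Q → ℂ) :
    actMat cs r U *ᵥ ψ = actOn cs r U ψ := LinearMap.toMatrix'_mulVec _ _

theorem actMat_apply (cs : List (Fin Q)) (r : ι ↪ Fin Q)
    (U : Matrix (ι → Bool) (ι → Bool) ℂ) (b b' : Bits Q) :
    actMat cs r U b b' = actOn cs r U (ket b') b := by
  rw [← actMat_mulVec, ket, Matrix.mulVec_single_one, Matrix.col_apply]

theorem actMat_mul {cs : List (Fin Q)} {r : ι ↪ Fin Q} (hr : ∀ i, r i ∉ cs)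
    (U V : Matrix (ι → Bool) (ι → Bool) ℂ) :
    actMat cs r U * actMat cs r V = actMat cs r (U * V) := by
  unfold actMat
  rw [← LinearMap.toMatrix'_comp]
  exact congrArg _ (LinearMap.ext fun ψ => actOn_mul hr U V ψ)

theorem actMat_one (cs : List (Fin Q)) (r : ι ↪ Fin Q) :
    actMat cs r (1 : Matrix (ι → Bool) (ι → Bool) ℂ) = 1 := by
  have : actLin cs r (1 : Matrix (ι → Bool) (ι → Bool) ℂ) = LinearMap.id :=
    LinearMap.ext fun ψ => actOn_one ψ
  rw [actMat, this, LinearMap.toMatrix'_id]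

theorem actMat_conjTranspose {cs : List (Fin Q)} {r : ι ↪ Fin Q} (hr : ∀ i, r i ∉ cs)
    (U : Matrix (ι → Bool) (ι → Bool) ℂ) : (actMat cs r U)ᴴ = actMat cs r Uᴴ := by
  ext b b'
  rw [Matrix.conjTranspose_apply, actMat_apply, actMat_apply, actOn_ket hr]
  by_cases hb : ∃ u, b' = Function.extend r u b
  · obtain ⟨u, rfl⟩ := hb
    have h2 : ∀ v w : ι → Bool, Function.extend r v b = Function.extend r w b ↔ v = w := by
      intro v w
      constructor
      · intro h
        funext i
        rw [← extend_at r v b i, h, extend_at]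
      · rintro rfl
        rfl
    rw [actOn_ket hr]
    simp only [controls_extend hr, extend_extend, extend_at]
    split_ifs with h
    · have h3 : ∀ v : ι → Bool, b = Function.extend r v b ↔ (fun i => b (r i)) = v := by
        intro v
        conv_lhs => lhs; rw [← extend_self r b]
        exact h2 _ _
      simp [Finset.sum_apply, ket_apply, h2, h3]
    · simp only [ket_apply, eq_comm]
      split_ifs <;> simp
  · have h1 : b ≠ b' := by
      rintro rfl
      exact hb ⟨_, (extend_self r b).symm⟩
    have h2 : ∀ v : ι → Bool, b ≠ Function.extend r v b' := by
      intro v h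
      exact hb ⟨fun i => b' (r i), by rw [h, extend_extend, extend_self]⟩
    have h3 : ∀ v : ι → Bool, b' ≠ Function.extend r v b := fun v h => hb ⟨v, h⟩
    rw [actOn_ket hr]
    split_ifs <;> simp [ket_apply, h1, h1.symm, h2, h3]

/-- A unitary operator on some qubits, with control qubits that are not among them, as an operator
on the whole register. -/
noncomputable def controlled (cs : List (Fin Q)) (r : ι ↪ Fin Q) (hr : ∀ i, r i ∉ cs) :
    Matrix.unitaryGroup (ι → Bool) ℂ →* UOp Q where
  toFun U := ⟨actMat cs r U, by
    rw [Matrix.mem_unitaryGroup_iff, Matrix.star_eq_conjTranspose, actMat_conjTranspose hr,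
      actMat_mul hr, ← Matrix.star_eq_conjTranspose, Matrix.mem_unitaryGroup_iff.1 U.2,
      actMat_one]⟩
  map_one' := Subtype.ext (actMat_one cs r)
  map_mul' U V := Subtype.ext (actMat_mul hr U V).symm

theorem controlled_mulVec {cs : List (Fin Q)} {r : ι ↪ Fin Q} (hr : ∀ i, r i ∉ cs)
    (U : Matrix.unitaryGroup (ι → Bool) ℂ) (ψ : Bits Q → ℂ) :
    (controlled cs r hr U).1 *ᵥ ψ = actOn cs r U.1 ψ := actMat_mulVec _ _ _ _

end ActOn

/-! ### Inner products and weights -/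

section Inner

variable {Q : ℕ}

/-- The inner product of two states. -/
noncomputable def inn (φ ψ : Bits Q → ℂ) : ℂ := star φ ⬝ᵥ ψ

/-- The squared norm of a state. -/
noncomputable def nsq (ψ : Bits Q → ℂ) : ℝ := ∑ b, ‖ψ b‖ ^ 2

theorem inn_self (ψ : Bits Q → ℂ) : inn ψ ψ = (nsq ψ : ℂ) := by
  simp only [inn, nsq, dotProduct, Pi.star_apply, RCLike.star_def, Complex.conj_mul']
  push_cast
  rfl

theorem inn_mulVec (U : UOp Q) (φ ψ : Bits Q → ℂ) :
    inn (U.1 *ᵥ φ) (U.1 *ᵥ ψ) = inn φ ψ := by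
  rw [inn, Matrix.star_mulVec, Matrix.dotProduct_mulVec, Matrix.vecMul_vecMul,
    ← Matrix.star_eq_conjTranspose, Matrix.mem_unitaryGroup_iff'.1 U.2, Matrix.vecMul_one, inn]

theorem inn_add_right (φ ψ χ : Bits Q → ℂ) : inn φ (ψ + χ) = inn φ ψ + inn φ χ :=
  dotProduct_add _ _ _

theorem inn_sub_right (φ ψ χ : Bits Q → ℂ) : inn φ (ψ - χ) = inn φ ψ - inn φ χ :=
  dotProduct_sub _ _ _

theorem inn_add_left (φ ψ χ : Bits Q → ℂ) : inn (φ + ψ) χ = inn φ χ + inn ψ χ := by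
  simp [inn, add_dotProduct]

theorem inn_smul_right (c : ℂ) (φ ψ : Bits Q → ℂ) : inn φ (c • ψ) = c * inn φ ψ := by
  simp [inn]

theorem inn_smul_left (c : ℂ) (φ ψ : Bits Q → ℂ) : inn (c • φ) ψ = star c * inn φ ψ := by
  simp [inn, star_smul]

theorem inn_conj (φ ψ : Bits Q → ℂ) : star (inn φ ψ) = inn ψ φ := by
  simp only [inn, dotProduct, star_sum, star_mul', Pi.star_apply, star_star]
  exact Finset.sum_congr rfl fun _ _ => mul_comm _ _

theorem inn_ket (b : Bits Q) (ψ : Bits Q → ℂ) : inn (ket b) ψ = ψ b := by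
  simp [inn, dotProduct, ket_apply]

theorem nsq_mulVec (U : UOp Q) (ψ : Bits Q → ℂ) : nsq (U.1 *ᵥ ψ) = nsq ψ := by
  have := inn_mulVec U ψ ψ
  rw [inn_self, inn_self] at this
  exact_mod_cast this

theorem nsq_nonneg (ψ : Bits Q → ℂ) : 0 ≤ nsq ψ := Finset.sum_nonneg fun _ _ => by positivity

theorem UOp.mul_mulVec (U V : UOp Q) (ψ : Bits Q → ℂ) :
    (U * V).1 *ᵥ ψ = U.1 *ᵥ (V.1 *ᵥ ψ) := by
  rw [Matrix.mulVec_mulVec]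
  rfl

theorem UOp.one_mulVec (ψ : Bits Q → ℂ) : (1 : UOp Q).1 *ᵥ ψ = ψ := Matrix.one_mulVec ψ

theorem UOp.inv_mulVec_eq {U : UOp Q} {φ ψ : Bits Q → ℂ} (h : U.1 *ᵥ φ = ψ) :
    (U⁻¹).1 *ᵥ ψ = φ := by
  rw [← h, ← UOp.mul_mulVec, inv_mul_cancel, UOp.one_mulVec]

theorem inn_inv (U : UOp Q) (φ ψ : Bits Q → ℂ) :
    inn φ ((U⁻¹).1 *ᵥ ψ) = inn (U.1 *ᵥ φ) ψ := by
  rw [← inn_mulVec U, ← UOp.mul_mulVec, mul_inv_cancel, UOp.one_mulVec]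

end Inner

/-! ### Operations on qubits given by their addresses -/

section Address

variable {Q : ℕ} {ι : Type}

/-- The basis state whose qubit with address `a` has the value `f a`. The values of `f` from `Q` on
play no role; with functions on `ℕ`, addresses need no proofs that they are in range. -/
def kt {Q : ℕ} (f : ℕ → Bool) : Bits Q → ℂ := ket fun p => f p

/-- Control addresses `cs` and target addresses `addr` that describe an operation on `Q` qubits. -/
structure Valid (Q : ℕ) (cs : List ℕ) (addr : ι → ℕ) : Prop where
  pos : 0 < Q
  controls_lt : ∀ c ∈ cs, c < Q
  targets_lt : ∀ i, addr i < Q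
  inj : Function.Injective addr
  disjoint : ∀ i, addr i ∉ cs

/-- The targets of a valid operation, as qubits. -/
def Valid.target {cs : List ℕ} {addr : ι → ℕ} (h : Valid Q cs addr) : ι ↪ Fin Q :=
  ⟨fun i => ⟨addr i, h.targets_lt i⟩, fun _ _ hij => h.inj (congrArg Fin.val hij)⟩

/-- The controls of a valid operation, as qubits. -/
def Valid.control {cs : List ℕ} {addr : ι → ℕ} (h : Valid Q cs addr) : List (Fin Q) :=
  cs.map fun c => ⟨c % Q, Nat.mod_lt _ h.pos⟩

theorem Valid.map_control {cs : List ℕ} {addr : ι → ℕ} (h : Valid Q cs addr) :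
    h.control.map (fun p : Fin Q => (p : ℕ)) = cs := by
  rw [Valid.control, List.map_map]
  conv_rhs => rw [← List.map_id cs]
  exact List.map_congr_left fun c hc => Nat.mod_eq_of_lt (h.controls_lt c hc)

theorem Valid.forall_control {cs : List ℕ} {addr : ι → ℕ} (h : Valid Q cs addr)
    (P : ℕ → Prop) : (∀ p ∈ h.control, P p) ↔ ∀ c ∈ cs, P c := by
  conv_rhs => rw [← h.map_control]
  simp

theorem Valid.target_notMem {cs : List ℕ} {addr : ι → ℕ} (h : Valid Q cs addr) (i : ι) :
    h.target i ∉ h.control := by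
  intro hi
  exact (h.forall_control (fun c => c ≠ addr i)).2 (fun c hc e => h.disjoint i (e ▸ hc)) _ hi rfl

theorem Valid.extend_target {cs : List ℕ} {addr : ι → ℕ} (h : Valid Q cs addr)
    (u : ι → Bool) (f : ℕ → Bool) :
    Function.extend h.target u (fun p : Fin Q => f p) =
      fun p : Fin Q => Function.extend addr u f p := by
  ext p
  by_cases hp : ∃ i, h.target i = p
  · obtain ⟨i, rfl⟩ := hp
    rw [extend_at]
    exact (h.inj.extend_apply _ _ _).symm
  · have hp' : ¬ ∃ i, addr i = p := fun ⟨i, hi⟩ => hp ⟨i, Fin.ext hi⟩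
    rw [Function.extend_apply' _ _ _ hp, Function.extend_apply' _ _ _ hp']

variable [Fintype ι] [DecidableEq ι]

open Classical in
/-- A unitary operator applied to the qubits with addresses `addr`, controlled on the qubits with
addresses `cs`; the identity when these addresses do not describe an operation on `Q` qubits. -/
noncomputable def opAt (Q : ℕ) (cs : List ℕ) (addr : ι → ℕ) :
    Matrix.unitaryGroup (ι → Bool) ℂ →* UOp Q :=
  if h : Valid Q cs addr then controlled h.control h.target h.target_notMem else 1

theorem opAt_mulVec {cs : List ℕ} {addr : ι → ℕ} (h : Valid Q cs addr)
    (U : Matrix.unitaryGroup (ι → Bool) ℂ) (ψ : Bits Q → ℂ) :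
    (opAt Q cs addr U).1 *ᵥ ψ = actOn h.control h.target U.1 ψ := by
  rw [opAt, dif_pos h, controlled_mulVec]

theorem opAt_kt {cs : List ℕ} {addr : ι → ℕ} (h : Valid Q cs addr)
    (U : Matrix.unitaryGroup (ι → Bool) ℂ) (f : ℕ → Bool) :
    (opAt Q cs addr U).1 *ᵥ kt f = if ∀ c ∈ cs, f c = true then
      ∑ u : ι → Bool, U.1 u (fun i => f (addr i)) • kt (Function.extend addr u f)
      else kt f := by
  rw [opAt_mulVec h, kt, actOn_ket h.target_notMem]
  simp only [h.extend_target, h.forall_control (fun c => f c = true), kt]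
  rfl

end Address

/-! ### Qubits that an operation does not change -/

section Keeps

variable {Q : ℕ}

/-- The unitary operators that do not change the value of the qubit `p`: their matrix entries
between basis states with different values of `p` are zero. -/
def keeps (p : Fin Q) : Subgroup (UOp Q) where
  carrier := {U | ∀ b b', U.1 b b' ≠ 0 → b p = b' p}
  one_mem' b b' h := by
    by_contra hb
    exact h (Matrix.one_apply_ne fun e => hb (by rw [e]))
  mul_mem' {U V} hU hV b b' h := by
    obtain ⟨c, -, hc⟩ := Finset.exists_ne_zero_of_sum_ne_zero h
    exact (hU b c (left_ne_zero_of_mul hc)).trans (hV c b' (right_ne_zero_of_mul hc))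
  inv_mem' {U} hU b b' h := by
    refine (hU b' b fun e => h ?_).symm
    change star (U.1 b' b) = 0
    rw [e, star_zero]

/-- All values of the qubit `p` in the state `ψ` are `v`. -/
def Holds (ψ : Bits Q → ℂ) (p : Fin Q) (v : Bool) : Prop := ∀ b, ψ b ≠ 0 → b p = v

theorem Holds.mulVec {ψ : Bits Q → ℂ} {p : Fin Q} {v : Bool} (h : Holds ψ p v) {U : UOp Q}
    (hU : U ∈ keeps p) : Holds (U.1 *ᵥ ψ) p v := by
  intro b hb
  obtain ⟨c, -, hc⟩ := Finset.exists_ne_zero_of_sum_ne_zero hb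
  exact (hU b c (left_ne_zero_of_mul hc)).trans (h c (right_ne_zero_of_mul hc))

theorem Holds.add {ψ φ : Bits Q → ℂ} {p : Fin Q} {v : Bool} (h : Holds ψ p v)
    (h' : Holds φ p v) : Holds (ψ + φ) p v := by
  intro b hb
  by_contra hv
  have h1 : ψ b = 0 := by_contra fun e => hv (h b e)
  have h2 : φ b = 0 := by_contra fun e => hv (h' b e)
  exact hb (by simp [h1, h2])

theorem Holds.smul {ψ : Bits Q → ℂ} {p : Fin Q} {v : Bool} (h : Holds ψ p v) (c : ℂ) :
    Holds (c • ψ) p v := fun b hb => h b (right_ne_zero_of_mul hb)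

/-- Two operators agree on a state if they agree on the basis states that occur in it. -/
theorem mulVec_congr {A A' : Matrix (Bits Q) (Bits Q) ℂ} {ψ : Bits Q → ℂ}
    (h : ∀ b, ψ b ≠ 0 → A *ᵥ ket b = A' *ᵥ ket b) : A *ᵥ ψ = A' *ᵥ ψ := by
  rw [eq_sum_ket ψ, mulVec_sum_smul, mulVec_sum_smul]
  refine Finset.sum_congr rfl fun b _ => ?_
  by_cases hb : ψ b = 0
  · simp [hb]
  · rw [h b hb]

variable {ι : Type} [Fintype ι] [DecidableEq ι]

theorem opAt_mem_keeps (cs : List ℕ) (addr : ι → ℕ) (U : Matrix.unitaryGroup (ι → Bool) ℂ)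
    {p : Fin Q} (hp : ∀ i, addr i ≠ p) : opAt Q cs addr U ∈ keeps p := by
  by_cases h : Valid Q cs addr
  · intro b b' hb
    have e : (opAt Q cs addr U).1 b b' = actOn h.control h.target U.1 (ket b') b := by
      rw [← opAt_mulVec, ket, Matrix.mulVec_single_one, Matrix.col_apply]
    rw [e, actOn_ket h.target_notMem] at hb
    split_ifs at hb with hc
    · rw [Finset.sum_apply] at hb
      obtain ⟨u, -, hu⟩ := Finset.exists_ne_zero_of_sum_ne_zero hb
      have hu' := right_ne_zero_of_mul (a := U.1 u fun i => b' (h.target i)) hu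
      rw [ket_apply] at hu'
      have : b = Function.extend h.target u b' := by
        by_contra hne
        exact hu' (if_neg hne)
      rw [this, extend_of_notMem]
      intro i hi
      exact hp i (congrArg Fin.val hi)
    · rw [ket_apply] at hb
      have : b = b' := by
        by_contra hne
        exact hb (if_neg hne)
      rw [this]
  · rw [opAt, dif_neg h]
    exact (keeps p).one_mem

end Keeps

/-! ### Elementary gates -/

section Gates

/-- The matrix of the gate `X`. -/
def xMat : Matrix Bool Bool ℂ := fun a b => if a = b then 0 else 1

/-- The matrix of the gate `H`. -/
noncomputable def hMat : Matrix Bool Bool ℂ := fun a b =>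
  if a && b then -((1 / Real.sqrt 2 : ℝ) : ℂ) else ((1 / Real.sqrt 2 : ℝ) : ℂ)

/-- The matrix of the phase gate of angle `r`, in full turns. -/
noncomputable def phMat (r : ℝ) : Matrix Bool Bool ℂ := fun a b =>
  if a = b then (if a then Complex.exp (2 * Real.pi * Complex.I * (r : ℂ)) else 1) else 0

theorem xMat_apply (a b : Bool) : xMat a b = if a = b then 0 else 1 := rfl

theorem hMat_apply (a b : Bool) : hMat a b =
    if a && b then -((1 / Real.sqrt 2 : ℝ) : ℂ) else ((1 / Real.sqrt 2 : ℝ) : ℂ) := rfl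

theorem phMat_apply (r : ℝ) (a b : Bool) : phMat r a b = if a = b then
    (if a then Complex.exp (2 * Real.pi * Complex.I * (r : ℂ)) else 1) else 0 := rfl

theorem sqrt_half_mul_self :
    ((1 / Real.sqrt 2 : ℝ) : ℂ) * ((1 / Real.sqrt 2 : ℝ) : ℂ) = 1 / 2 := by
  rw [← Complex.ofReal_mul, div_mul_div_comm, Real.mul_self_sqrt (by norm_num)]
  norm_num

theorem xMat_conjTranspose : xMatᴴ = xMat := by
  ext i j
  rw [Matrix.conjTranspose_apply]
  cases i <;> cases j <;> simp [xMat_apply]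

theorem hMat_conjTranspose : hMatᴴ = hMat := by
  ext i j
  rw [Matrix.conjTranspose_apply]
  cases i <;> cases j <;> simp [hMat_apply]

theorem xMat_sq : xMat * xMat = 1 := by
  ext a b
  rw [Matrix.mul_apply, Fintype.sum_bool, Matrix.one_apply]
  simp only [xMat_apply]
  cases a <;> cases b <;> simp

theorem hMat_sq : hMat * hMat = 1 := by
  ext a b
  rw [Matrix.mul_apply, Fintype.sum_bool, Matrix.one_apply]
  simp only [hMat_apply]
  cases a <;> cases b <;>
    simp only [Bool.and_true, Bool.and_false, if_true, Bool.false_eq_true, if_false, mul_neg,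
      neg_mul, neg_neg, sqrt_half_mul_self, Bool.true_eq_false] <;> norm_num

theorem phMat_unitary (r : ℝ) : phMat r * (phMat r)ᴴ = 1 := by
  have h : Complex.exp (2 * Real.pi * Complex.I * (r : ℂ)) *
      (starRingEnd ℂ) (Complex.exp (2 * Real.pi * Complex.I * (r : ℂ))) = 1 := by
    rw [Complex.mul_conj', Complex.norm_exp]
    simp
  ext a b
  rw [Matrix.mul_apply, Fintype.sum_bool, Matrix.one_apply, Matrix.conjTranspose_apply,
    Matrix.conjTranspose_apply]
  simp only [phMat_apply, RCLike.star_def]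
  cases a <;> cases b <;> simp only [if_true, Bool.false_eq_true, if_false, h, map_zero,
    mul_zero, zero_mul, add_zero, zero_add, Bool.true_eq_false, map_one, mul_one]

/-- The gates of the machine are unitary, whatever the memory contains. -/
theorem gate_unitary (M : Mem) (g : Gate) : (g.matrix M) * (g.matrix M)ᴴ = 1 := by
  cases g with
  | X => change xMat * xMatᴴ = 1; rw [xMat_conjTranspose, xMat_sq]
  | H => change hMat * hMatᴴ = 1; rw [hMat_conjTranspose, hMat_sq]
  | phase θ => exact phMat_unitary _

theorem onOne_mul (G G' : Matrix Bool Bool ℂ) : onOne G * onOne G' = onOne (G * G') := by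
  ext u v
  rw [Matrix.mul_apply, ← (Equiv.funUnique (Fin 1) Bool).symm.sum_comp]
  simp only [onOne, Matrix.mul_apply]
  rfl

theorem onOne_one : onOne 1 = 1 := by
  ext u v
  have huv : u = v ↔ u 0 = v 0 := by
    rw [funext_iff]
    exact ⟨fun h => h 0, fun h i => by rw [Subsingleton.elim i 0]; exact h⟩
  simp only [onOne, Matrix.one_apply, huv]

theorem onOne_mem {G : Matrix Bool Bool ℂ} (hG : G * Gᴴ = 1) :
    onOne G ∈ Matrix.unitaryGroup (Fin 1 → Bool) ℂ := by
  rw [Matrix.mem_unitaryGroup_iff]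
  have : star (onOne G) = onOne Gᴴ := rfl
  rw [this, onOne_mul, hG, onOne_one]

open Classical in
/-- The one-qubit operation with the matrix `G`, applied to the qubit `a` with controls `cs`; the
identity when `G` is not unitary. -/
noncomputable def gateAt (Q : ℕ) (cs : List ℕ) (G : Matrix Bool Bool ℂ) (a : ℕ) : UOp Q :=
  if h : G * Gᴴ = 1 then opAt Q cs (fun _ : Fin 1 => a) ⟨onOne G, onOne_mem h⟩ else 1

theorem valid_gate {Q : ℕ} {cs : List ℕ} {a : ℕ} (ha : a < Q) (hc : ∀ c ∈ cs, c < Q ∧ c ≠ a) :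
    Valid Q cs (fun _ : Fin 1 => a) :=
  ⟨by omega, fun c h => (hc c h).1, fun _ => ha, fun _ _ _ => Subsingleton.elim _ _,
    fun _ h => (hc a h).2 rfl⟩

theorem extend_one (a : ℕ) (u : Fin 1 → Bool) (f : ℕ → Bool) :
    Function.extend (fun _ : Fin 1 => a) u f = Function.update f a (u 0) := by
  ext p
  by_cases h : p = a
  · subst h
    rw [Function.update_self]
    exact Function.Injective.extend_apply (f := fun _ : Fin 1 => p)
      (fun _ _ _ => Subsingleton.elim _ _) u f 0
  · rw [Function.update_of_ne h, Function.extend_apply']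
    rintro ⟨_, rfl⟩
    exact h rfl

variable {Q : ℕ} {cs : List ℕ} {a : ℕ}

theorem gateAt_kt (ha : a < Q) (hc : ∀ c ∈ cs, c < Q ∧ c ≠ a) {G : Matrix Bool Bool ℂ}
    (hG : G * Gᴴ = 1) (f : ℕ → Bool) :
    (gateAt Q cs G a).1 *ᵥ kt f = if ∀ c ∈ cs, f c = true then
      G false (f a) • kt (Function.update f a false) +
        G true (f a) • kt (Function.update f a true) else kt f := by
  rw [gateAt, dif_pos hG, opAt_kt (valid_gate ha hc)]
  congr 1
  rw [← (Equiv.funUnique (Fin 1) Bool).symm.sum_comp]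
  simp only [Fintype.sum_bool, extend_one]
  rw [add_comm]
  rfl

theorem xGate_kt (ha : a < Q) (hc : ∀ c ∈ cs, c < Q ∧ c ≠ a) (f : ℕ → Bool) :
    (gateAt Q cs xMat a).1 *ᵥ kt f =
      if ∀ c ∈ cs, f c = true then kt (Function.update f a (!f a)) else kt f := by
  rw [gateAt_kt ha hc (by rw [xMat_conjTranspose, xMat_sq])]
  congr 1
  cases h : f a <;> simp [xMat_apply]

theorem hGate_kt (ha : a < Q) (hc : ∀ c ∈ cs, c < Q ∧ c ≠ a) (f : ℕ → Bool) :
    (gateAt Q cs hMat a).1 *ᵥ kt f =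
      if ∀ c ∈ cs, f c = true then ((1 / Real.sqrt 2 : ℝ) : ℂ) •
        (kt (Function.update f a false) +
          (if f a then (-1 : ℂ) else 1) • kt (Function.update f a true)) else kt f := by
  rw [gateAt_kt ha hc (by rw [hMat_conjTranspose, hMat_sq])]
  congr 1
  cases h : f a <;> simp [hMat_apply]

theorem phaseGate_kt (ha : a < Q) (hc : ∀ c ∈ cs, c < Q ∧ c ≠ a) (r : ℝ) (f : ℕ → Bool) :
    (gateAt Q cs (phMat r) a).1 *ᵥ kt f =
      (if (∀ c ∈ cs, f c = true) ∧ f a = true then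
        Complex.exp (2 * Real.pi * Complex.I * (r : ℂ)) else 1) • kt f := by
  rw [gateAt_kt ha hc (phMat_unitary r)]
  by_cases h : ∀ c ∈ cs, f c = true
  · have h1 : ∀ v, f a = v → Function.update f a v = f := by
      rintro v rfl
      exact Function.update_eq_self _ _
    cases hf : f a
    · simp [phMat_apply, h1 _ hf]
    · simp [phMat_apply, h1 _ hf]
  · rw [if_neg h, if_neg fun e => h e.1, one_smul]

theorem gateAt_mem_keeps (G : Matrix Bool Bool ℂ) {p : Fin Q} (hp : a ≠ p) :
    gateAt Q cs G a ∈ keeps p := by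
  unfold gateAt
  split_ifs
  · exact opAt_mem_keeps _ _ _ fun _ => hp
  · exact (keeps p).one_mem

theorem gateAt_sq {G : Matrix Bool Bool ℂ} (h1 : Gᴴ = G) (h2 : G * G = 1) :
    gateAt Q cs G a * gateAt Q cs G a = 1 := by
  have h3 : G * Gᴴ = 1 := by rw [h1, h2]
  have h4 : (⟨onOne G, onOne_mem h3⟩ * ⟨onOne G, onOne_mem h3⟩ :
      Matrix.unitaryGroup (Fin 1 → Bool) ℂ) = 1 :=
    Subtype.ext ((onOne_mul G G).trans (by rw [h2, onOne_one]; rfl))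
  rw [gateAt, dif_pos h3, ← map_mul, h4, map_one]

theorem xGate_sq : gateAt Q cs xMat a * gateAt Q cs xMat a = 1 :=
  gateAt_sq xMat_conjTranspose xMat_sq

theorem hGate_sq : gateAt Q cs hMat a * gateAt Q cs hMat a = 1 :=
  gateAt_sq hMat_conjTranspose hMat_sq

end Gates

/-! ### Programs without measurements -/

section Impl

variable {l n N w Q : ℕ} (B : BlackBoxes l n N w)

/-- In every memory with the property `pre`, the program `P` halts after time at most `T` with the
property `post`, and applies the unitary operator `U` to the register. The time and the final memory
do not depend on the state of the register. -/
def Impl (P : Program) (pre post : Mem → Prop) (U : UOp Q) (T : ℝ) : Prop :=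
  ∀ M, pre M → ∃ M', post M' ∧ ∃ t ≤ T, ∀ (ψ : Bits Q → ℂ) (τ : ℝ),
    Exec B P ⟨M, ψ, τ⟩ [⟨M', U.1 *ᵥ ψ, τ + t⟩]

variable {B}

theorem Impl.mono {P : Program} {pre post pre' post' : Mem → Prop} {U : UOp Q} {T T' : ℝ}
    (h : Impl B P pre post U T) (h1 : ∀ M, pre' M → pre M) (h2 : ∀ M, post M → post' M)
    (hT : T ≤ T') : Impl B P pre' post' U T' := by
  intro M hM
  obtain ⟨M', hM', t, ht, hE⟩ := h M (h1 M hM)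
  exact ⟨M', h2 _ hM', t, ht.trans hT, hE⟩

theorem Impl.seq {P P' : Program} {pre mid post : Mem → Prop} {U U' : UOp Q} {T T' : ℝ}
    (h : Impl B P pre mid U T) (h' : Impl B P' mid post U' T') :
    Impl B (.seq P P') pre post (U' * U) (T + T') := by
  intro M hM
  obtain ⟨M', hM', t, ht, hE⟩ := h M hM
  obtain ⟨M'', hM'', t', ht', hE'⟩ := h' M' hM'
  refine ⟨M'', hM'', t + t', add_le_add ht ht', fun ψ τ => ?_⟩
  have := Exec.seq P P' ⟨M, ψ, τ⟩ _
    (fun _ => [⟨M'', (U' * U).1 *ᵥ ψ, τ + (t + t')⟩]) (hE ψ τ) (by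
      intro u hu
      rw [List.mem_singleton] at hu
      rw [hu, UOp.mul_mulVec, ← add_assoc]
      exact hE' _ _)
  simpa using this

theorem impl_setN (a v : NExp) {pre post : Mem → Prop}
    (h : ∀ M, pre M → post (M.setNat (a.eval M) (v.eval M))) :
    Impl B (.setN a v) pre post (1 : UOp Q) 1 := by
  intro M hM
  refine ⟨_, h M hM, 1, le_rfl, fun ψ τ => ?_⟩
  rw [UOp.one_mulVec]
  exact Exec.setN a v _

theorem impl_setR (a : NExp) (v : RExp) {pre post : Mem → Prop}
    (h : ∀ M, pre M → post (M.setReal (a.eval M) (v.eval M))) :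
    Impl B (.setR a v) pre post (1 : UOp Q) 1 := by
  intro M hM
  refine ⟨_, h M hM, 1, le_rfl, fun ψ τ => ?_⟩
  rw [UOp.one_mulVec]
  exact Exec.setR a v _

theorem Impl.ite {t : BExp} {P P' : Program} {pre post : Mem → Prop} {c : Prop} [Decidable c]
    {U U' : UOp Q} {T : ℝ}
    (ht : ∀ M, pre M → (t.holds M ↔ c)) (h : c → Impl B P pre post U T)
    (h' : ¬ c → Impl B P' pre post U' T) :
    Impl B (.ite t P P') pre post (if c then U else U') (1 + T) := by
  intro M hM
  by_cases hc : c
  · obtain ⟨M', hM', s, hs, hE⟩ := h hc M hM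
    refine ⟨M', hM', 1 + s, by linarith, fun ψ τ => ?_⟩
    rw [if_pos hc, ← add_assoc]
    exact Exec.iteTrue _ _ _ _ _ ((ht M hM).2 hc) (hE ψ (τ + 1))
  · obtain ⟨M', hM', s, hs, hE⟩ := h' hc M hM
    refine ⟨M', hM', 1 + s, by linarith, fun ψ τ => ?_⟩
    rw [if_neg hc, ← add_assoc]
    exact Exec.iteFalse _ _ _ _ _ (fun e => hc ((ht M hM).1 e)) (hE ψ (τ + 1))

/-- The product `U (k - 1) * ⋯ * U 0`. -/
def prodU (U : ℕ → UOp Q) : ℕ → UOp Q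
  | 0 => 1
  | k + 1 => U k * prodU U k

theorem prodU_const (U : UOp Q) (k : ℕ) : prodU (fun _ => U) k = U ^ k := by
  induction k with
  | zero => rfl
  | succ k ih => rw [prodU, ih, pow_succ']

theorem prodU_mem {S : Subgroup (UOp Q)} {U : ℕ → UOp Q} {k : ℕ} (h : ∀ j < k, U j ∈ S) :
    prodU U k ∈ S := by
  induction k with
  | zero => exact S.one_mem
  | succ k ih => exact S.mul_mem (h k (by omega)) (ih fun j hj => h j (by omega))

/-- Undoing the factors in the opposite order. -/
theorem prodU_reverse (U : ℕ → UOp Q) (k : ℕ) :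
    prodU (fun j => (U (k - (j + 1)))⁻¹) k = (prodU U k)⁻¹ := by
  suffices h : ∀ j ≤ k, prodU (fun j => (U (k - (j + 1)))⁻¹) j =
      prodU U (k - j) * (prodU U k)⁻¹ by
    simpa [prodU] using h k le_rfl
  intro j hj
  induction j with
  | zero => simp [prodU]
  | succ j ih =>
    obtain ⟨i, hi⟩ : ∃ i, k - j = i + 1 := ⟨k - j - 1, by omega⟩
    have hi' : k - (j + 1) = i := by omega
    rw [prodU, ih (by omega), hi, hi', prodU]
    group

theorem Impl.loop {t : BExp} {P : Program} {J : ℕ → Mem → Prop} {U : ℕ → UOp Q} {T : ℝ} {k : ℕ}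
    (hJ : ∀ j < k, ∀ M, J j M → t.holds M) (hk : ∀ M, J k M → ¬ t.holds M)
    (h : ∀ j < k, Impl B P (J j) (J (j + 1)) (U j) T) :
    Impl B (.loop t P) (J 0) (J k) (prodU U k) (k * (1 + T) + 1) := by
  suffices H : ∀ i ≤ k, ∀ M, J (k - i) M → ∃ M', J k M' ∧ ∃ s ≤ i * (1 + T) + 1,
      ∀ (ψ : Bits Q → ℂ) (τ : ℝ), Exec B (.loop t P) ⟨M, ψ, τ⟩
        [⟨M', (prodU U k * (prodU U (k - i))⁻¹).1 *ᵥ ψ, τ + s⟩] by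
    intro M hM
    obtain ⟨M', hM', s, hs, hE⟩ := H k le_rfl M (by simpa using hM)
    refine ⟨M', hM', s, hs, fun ψ τ => ?_⟩
    simpa [prodU] using hE ψ τ
  -- `i` is the number of passages that remain
  intro i hi
  induction i with
  | zero =>
    intro M hM
    refine ⟨M, by simpa using hM, 1, by simp, fun ψ τ => ?_⟩
    rw [Nat.sub_zero, mul_inv_cancel, UOp.one_mulVec]
    exact Exec.loopDone _ _ _ (hk M (by simpa using hM))
  | succ i ih =>
    intro M hM
    have e : k - i = k - (i + 1) + 1 := by omega
    obtain ⟨M₁, hM₁, s₁, hs₁, hE₁⟩ := h (k - (i + 1)) (by omega) M hM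
    obtain ⟨M', hM', s, hs, hE⟩ := ih (by omega) M₁ (e ▸ hM₁)
    refine ⟨M', hM', 1 + s₁ + s, by push_cast; linarith, fun ψ τ => ?_⟩
    have := Exec.loopStep t P ⟨M, ψ, τ⟩ _ (fun _ =>
      [⟨M', (prodU U k * (prodU U (k - (i + 1)))⁻¹).1 *ᵥ ψ, τ + (1 + s₁ + s)⟩])
      (hJ _ (by omega) M hM) (hE₁ ψ (τ + 1)) (by
        intro u hu
        rw [List.mem_singleton] at hu
        have e2 : prodU U k * (prodU U (k - (i + 1)))⁻¹ =
            prodU U k * (prodU U (k - i))⁻¹ * U (k - (i + 1)) := by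
          rw [e, prodU]
          group
        have e3 : τ + (1 + s₁ + s) = τ + 1 + s₁ + s := by ring
        rw [hu, e2, UOp.mul_mulVec, e3]
        exact hE _ _)
    simpa using this

/-- The memories that agree with `M₀` on the real cells and on the first `c` integer cells. -/
def Agree (c : ℕ) (M₀ M : Mem) : Prop := M.real = M₀.real ∧ ∀ k < c, M.nat k = M₀.nat k

theorem Agree.setNat {c : ℕ} {M₀ M : Mem} (h : Agree c M₀ M) (v : ℕ) :
    Agree (c + 1) (M₀.setNat c v) (M.setNat c v) := by
  refine ⟨h.1, fun k hk => ?_⟩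
  rcases Nat.lt_succ_iff_lt_or_eq.1 hk with hk | rfl
  · simp [Mem.setNat, Function.update_of_ne hk.ne, h.2 k hk]
  · simp [Mem.setNat]

theorem agree_setNat_iff {c v : ℕ} {M₀ M : Mem} :
    Agree (c + 1) (M₀.setNat c v) M ↔ Agree c M₀ M ∧ M.nat c = v := by
  constructor
  · rintro ⟨h1, h2⟩
    refine ⟨⟨h1, fun k hk => ?_⟩, ?_⟩
    · rw [h2 k (by omega)]
      simp [Mem.setNat, Function.update_of_ne hk.ne]
    · rw [h2 c (by omega)]
      simp [Mem.setNat]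
  · rintro ⟨⟨h1, h2⟩, h3⟩
    refine ⟨h1, fun k hk => ?_⟩
    rcases Nat.lt_succ_iff_lt_or_eq.1 hk with hk | rfl
    · simp [Mem.setNat, Function.update_of_ne hk.ne, h2 k hk]
    · simp [Mem.setNat, h3]

/-- The program `P` applies `U` in time at most `T`, in every memory that agrees with `M₀` on the
real cells and the first `c` integer cells, and leaves these cells as they are. The cells from `c`
on are scratch. -/
def Does (B : BlackBoxes l n N w) (c : ℕ) (M₀ : Mem) (P : Program) (U : UOp Q) (T : ℝ) : Prop :=
  Impl B P (Agree c M₀) (Agree c M₀) U T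

theorem Does.seq {c : ℕ} {M₀ : Mem} {P P' : Program} {U U' : UOp Q} {T T' : ℝ}
    (h : Does B c M₀ P U T) (h' : Does B c M₀ P' U' T') :
    Does B c M₀ (.seq P P') (U' * U) (T + T') := Impl.seq h h'

theorem Does.of_eq {c : ℕ} {M₀ : Mem} {P : Program} {U U' : UOp Q} {T T' : ℝ}
    (h : Does B c M₀ P U T) (hU : U = U') (hT : T ≤ T') : Does B c M₀ P U' T' :=
  hU ▸ Impl.mono h (fun _ h => h) (fun _ h => h) hT

/-- `for cell c from 0 to len - 1 do P`. -/
def forLoop (c : ℕ) (len : NExp) (P : Program) : Program :=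
  .seq (.setN (.lit c) (.lit 0)) (.loop (.ltN (.get (.lit c)) len)
    (.seq P (.setN (.lit c) (.add (.get (.lit c)) (.lit 1)))))

/-- A `for` loop with the counter in cell `c`. The body has to preserve the cells up to `c`, and may
use the integer cells from `c + 1` on as scratch. -/
theorem does_forLoop {c k : ℕ} {M₀ : Mem} {len : NExp} {P : Program} {U : ℕ → UOp Q} {T : ℝ}
    (hlen : ∀ M, Agree c M₀ M → len.eval M = k)
    (h : ∀ j < k, Does B (c + 1) (M₀.setNat c j) P (U j) T) :
    Does B c M₀ (forLoop c len P) (prodU U k) (k * (T + 2) + 2) := by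
  have h1 : Impl B (.setN (.lit c) (.lit 0)) (Agree c M₀) (Agree (c + 1) (M₀.setNat c 0))
      (1 : UOp Q) 1 := impl_setN _ _ fun M hM => hM.setNat 0
  have h2 := Impl.loop (B := B) (Q := Q) (t := .ltN (.get (.lit c)) len)
    (P := .seq P (.setN (.lit c) (.add (.get (.lit c)) (.lit 1))))
    (J := fun j => Agree (c + 1) (M₀.setNat c j)) (U := fun j => 1 * U j) (T := T + 1) (k := k)
    (fun j hj M hM => by
      obtain ⟨h3, h4⟩ := agree_setNat_iff.1 hM
      simp only [BExp.holds, NExp.eval, h4, hlen M h3, hj])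
    (fun M hM => by
      obtain ⟨h3, h4⟩ := agree_setNat_iff.1 hM
      simp only [BExp.holds, NExp.eval, h4, hlen M h3, lt_irrefl, not_false_iff])
    (fun j hj => Impl.seq (h j hj) (impl_setN _ _ fun M hM => by
      obtain ⟨h3, h4⟩ := agree_setNat_iff.1 hM
      simp only [NExp.eval, h4]
      exact h3.setNat _))
  have h3 := h1.seq h2
  simp only [one_mul, mul_one] at h3
  refine h3.mono (fun _ h => h) (fun M hM => (agree_setNat_iff.1 hM).1) ?_
  linarith

/-! ### Calls of gates and black boxes -/

theorem Valid.wired {ι : Type} {cs : List ℕ} {addr : ι → ℕ} (h : Valid Q cs addr) {M : Mem}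
    {ce : List NExp} {addr' : ι → ℕ} (hc : ce.map (fun a => a.eval M) = cs) (ha : addr' = addr) :
    Wired M ce h.control addr' h.target := by
  subst ha
  refine ⟨?_, fun i => rfl, h.target_notMem⟩
  rw [hc]
  conv_rhs => rw [← h.map_control]
  simp [List.map_eq_flatMap]

theorem adj_unitary {ι : Type} [Fintype ι] [DecidableEq ι] (inv : Bool)
    (U : Matrix.unitaryGroup ι ℂ) : adj inv U.1 = (if inv then U⁻¹ else U).1 := by
  cases inv
  · rfl
  · rfl

theorem does_gate {c : ℕ} {M₀ : Mem} {ce : List NExp} {g : Gate} {q : NExp} {cs : List ℕ} {a : ℕ}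
    {G : Matrix Bool Bool ℂ} (ha : a < Q) (hc : ∀ c ∈ cs, c < Q ∧ c ≠ a)
    (hce : ∀ M, Agree c M₀ M → ce.map (fun e => e.eval M) = cs)
    (hq : ∀ M, Agree c M₀ M → q.eval M = a)
    (hg : ∀ M, Agree c M₀ M → g.matrix M = G) :
    Does B c M₀ (.gate ce g q) (gateAt Q cs G a) 1 := by
  intro M hM
  refine ⟨M, hM, 1, le_rfl, fun ψ τ => ?_⟩
  have h := valid_gate ha hc
  have e := hg M hM
  subst e
  rw [gateAt, dif_pos (gate_unitary M g), opAt_mulVec h]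
  exact Exec.gate ce g q _ _ _ (h.wired (hce M hM) (by rw [hq M hM]))

theorem does_load {c : ℕ} {M₀ : Mem} {ce : List NExp} {ea eb : NExp} {cs : List ℕ} {a b : ℕ}
    {U : Matrix.unitaryGroup (Fin l ⊕ Fin n → Bool) ℂ} (hU : B.load = U.1) (inv : Bool)
    (h : Valid Q cs (Sum.elim (block l a) (block n b)))
    (hce : ∀ M, Agree c M₀ M → ce.map (fun e => e.eval M) = cs)
    (ha : ∀ M, Agree c M₀ M → ea.eval M = a) (hb : ∀ M, Agree c M₀ M → eb.eval M = b) :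
    Does B c M₀ (.load inv ce ea eb)
      (opAt Q cs (Sum.elim (block l a) (block n b)) (if inv then U⁻¹ else U))
      (1 + B.queryTime) := by
  intro M hM
  refine ⟨M, hM, _, le_rfl, fun ψ τ => ?_⟩
  rw [opAt_mulVec h, ← adj_unitary, ← hU]
  exact Exec.load inv ce ea eb _ _ _ (h.wired (hce M hM) (by rw [ha M hM, hb M hM]))

theorem does_prep {c : ℕ} {M₀ : Mem} {ce : List NExp} {et ea : NExp} {cs : List ℕ} {a : ℕ}
    {t : Fin w} {U : Matrix.unitaryGroup (Fin l → Bool) ℂ} (hU : B.prep t = U.1) (inv : Bool)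
    (h : Valid Q cs (block l a))
    (hce : ∀ M, Agree c M₀ M → ce.map (fun e => e.eval M) = cs)
    (ht : ∀ M, Agree c M₀ M → et.eval M = t) (ha : ∀ M, Agree c M₀ M → ea.eval M = a) :
    Does B c M₀ (.prep inv ce et ea) (opAt Q cs (block l a) (if inv then U⁻¹ else U))
      (1 + B.queryTime) := by
  intro M hM
  refine ⟨M, hM, _, le_rfl, fun ψ τ => ?_⟩
  rw [opAt_mulVec h, ← adj_unitary, ← hU]
  exact Exec.prep inv ce et ea _ _ _ t (ht M hM).symm (h.wired (hce M hM) (by rw [ha M hM]))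

theorem does_feat {c : ℕ} {M₀ : Mem} {ce : List NExp} {ea eb : NExp} {cs : List ℕ} {a b : ℕ}
    {U : Matrix.unitaryGroup (Fin n ⊕ Fin N → Bool) ℂ} (hU : B.feat = U.1) (inv : Bool)
    (h : Valid Q cs (Sum.elim (block n a) (block N b)))
    (hce : ∀ M, Agree c M₀ M → ce.map (fun e => e.eval M) = cs)
    (ha : ∀ M, Agree c M₀ M → ea.eval M = a) (hb : ∀ M, Agree c M₀ M → eb.eval M = b) :
    Does B c M₀ (.feat inv ce ea eb)
      (opAt Q cs (Sum.elim (block n a) (block N b)) (if inv then U⁻¹ else U))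
      (1 + B.featTime) := by
  intro M hM
  refine ⟨M, hM, _, le_rfl, fun ψ τ => ?_⟩
  rw [opAt_mulVec h, ← adj_unitary, ← hU]
  exact Exec.feat inv ce ea eb _ _ _ (h.wired (hce M hM) (by rw [ha M hM, hb M hM]))

end Impl

/-!
### The walk operator and the program that applies it

With `q = l + n + N + 3`, the block of qubits that starts at the address `a` consists of
* the index register, `a, …, a + l - 1`, and two qubits that are used only to lower the overlap,
* the qubit `a + (l + 2)`, which selects one of the two states,
* the data register, `a + (l + 3), …`, and the feature register, `a + (l + 3) + n, …`,
* `q + 1` auxiliary qubits, `a + q, …, a + q + q`,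
* the qubit `a + q + (q + 1)`, which controls the walk.

The integer cells `0` to `5` hold the input, cell `6` the number of the current vector, cell `7` the
address `a`, cell `9` the power of the walk operator, cell `10` the outcome of a measurement; the
cells from `11` on are loop counters and scratch. At first, cells `9` and `10` serve to
compute `2 ^ l`.
-/

section Walk

/-- The memory holds the sizes `l, n, N` of the registers, the index `i`, the number `t` of the
current vector and the first address `a` of the current block of qubits. -/
structure Ctx (l n N i t a : ℕ) (M : Mem) : Prop where
  l : M.nat 0 = l
  n : M.nat 1 = n
  N : M.nat 2 = N
  i : M.nat 5 = i
  t : M.nat 6 = t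
  a : M.nat 7 = a

theorem Ctx.of_agree {l n N i t a c : ℕ} {M₀ M : Mem} (h : Ctx l n N i t a M₀)
    (hM : Agree c M₀ M) (hc : 8 ≤ c) : Ctx l n N i t a M :=
  ⟨(hM.2 _ (by omega)).trans h.l, (hM.2 _ (by omega)).trans h.n, (hM.2 _ (by omega)).trans h.N,
    (hM.2 _ (by omega)).trans h.i, (hM.2 _ (by omega)).trans h.t, (hM.2 _ (by omega)).trans h.a⟩

/-- The integer cell `c`. -/
def cell (c : ℕ) : NExp := .get (.lit c)

/-- The address of the qubit that selects one of the two states to be compared. -/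
def eG : NExp := .add (cell 7) (.add (cell 0) (.lit 2))

/-- The first address of the data register. -/
def eData : NExp := .add (cell 7) (.add (cell 0) (.lit 3))

/-- The first address of the feature register. -/
def eFeat : NExp := .add eData (cell 1)

/-- The number of qubits of a block without its auxiliary qubits. -/
def eSize : NExp := .add (.add (cell 0) (cell 1)) (.add (cell 2) (.lit 3))

/-- The address of the `j`-th auxiliary qubit, counted from `0`. -/
def eAnc (j : NExp) : NExp := .add (.add (cell 7) eSize) j

/-- The address of the qubit that controls the walk. -/
def eH : NExp := eAnc (.add eSize (.lit 1))

variable {l n N i t a : ℕ} {M : Mem}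

theorem Ctx.eG (h : Ctx l n N i t a M) : eG.eval M = a + (l + 2) := by
  simp [_root_.eG, cell, NExp.eval, h.l, h.a]

theorem Ctx.eData (h : Ctx l n N i t a M) : eData.eval M = a + (l + 3) := by
  simp [_root_.eData, cell, NExp.eval, h.l, h.a]

theorem Ctx.eFeat (h : Ctx l n N i t a M) : eFeat.eval M = a + (l + 3) + n := by
  simp [_root_.eFeat, cell, NExp.eval, h.eData, h.n]

theorem Ctx.eSize (h : Ctx l n N i t a M) : eSize.eval M = l + n + (N + 3) := by
  simp [_root_.eSize, cell, NExp.eval, h.l, h.n, h.N]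

theorem Ctx.eAnc (h : Ctx l n N i t a M) (j : NExp) :
    (eAnc j).eval M = a + (l + n + (N + 3)) + j.eval M := by
  simp [_root_.eAnc, cell, NExp.eval, h.eSize, h.a]

theorem Ctx.eH (h : Ctx l n N i t a M) :
    eH.eval M = a + (l + n + (N + 3)) + (l + n + (N + 3) + 1) := by
  simp [_root_.eH, h.eAnc, NExp.eval, h.eSize]

theorem Ctx.eBase (h : Ctx l n N i t a M) (e : NExp) :
    (NExp.add (cell 7) e).eval M = a + e.eval M := by
  simp [cell, NExp.eval, h.a]

/-! #### Operators -/

variable (Q l n N i a : ℕ)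

/-- Flips the index register between `0` and `i`, if the selecting qubit is `1`. -/
noncomputable def flipU : UOp Q :=
  prodU (fun j => if i.testBit j then gateAt Q [a + (l + 2)] xMat (a + j) else 1) l

/-- Hadamard gates on the index register and two further qubits, if the selecting qubit is `1`. The
two further qubits halve the overlap, which keeps the phase of the walk away from `0` and `π`. -/
noncomputable def spreadU : UOp Q :=
  prodU (fun j => gateAt Q [a + (l + 2)] hMat (a + j)) (l + 2)

/-- The black boxes as unitary operators, with `prep` for a single stored vector. -/
structure Boxes (l n N : ℕ) where
  load : Matrix.unitaryGroup (Fin l ⊕ Fin n → Bool) ℂ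
  prep : Matrix.unitaryGroup (Fin l → Bool) ℂ
  feat : Matrix.unitaryGroup (Fin n ⊕ Fin N → Bool) ℂ

variable {l n N}

/-- The call of `load` on the current block. -/
noncomputable def loadU (X : Boxes l n N) : UOp Q :=
  opAt Q [] (Sum.elim (block l a) (block n (a + (l + 3)))) X.load

/-- The call of `feat` on the current block. -/
noncomputable def featU (X : Boxes l n N) : UOp Q :=
  opAt Q [] (Sum.elim (block n (a + (l + 3))) (block N (a + (l + 3) + n))) X.feat

/-- The call of `prep` on the current block, if the selecting qubit is `1`. -/
noncomputable def prepU (X : Boxes l n N) : UOp Q :=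
  opAt Q [a + (l + 2)] (block l a) X.prep

/-- Prepares the two states whose inner product is wanted: the superposition of the feature vectors
with the coefficients of the stored vector when the selecting qubit is `0`, and the feature vector
of the datum `i`, with a uniform superposition of the indices, when it is `1`. The call of `prep`
stands between two `X` gates, so it takes place when the selecting qubit is `0`. The first `flipU`
writes the index `i` if the selecting qubit is `1`, and the other one erases it. -/
noncomputable def stateU (X : Boxes l n N) : UOp Q :=
  spreadU Q l a * flipU Q l i a * gateAt Q [] xMat (a + (l + 2)) * (loadU Q a X)⁻¹ * featU Q a X *
    loadU Q a X * prepU Q a X * gateAt Q [] xMat (a + (l + 2)) * flipU Q l i a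

/-- If the controlling qubit is `1`, a reflection whose expectation in the zero state is the inner
product of the two states: the Hadamard gate superposes the two values of the selecting qubit, and
the controlled `X` gate exchanges them after the states have been prepared. -/
noncomputable def mirrorU (X : Boxes l n N) : UOp Q :=
  gateAt Q [] hMat (a + (l + 2)) * (stateU Q i a X)⁻¹ *
    gateAt Q [a + (l + n + (N + 3)) + (l + n + (N + 3) + 1)] xMat (a + (l + 2)) *
    stateU Q i a X * gateAt Q [] hMat (a + (l + 2))

variable (l n N)

/-- One step of the computation of the conjunction of the negated bits of a block of size `q`: the
next auxiliary qubit becomes `c && !b = c ⊕ (c && b)`, for the last auxiliary qubit `c` and the next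
bit `b`. -/
noncomputable def ladderStep (q a j : ℕ) : UOp Q :=
  gateAt Q [a + q + j, a + j] xMat (a + q + (j + 1)) * gateAt Q [a + q + j] xMat (a + q + (j + 1))

/-- Writes to the auxiliary qubits whether the first bits of the block are all `0`. -/
noncomputable def ladderU (q a : ℕ) : UOp Q :=
  prodU (ladderStep Q q a) q * gateAt Q [] xMat (a + q)

/-- If the controlling qubit is `1`, the sign change of the zero state of a block of size `q`. -/
noncomputable def signU (q a : ℕ) : UOp Q :=
  (ladderU Q q a)⁻¹ * gateAt Q [a + q + (q + 1)] (phMat (1 / 2)) (a + q + q) * ladderU Q q a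

variable {l n N}

/-- The walk operator: the product of the two reflections. It is controlled by a qubit of the block:
only the exchange in `mirrorU` and the phase gate in `signU` carry this control, as all the other
operators cancel without them. -/
noncomputable def walkU (X : Boxes l n N) : UOp Q :=
  signU Q (l + n + (N + 3)) a * mirrorU Q i a X

/-! #### Programs -/

/-- No operation, for the price of one instruction; it writes to a cell that is not used otherwise.
-/
def skip : Program := .setN (.lit 30) (.lit 0)

/-- The program of `flipU`. Cell `12` counts the bits of `i`, cell `13` contains the bits that
remain; twice the half of an odd number is less than the number. -/
def flipP : Program :=
  .seq (.setN (.lit 12) (.lit 0)) (.seq (.setN (.lit 13) (cell 5))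
    (.loop (.ltN (cell 12) (cell 0))
      (.seq (.ite (.ltN (.add (.half (cell 13)) (.half (cell 13))) (cell 13))
          (.gate [eG] .X (.add (cell 7) (cell 12))) skip)
        (.seq (.setN (.lit 13) (.half (cell 13))) (.setN (.lit 12) (.add (cell 12) (.lit 1)))))))

/-- The program of `spreadU`. -/
def spreadP : Program :=
  forLoop 12 (.add (cell 0) (.lit 2)) (.gate [eG] .H (.add (cell 7) (cell 12)))

/-- The program of the inverse of `spreadU`. -/
def spreadInvP : Program :=
  forLoop 12 (.add (cell 0) (.lit 2)) (.gate [eG] .H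
    (.add (cell 7) (.sub (.add (cell 0) (.lit 2)) (.add (cell 12) (.lit 1)))))

/-- The program of `stateU`. -/
def stateP : Program :=
  .seq flipP (.seq (.gate [] .X eG) (.seq (.prep false [eG] (cell 6) (cell 7))
    (.seq (.load false [] (cell 7) eData) (.seq (.feat false [] eData eFeat)
      (.seq (.load true [] (cell 7) eData) (.seq (.gate [] .X eG) (.seq flipP spreadP)))))))

/-- The program of the inverse of `stateU`. -/
def stateInvP : Program :=
  .seq spreadInvP (.seq flipP (.seq (.gate [] .X eG) (.seq (.load false [] (cell 7) eData)
    (.seq (.feat true [] eData eFeat) (.seq (.load true [] (cell 7) eData)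
      (.seq (.prep true [eG] (cell 6) (cell 7)) (.seq (.gate [] .X eG) flipP)))))))

/-- The program of `mirrorU`. -/
def mirrorP : Program :=
  .seq (.gate [] .H eG) (.seq stateP (.seq (.gate [eH] .X eG) (.seq stateInvP (.gate [] .H eG))))

/-- The program of `ladderU`. -/
def ladderP : Program :=
  .seq (.gate [] .X (eAnc (.lit 0))) (forLoop 12 eSize
    (.seq (.gate [eAnc (cell 12)] .X (eAnc (.add (cell 12) (.lit 1))))
      (.gate [eAnc (cell 12), .add (cell 7) (cell 12)] .X (eAnc (.add (cell 12) (.lit 1))))))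

/-- The counter of a loop that runs downwards. -/
def eDown : NExp := .sub eSize (.add (cell 12) (.lit 1))

/-- The program of the inverse of `ladderU`. -/
def ladderInvP : Program :=
  .seq (forLoop 12 eSize
    (.seq (.gate [eAnc eDown, .add (cell 7) eDown] .X (eAnc (.add eDown (.lit 1))))
      (.gate [eAnc eDown] .X (eAnc (.add eDown (.lit 1))))))
    (.gate [] .X (eAnc (.lit 0)))

/-- The program of `signU`. -/
def signP : Program :=
  .seq ladderP (.seq (.gate [eH] (.phase (.div (.ofNat (.lit 1)) (.ofNat (.lit 2)))) (eAnc eSize))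
    ladderInvP)

/-- The program of `walkU`. -/
def walkP : Program := .seq mirrorP signP

end Walk

/-! ### The programs apply the operators -/

section DoesWalk

variable {l n N w Q i a : ℕ} {B : BlackBoxes l n N w} {t : Fin w} {M₀ : Mem}

theorem does_skip {c : ℕ} (hc : c ≤ 30) : Does (Q := Q) B c M₀ skip 1 1 :=
  impl_setN _ _ fun M hM => ⟨hM.1, fun k hk => by
    simp only [NExp.eval, Mem.setNat]
    rw [Function.update_of_ne (by omega), hM.2 k hk]⟩

theorem odd_iff (k : ℕ) : k / 2 + k / 2 < k ↔ k.testBit 0 = true := by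
  rw [Nat.testBit_zero, decide_eq_true_iff]
  omega

theorem does_flip (h : Ctx l n N i t a M₀) (hQ : a + (l + 3) ≤ Q) :
    Does B 12 M₀ flipP (flipU Q l i a) (6 * l + 3) := by
  have h1 : Impl B (.setN (.lit 12) (.lit 0)) (Agree 12 M₀) (Agree 13 (M₀.setNat 12 0))
      (1 : UOp Q) 1 := impl_setN _ _ fun M hM => hM.setNat 0
  have h2 : Impl B (.setN (.lit 13) (cell 5)) (Agree 13 (M₀.setNat 12 0))
      (Agree 14 ((M₀.setNat 12 0).setNat 13 (i / 2 ^ 0))) (1 : UOp Q) 1 :=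
    impl_setN _ _ fun M hM => by
      have h3 : (cell 5).eval M = i / 2 ^ 0 := by
        rw [pow_zero, Nat.div_one]
        exact ((h.of_agree (agree_setNat_iff.1 hM).1 (by omega)).i)
      rw [h3]
      exact hM.setNat _
  have ctx : ∀ {j v : ℕ} {M : Mem}, Agree 14 ((M₀.setNat 12 j).setNat 13 v) M →
      Ctx l n N i t a M ∧ M.nat 12 = j ∧ M.nat 13 = v := by
    intro j v M hM
    obtain ⟨h3, h4⟩ := agree_setNat_iff.1 hM
    obtain ⟨h5, h6⟩ := agree_setNat_iff.1 h3
    exact ⟨h.of_agree h5 (by omega), h6, h4⟩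
  have body : ∀ j < l, Impl B
      (.seq (.ite (.ltN (.add (.half (cell 13)) (.half (cell 13))) (cell 13))
          (.gate [eG] .X (.add (cell 7) (cell 12))) skip)
        (.seq (.setN (.lit 13) (.half (cell 13))) (.setN (.lit 12) (.add (cell 12) (.lit 1)))))
      (Agree 14 ((M₀.setNat 12 j).setNat 13 (i / 2 ^ j)))
      (Agree 14 ((M₀.setNat 12 (j + 1)).setNat 13 (i / 2 ^ (j + 1))))
      (if i.testBit j then gateAt Q [a + (l + 2)] xMat (a + j) else 1 : UOp Q) 4 := by
    intro j hj
    have b1 : Impl B (.ite (.ltN (.add (.half (cell 13)) (.half (cell 13))) (cell 13))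
          (.gate [eG] .X (.add (cell 7) (cell 12))) skip)
        (Agree 14 ((M₀.setNat 12 j).setNat 13 (i / 2 ^ j)))
        (Agree 14 ((M₀.setNat 12 j).setNat 13 (i / 2 ^ j)))
        (if i.testBit j = true then gateAt Q [a + (l + 2)] xMat (a + j) else 1 : UOp Q)
        (1 + 1) := by
      refine Impl.ite (fun M hM => ?_) (fun _ => ?_) (fun _ => does_skip (by omega))
      · obtain ⟨c1, c2, c3⟩ := ctx hM
        simp only [BExp.holds, NExp.eval, cell, c3, odd_iff]
        rw [Nat.testBit_div_two_pow, Nat.zero_add]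
      · refine does_gate (by omega) ?_ ?_ ?_ (fun _ _ => rfl)
        · intro c hc
          rw [List.mem_singleton] at hc
          omega
        · intro M hM
          simp [(ctx hM).1.eG]
        · intro M hM
          obtain ⟨c1, c2, c3⟩ := ctx hM
          simp [cell, NExp.eval, c1.a, c2]
    have b2 : Impl B (.seq (.setN (.lit 13) (.half (cell 13)))
          (.setN (.lit 12) (.add (cell 12) (.lit 1))))
        (Agree 14 ((M₀.setNat 12 j).setNat 13 (i / 2 ^ j)))
        (Agree 14 ((M₀.setNat 12 (j + 1)).setNat 13 (i / 2 ^ (j + 1)))) (1 * 1 : UOp Q)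
        (1 + 1) := by
      refine Impl.seq (mid := fun M => Agree 12 M₀ M ∧ M.nat 12 = j ∧ M.nat 13 = i / 2 ^ (j + 1))
        (impl_setN _ _ fun M hM => ?_) (impl_setN _ _ fun M hM => ?_)
      · obtain ⟨h3, h4⟩ := agree_setNat_iff.1 hM
        obtain ⟨h5, h6⟩ := agree_setNat_iff.1 h3
        refine ⟨⟨h5.1, fun k hk => ?_⟩, ?_, ?_⟩
        · simp only [NExp.eval, Mem.setNat]
          rw [Function.update_of_ne (by omega), h5.2 k hk]
        · simp [NExp.eval, Mem.setNat, h6]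
        · simp [NExp.eval, Mem.setNat, h4, cell, pow_succ, Nat.div_div_eq_div_mul]
      · obtain ⟨h3, h4, h5⟩ := hM
        rw [agree_setNat_iff, agree_setNat_iff]
        refine ⟨⟨⟨h3.1, fun k hk => ?_⟩, ?_⟩, ?_⟩
        · simp only [NExp.eval, Mem.setNat]
          rw [Function.update_of_ne (by omega), h3.2 k hk]
        · simp [NExp.eval, Mem.setNat, h4, cell]
        · simp [NExp.eval, Mem.setNat, h5]
    have b3 := b1.seq b2
    rw [one_mul, one_mul] at b3
    exact b3.mono (fun _ h => h) (fun _ h => h) (by norm_num)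
  have h3 := Impl.loop (B := B) (t := .ltN (cell 12) (cell 0)) (k := l)
    (J := fun j => Agree 14 ((M₀.setNat 12 j).setNat 13 (i / 2 ^ j)))
    (fun j hj M hM => by
      obtain ⟨c1, c2, c3⟩ := ctx hM
      simp only [BExp.holds, NExp.eval, cell, c1.l, c2, hj])
    (fun M hM => by
      obtain ⟨c1, c2, c3⟩ := ctx hM
      simp only [BExp.holds, NExp.eval, cell, c1.l, c2, lt_irrefl, not_false_iff]) body
  have h4 := h1.seq (h2.seq h3)
  rw [mul_one, mul_one] at h4
  exact h4.mono (fun _ h => h) (fun M hM => (agree_setNat_iff.1 (agree_setNat_iff.1 hM).1).1)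
    (by
      have : (0 : ℝ) ≤ l := Nat.cast_nonneg l
      linarith)

theorem does_spread (h : Ctx l n N i t a M₀) (hQ : a + (l + 3) ≤ Q) :
    Does B 12 M₀ spreadP (spreadU Q l a) (3 * l + 8) := by
  have h1 : ∀ M, Agree 12 M₀ M → (NExp.add (cell 0) (.lit 2)).eval M = l + 2 := fun M hM => by
    simp [NExp.eval, cell, (h.of_agree hM (by omega)).l]
  refine (does_forLoop (U := fun j => gateAt Q [a + (l + 2)] hMat (a + j)) (T := 1) h1
    fun j hj => ?_).mono (fun _ h => h) (fun _ h => h) ?_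
  · refine does_gate (by omega) ?_ ?_ ?_ (fun _ _ => rfl)
    · intro c hc
      rw [List.mem_singleton] at hc
      omega
    · intro M hM
      simp [(h.of_agree (agree_setNat_iff.1 hM).1 (by omega)).eG]
    · intro M hM
      rw [(h.of_agree (agree_setNat_iff.1 hM).1 (by omega)).eBase]
      simp [cell, NExp.eval, (agree_setNat_iff.1 hM).2]
  · push_cast
    linarith

theorem does_spreadInv (h : Ctx l n N i t a M₀) (hQ : a + (l + 3) ≤ Q) :
    Does B 12 M₀ spreadInvP (spreadU Q l a)⁻¹ (3 * l + 8) := by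
  have h1 : ∀ M, Agree 12 M₀ M → (NExp.add (cell 0) (.lit 2)).eval M = l + 2 := fun M hM => by
    simp [NExp.eval, cell, (h.of_agree hM (by omega)).l]
  rw [spreadU, ← prodU_reverse]
  refine (does_forLoop (T := 1) h1 fun j hj => ?_).mono (fun _ h => h) (fun _ h => h) ?_
  · rw [inv_eq_of_mul_eq_one_left hGate_sq]
    refine does_gate (by omega) ?_ ?_ ?_ (fun _ _ => rfl)
    · intro c hc
      rw [List.mem_singleton] at hc
      omega
    · intro M hM
      simp [(h.of_agree (agree_setNat_iff.1 hM).1 (by omega)).eG]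
    · intro M hM
      have c1 := h.of_agree (agree_setNat_iff.1 hM).1 (by omega)
      rw [c1.eBase]
      simp [cell, NExp.eval, (agree_setNat_iff.1 hM).2, c1.l]
  · push_cast
    linarith

theorem valid_load {cs : List ℕ} {a b : ℕ} (hQ : 0 < Q) (hb : b + n ≤ Q)
    (hab : a + l ≤ b) (hc : ∀ c ∈ cs, c < Q ∧ (c < a ∨ a + l ≤ c) ∧ (c < b ∨ b + n ≤ c)) :
    Valid Q cs (Sum.elim (block l a) (block n b)) := by
  refine ⟨hQ, fun c h => (hc c h).1, ?_, ?_, ?_⟩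
  · rintro (j | j)
    · simp only [Sum.elim_inl, block]; omega
    · simp only [Sum.elim_inr, block]; omega
  · rintro (j | j) (k | k) e <;> simp only [Sum.elim_inl, Sum.elim_inr, block] at e
    · exact congrArg _ (Fin.ext (by omega))
    · omega
    · omega
    · exact congrArg _ (Fin.ext (by omega))
  · rintro (j | j) e <;> simp only [Sum.elim_inl, Sum.elim_inr, block] at e
    · have := hc _ e; omega
    · have := hc _ e; omega

theorem valid_prep {cs : List ℕ} {a : ℕ} (hQ : 0 < Q) (ha : a + l ≤ Q)
    (hc : ∀ c ∈ cs, c < Q ∧ (c < a ∨ a + l ≤ c)) : Valid Q cs (block l a) := by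
  refine ⟨hQ, fun c h => (hc c h).1, fun j => by simp only [block]; omega, ?_, ?_⟩
  · intro j k e
    simp only [block] at e
    exact Fin.ext (by omega)
  · intro j e
    have := hc _ e
    simp only [block] at this
    omega

theorem spread_mem_keeps {p : Fin Q} (hp : (p : ℕ) < a ∨ a + (l + 2) ≤ p) :
    spreadU Q l a ∈ keeps p := prodU_mem fun j hj => gateAt_mem_keeps _ (by omega)

theorem flip_mem_keeps {p : Fin Q} (hp : (p : ℕ) < a ∨ a + l ≤ p) :
    flipU Q l i a ∈ keeps p := prodU_mem fun j hj => by
  split_ifs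
  · exact gateAt_mem_keeps _ (by omega)
  · exact (keeps p).one_mem

/-- The action of `flipU` on the bits of a basis state. -/
def flipBits (l i a : ℕ) (f : ℕ → Bool) : ℕ → Bool := fun p =>
  if a ≤ p ∧ p < a + l ∧ f (a + (l + 2)) = true then xor (f p) (i.testBit (p - a)) else f p

theorem flipU_kt (hQ : a + (l + 3) ≤ Q) (f : ℕ → Bool) :
    (flipU Q l i a).1 *ᵥ kt f = kt (flipBits l i a f) := by
  have h : ∀ k ≤ l,
      (prodU (fun j => if i.testBit j then gateAt Q [a + (l + 2)] xMat (a + j) else 1) k).1 *ᵥ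
        kt f = kt fun p => if a ≤ p ∧ p < a + k ∧ f (a + (l + 2)) = true then
          xor (f p) (i.testBit (p - a)) else f p := by
    intro k hk
    induction k with
    | zero =>
      have : ∀ p, ¬ (a ≤ p ∧ p < a + 0 ∧ f (a + (l + 2)) = true) := fun p => by omega
      simp only [this, if_false]
      exact UOp.one_mulVec _
    | succ k ih =>
      rw [prodU, UOp.mul_mulVec, ih (by omega)]
      by_cases hb : i.testBit k = true
      · rw [if_pos hb, xGate_kt (by omega) (by
          intro c hc
          rw [List.mem_singleton] at hc
          omega)]
        have h2 : ¬ (a + (l + 2) < a + k) := by omega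
        by_cases hg : f (a + (l + 2)) = true
        · rw [if_pos (by
            intro c hc
            rw [List.mem_singleton] at hc
            subst hc
            rw [if_neg fun e => h2 e.2.1]
            exact hg)]
          congr 1
          ext p
          by_cases hp : p = a + k
          · subst hp
            simp [hg, hb]
          · rw [Function.update_of_ne hp]
            have : p < a + k ↔ p < a + (k + 1) := by omega
            simp only [this]
        · rw [if_neg fun e => hg (by
            have := e _ (List.mem_singleton_self _)
            rwa [if_neg fun e => h2 e.2.1] at this)]
          simp [hg]
      · rw [if_neg hb, UOp.one_mulVec]
        congr 1
        ext p
        by_cases hp : p = a + k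
        · subst hp
          simp [hb]
        · have : p < a + k ↔ p < a + (k + 1) := by omega
          simp only [this]
  exact h l le_rfl

theorem kt_surj (b : Bits Q) : ∃ f : ℕ → Bool, ket b = kt f :=
  ⟨fun p => if h : p < Q then b ⟨p, h⟩ else false, by simp [kt]⟩

theorem uop_ext {U V : UOp Q} (h : ∀ f : ℕ → Bool, U.1 *ᵥ kt f = V.1 *ᵥ kt f) : U = V := by
  refine Subtype.ext (Matrix.ext_of_mulVec_single fun b => ?_)
  obtain ⟨f, hf⟩ := kt_surj b
  change U.1 *ᵥ ket b = V.1 *ᵥ ket b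
  rw [hf]
  exact h f

theorem flipU_sq (hQ : a + (l + 3) ≤ Q) : flipU Q l i a * flipU Q l i a = 1 := by
  refine uop_ext fun f => ?_
  rw [UOp.mul_mulVec, flipU_kt hQ, flipU_kt hQ, UOp.one_mulVec]
  congr 1
  ext p
  have h1 : ¬ (a + (l + 2) < a + l) := by omega
  simp only [flipBits, h1, false_and, and_false, if_false]
  split_ifs <;> simp

variable {X : Boxes l n N}

/-- The black boxes that are called with the number `t`. -/
structure IsBoxes (B : BlackBoxes l n N w) (t : Fin w) (X : Boxes l n N) : Prop where
  load : B.load = X.load.1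
  prep : B.prep t = X.prep.1
  feat : B.feat = X.feat.1

theorem does_gate_g (h : Ctx l n N i t a M₀) (hQ : a + (l + 3) ≤ Q) {g : Gate}
    {G : Matrix Bool Bool ℂ} (hg : ∀ M, g.matrix M = G) :
    Does B 12 M₀ (.gate [] g eG) (gateAt Q [] G (a + (l + 2))) 1 :=
  does_gate (by omega) (by simp) (fun _ _ => rfl) (fun M hM => (h.of_agree hM (by omega)).eG)
    fun M _ => hg M

theorem does_loadU (h : Ctx l n N i t a M₀) (hX : IsBoxes B t X) (inv : Bool)
    (hQ : a + (l + 3) + n ≤ Q) :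
    Does B 12 M₀ (.load inv [] (cell 7) eData) (if inv then (loadU Q a X)⁻¹ else loadU Q a X)
      (1 + B.queryTime) := by
  have := does_load (c := 12) (M₀ := M₀) (ce := []) (ea := cell 7) (eb := eData) hX.load inv
    (valid_load (Q := Q) (cs := []) (a := a) (b := a + (l + 3)) (by omega) (by omega)
      (by omega) (by simp)) (fun _ _ => rfl) (fun M hM => (h.of_agree hM (by omega)).a)
    (fun M hM => (h.of_agree hM (by omega)).eData)
  cases inv
  · exact this
  · rw [if_pos rfl, map_inv] at this
    exact this

theorem does_featU (h : Ctx l n N i t a M₀) (hX : IsBoxes B t X) (inv : Bool)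
    (hQ : a + (l + 3) + n + N ≤ Q) :
    Does B 12 M₀ (.feat inv [] eData eFeat) (if inv then (featU Q a X)⁻¹ else featU Q a X)
      (1 + B.featTime) := by
  have := does_feat (c := 12) (M₀ := M₀) (ce := []) (ea := eData) (eb := eFeat) hX.feat inv
    (valid_load (Q := Q) (cs := []) (a := a + (l + 3)) (b := a + (l + 3) + n) (by omega)
      (by omega) (by omega) (by simp)) (fun _ _ => rfl)
    (fun M hM => (h.of_agree hM (by omega)).eData)
    (fun M hM => (h.of_agree hM (by omega)).eFeat)
  cases inv
  · exact this
  · rw [if_pos rfl, map_inv] at this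
    exact this

theorem does_prepU (h : Ctx l n N i t a M₀) (hX : IsBoxes B t X) (inv : Bool)
    (hQ : a + (l + 3) ≤ Q) :
    Does B 12 M₀ (.prep inv [eG] (cell 6) (cell 7))
      (if inv then (prepU Q a X)⁻¹ else prepU Q a X) (1 + B.queryTime) := by
  have := does_prep (c := 12) (M₀ := M₀) (ce := [eG]) (et := cell 6) (ea := cell 7) hX.prep inv
    (valid_prep (Q := Q) (cs := [a + (l + 2)]) (a := a) (by omega) (by omega) (by
      intro c hc
      rw [List.mem_singleton] at hc
      omega)) (fun M hM => by simp [(h.of_agree hM (by omega)).eG])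
    (fun M hM => (h.of_agree hM (by omega)).t) (fun M hM => (h.of_agree hM (by omega)).a)
  cases inv
  · exact this
  · rw [if_pos rfl, map_inv] at this
    exact this

theorem does_state (h : Ctx l n N i t a M₀) (hX : IsBoxes B t X)
    (hQ : a + (l + 3) + n + N ≤ Q) :
    Does B 12 M₀ stateP (stateU Q i a X) (15 * l + 20 + 3 * B.queryTime + B.featTime) := by
  have f := does_flip (B := B) (Q := Q) h (by omega)
  have x := does_gate_g (B := B) (Q := Q) h (by omega) (g := .X) (G := xMat) fun _ => rfl
  have := f.seq (x.seq ((does_prepU h hX false (by omega)).seq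
    ((does_loadU h hX false (by omega)).seq ((does_featU h hX false (by omega)).seq
      ((does_loadU h hX true (by omega)).seq (x.seq (f.seq (does_spread h (by omega)))))))))
  exact this.of_eq (by simp only [stateU, mul_assoc, if_true, Bool.false_eq_true, if_false])
    (by linarith)

theorem does_stateInv (h : Ctx l n N i t a M₀) (hX : IsBoxes B t X)
    (hQ : a + (l + 3) + n + N ≤ Q) :
    Does B 12 M₀ stateInvP (stateU Q i a X)⁻¹ (15 * l + 20 + 3 * B.queryTime + B.featTime) := by
  have f := does_flip (B := B) (Q := Q) h (by omega)
  have x := does_gate_g (B := B) (Q := Q) h (by omega) (g := .X) (G := xMat) fun _ => rfl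
  have := (does_spreadInv (B := B) (Q := Q) h (by omega)).seq (f.seq (x.seq
    ((does_loadU h hX false (by omega)).seq ((does_featU h hX true (by omega)).seq
      ((does_loadU h hX true (by omega)).seq ((does_prepU h hX true (by omega)).seq
        (x.seq f)))))))
  exact this.of_eq (by
    simp only [stateU, mul_assoc, if_true, Bool.false_eq_true, if_false, _root_.mul_inv_rev,
      inv_inv,
      inv_eq_of_mul_eq_one_left (flipU_sq (Q := Q) (i := i) (show a + (l + 3) ≤ Q by omega)),
      inv_eq_of_mul_eq_one_left (xGate_sq (Q := Q) (cs := []) (a := a + (l + 2)))]) (by linarith)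

theorem does_mirror (h : Ctx l n N i t a M₀) (hX : IsBoxes B t X)
    (hQ : a + (l + n + (N + 3)) + (l + n + (N + 3) + 2) ≤ Q) :
    Does B 12 M₀ mirrorP (mirrorU Q i a X) (30 * l + 43 + 6 * B.queryTime + 2 * B.featTime) := by
  have x := does_gate_g (B := B) (Q := Q) h (by omega) (g := .H) (G := hMat) fun _ => rfl
  have y : Does B 12 M₀ (.gate [eH] .X eG)
      (gateAt Q [a + (l + n + (N + 3)) + (l + n + (N + 3) + 1)] xMat (a + (l + 2))) 1 :=
    does_gate (by omega) (by
      intro c hc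
      rw [List.mem_singleton] at hc
      omega) (fun M hM => by simp [(h.of_agree hM (by omega)).eH])
      (fun M hM => (h.of_agree hM (by omega)).eG) fun _ _ => rfl
  have := x.seq ((does_state (B := B) h hX (by omega)).seq (y.seq
    ((does_stateInv (B := B) h hX (by omega)).seq x)))
  exact this.of_eq (by simp only [mirrorU, mul_assoc]) (by linarith)

theorem does_ladder (h : Ctx l n N i t a M₀)
    (hQ : a + (l + n + (N + 3)) + (l + n + (N + 3) + 2) ≤ Q) :
    Does B 12 M₀ ladderP (ladderU Q (l + n + (N + 3)) a)
      (4 * (l + n + (N + 3) : ℕ) + 3) := by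
  have h1 : Does B 12 M₀ (.gate [] .X (eAnc (.lit 0)))
      (gateAt Q [] xMat (a + (l + n + (N + 3)))) 1 :=
    does_gate (by omega) (by simp) (fun _ _ => rfl)
      (fun M hM => (h.of_agree hM (by omega)).eAnc _) fun _ _ => rfl
  have h2 := does_forLoop (B := B) (Q := Q) (c := 12) (k := l + n + (N + 3)) (M₀ := M₀)
    (len := eSize) (U := ladderStep Q (l + n + (N + 3)) a) (T := 1 + 1)
    (P := .seq (.gate [eAnc (cell 12)] .X (eAnc (.add (cell 12) (.lit 1))))
      (.gate [eAnc (cell 12), .add (cell 7) (cell 12)] .X (eAnc (.add (cell 12) (.lit 1)))))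
    (fun M hM => (h.of_agree hM (by omega)).eSize) (fun j hj => by
      have h3 : ∀ M, Agree 13 (M₀.setNat 12 j) M → Ctx l n N i t a M ∧ M.nat 12 = j :=
        fun M hM => ⟨h.of_agree (agree_setNat_iff.1 hM).1 (by omega), (agree_setNat_iff.1 hM).2⟩
      refine Does.seq (does_gate (by omega) ?_ ?_ ?_ fun _ _ => rfl)
        (does_gate (by omega) ?_ ?_ ?_ fun _ _ => rfl)
      · intro c hc
        simp only [List.mem_singleton] at hc
        omega
      · intro M hM
        simp [(h3 M hM).1.eAnc, cell, NExp.eval, (h3 M hM).2]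
      · intro M hM
        simp [(h3 M hM).1.eAnc, cell, NExp.eval, (h3 M hM).2]
      · intro c hc
        simp only [List.mem_cons, List.not_mem_nil, or_false] at hc
        omega
      · intro M hM
        simp [(h3 M hM).1.eAnc, (h3 M hM).1.eBase]
        simp [cell, NExp.eval, (h3 M hM).2]
      · intro M hM
        simp [(h3 M hM).1.eAnc, cell, NExp.eval, (h3 M hM).2])
  refine Impl.mono (h1.seq h2) (fun _ h => h) (fun _ h => h) ?_
  linarith

theorem does_ladderInv (h : Ctx l n N i t a M₀)
    (hQ : a + (l + n + (N + 3)) + (l + n + (N + 3) + 2) ≤ Q) :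
    Does B 12 M₀ ladderInvP (ladderU Q (l + n + (N + 3)) a)⁻¹
      (4 * (l + n + (N + 3) : ℕ) + 3) := by
  have h1 : Does B 12 M₀ (.gate [] .X (eAnc (.lit 0)))
      (gateAt Q [] xMat (a + (l + n + (N + 3)))) 1 :=
    does_gate (by omega) (by simp) (fun _ _ => rfl)
      (fun M hM => (h.of_agree hM (by omega)).eAnc _) fun _ _ => rfl
  have h2 := does_forLoop (B := B) (Q := Q) (c := 12) (k := l + n + (N + 3)) (M₀ := M₀)
    (len := eSize) (T := 1 + 1)
    (U := fun j => (ladderStep Q (l + n + (N + 3)) a (l + n + (N + 3) - (j + 1)))⁻¹)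
    (P := .seq (.gate [eAnc eDown, .add (cell 7) eDown] .X (eAnc (.add eDown (.lit 1))))
      (.gate [eAnc eDown] .X (eAnc (.add eDown (.lit 1)))))
    (fun M hM => (h.of_agree hM (by omega)).eSize) (fun j hj => by
      have h3 : ∀ M, Agree 13 (M₀.setNat 12 j) M → Ctx l n N i t a M ∧
          eDown.eval M = l + n + (N + 3) - (j + 1) := by
        intro M hM
        have c1 := h.of_agree (agree_setNat_iff.1 hM).1 (by omega)
        refine ⟨c1, ?_⟩
        simp only [eDown, NExp.eval, c1.eSize, cell, (agree_setNat_iff.1 hM).2]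
      rw [ladderStep, _root_.mul_inv_rev, inv_eq_of_mul_eq_one_left xGate_sq,
        inv_eq_of_mul_eq_one_left xGate_sq]
      refine Does.seq (does_gate (by omega) ?_ ?_ ?_ fun _ _ => rfl)
        (does_gate (by omega) ?_ ?_ ?_ fun _ _ => rfl)
      · intro c hc
        simp only [List.mem_cons, List.not_mem_nil, or_false] at hc
        omega
      · intro M hM
        simp [(h3 M hM).1.eAnc, (h3 M hM).1.eBase, (h3 M hM).2]
      · intro M hM
        simp [(h3 M hM).1.eAnc, NExp.eval, (h3 M hM).2]
      · intro c hc
        simp only [List.mem_singleton] at hc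
        omega
      · intro M hM
        simp [(h3 M hM).1.eAnc, (h3 M hM).2]
      · intro M hM
        simp [(h3 M hM).1.eAnc, NExp.eval, (h3 M hM).2])
  rw [prodU_reverse] at h2
  exact (h2.seq h1).of_eq
    (by rw [ladderU, _root_.mul_inv_rev, inv_eq_of_mul_eq_one_left xGate_sq]) (by linarith)

theorem does_sign (h : Ctx l n N i t a M₀)
    (hQ : a + (l + n + (N + 3)) + (l + n + (N + 3) + 2) ≤ Q) :
    Does B 12 M₀ signP (signU Q (l + n + (N + 3)) a)
      (8 * (l + n + (N + 3) : ℕ) + 7) := by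
  have h1 : Does B 12 M₀
      (.gate [eH] (.phase (.div (.ofNat (.lit 1)) (.ofNat (.lit 2)))) (eAnc eSize))
      (gateAt Q [a + (l + n + (N + 3)) + (l + n + (N + 3) + 1)] (phMat (1 / 2))
        (a + (l + n + (N + 3)) + (l + n + (N + 3)))) 1 := by
    refine does_gate (by omega) ?_ ?_ ?_ ?_
    · intro c hc
      rw [List.mem_singleton] at hc
      omega
    · intro M hM
      simp [(h.of_agree hM (by omega)).eH]
    · intro M hM
      simp [(h.of_agree hM (by omega)).eAnc, (h.of_agree hM (by omega)).eSize]
    · intro M _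
      have : (RExp.div (.ofNat (.lit 1)) (.ofNat (.lit 2))).eval M = 1 / 2 := by
        simp [RExp.eval, NExp.eval]
      exact congrArg phMat this
  have := (does_ladder (B := B) h hQ).seq (h1.seq (does_ladderInv h hQ))
  exact this.of_eq (by simp only [signU, mul_assoc]) (by linarith)

/-- The time that `walkP` takes. -/
def walkTime (B : BlackBoxes l n N w) : ℝ :=
  40 * (l + n + N : ℕ) + 80 + 6 * B.queryTime + 2 * B.featTime

theorem does_walk (h : Ctx l n N i t a M₀) (hX : IsBoxes B t X)
    (hQ : a + (l + n + (N + 3)) + (l + n + (N + 3) + 2) ≤ Q) :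
    Does B 12 M₀ walkP (walkU Q i a X) (walkTime B) := by
  have := (does_mirror (B := B) h hX hQ).seq (does_sign h hQ)
  refine Impl.mono this (fun _ h => h) (fun _ h => h) ?_
  have h1 : (0 : ℝ) ≤ n := Nat.cast_nonneg n
  have h2 : (0 : ℝ) ≤ N := Nat.cast_nonneg N
  have h3 : (0 : ℝ) ≤ l := Nat.cast_nonneg l
  unfold walkTime
  push_cast
  linarith

end DoesWalk

/-! ### The two states and their inner product -/

section Overlap

/-- The bits `u` written to the addresses from `s` to `s + len - 1`. -/
def write (f : ℕ → Bool) (s len : ℕ) (u : ℕ → Bool) : ℕ → Bool := fun p =>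
  if s ≤ p ∧ p < s + len then u (p - s) else f p

/-- A bit string, continued by zeros. -/
def bitsOf {n : ℕ} (x : Bits n) : ℕ → Bool := fun k => if h : k < n then x ⟨k, h⟩ else false

theorem bitsOf_fin {n : ℕ} (x : Bits n) (k : Fin n) : bitsOf x k = x k := by
  simp [bitsOf]

variable {m l n N Q i a : ℕ} {X : Boxes l n N}

theorem extend_blocks {b : ℕ} (hab : a + l ≤ b) (u : Fin l ⊕ Fin n → Bool) (f : ℕ → Bool) :
    Function.extend (Sum.elim (block l a) (block n b)) u f =
      write (write f a l (bitsOf fun k => u (.inl k))) b n (bitsOf fun k => u (.inr k)) := by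
  have hinj : Function.Injective (Sum.elim (block l a) (block n b)) :=
    (valid_load (Q := b + n + 1) (cs := []) (by omega) (by omega) hab (by simp)).inj
  ext p
  by_cases h : ∃ j, Sum.elim (block l a) (block n b) j = p
  · obtain ⟨j, rfl⟩ := h
    rw [hinj.extend_apply]
    rcases j with j | j
    · simp only [Sum.elim_inl, block]
      simp only [write]
      rw [if_neg (by omega), if_pos (by omega), Nat.add_sub_cancel_left, bitsOf_fin]
    · simp only [Sum.elim_inr, block]
      simp only [write]
      rw [if_pos (by omega), Nat.add_sub_cancel_left, bitsOf_fin]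
  · rw [Function.extend_apply' _ _ _ h]
    simp only [write]
    rw [if_neg, if_neg]
    · rintro ⟨h1, h2⟩
      exact h ⟨.inl ⟨p - a, by omega⟩, by simp only [Sum.elim_inl, block]; omega⟩
    · rintro ⟨h1, h2⟩
      exact h ⟨.inr ⟨p - b, by omega⟩, by simp only [Sum.elim_inr, block]; omega⟩

theorem extend_block (u : Fin l → Bool) (f : ℕ → Bool) :
    Function.extend (block l a) u f = write f a l (bitsOf u) := by
  have hinj : Function.Injective (block l a) :=
    (valid_prep (Q := a + l + 1) (cs := []) (by omega) (by omega) (by simp)).inj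
  ext p
  by_cases h : ∃ j, block l a j = p
  · obtain ⟨j, rfl⟩ := h
    rw [hinj.extend_apply]
    simp only [block]
    simp only [write]
    rw [if_pos (by omega), Nat.add_sub_cancel_left, bitsOf_fin]
  · rw [Function.extend_apply' _ _ _ h]
    simp only [write]
    rw [if_neg]
    rintro ⟨h1, h2⟩
    exact h ⟨⟨p - a, by omega⟩, by simp only [block]; omega⟩

theorem loadU_kt {x : Fin m → Bits n} (hX : LoadsData X.load.1 x) (hQ : a + (l + 3) + n ≤ Q)
    (j : Fin m) {f : ℕ → Bool} (h1 : ∀ k < l, f (a + k) = Nat.testBit j k)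
    (h2 : ∀ k < n, f (a + (l + 3) + k) = false) :
    (loadU Q a X).1 *ᵥ kt f = kt (write f (a + (l + 3)) n (bitsOf (x j))) := by
  have e : (fun k => f (Sum.elim (block l a) (block n (a + (l + 3))) k)) =
      Sum.elim (binary l j) (zeros (Fin n)) := by
    ext (k | k)
    · exact h1 k k.2
    · exact h2 k k.2
  rw [loadU, opAt_kt (valid_load (by omega) (by omega) (by omega) (by simp)), if_pos (by simp), e]
  simp only [hX.2, ite_smul, one_smul, zero_smul, Finset.sum_ite_eq', Finset.mem_univ, if_true]
  rw [extend_blocks (by omega)]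
  congr 1
  ext p
  simp only [write, Sum.elim_inl, Sum.elim_inr]
  split_ifs with h3 h4
  · rfl
  · rw [bitsOf, dif_pos (by omega)]
    simp only [binary]
    rw [← h1 _ (by omega)]
    congr 1
    omega
  · rfl

theorem featU_kt {Φ : Bits n → EuclideanSpace ℝ (Bits N)} (hX : IsQuantumFeatureMap X.feat.1 Φ)
    (hQ : a + (l + 3) + n + N ≤ Q) {x : Bits n} (hx : Φ x ≠ 0) {f : ℕ → Bool}
    (h1 : ∀ k < n, f (a + (l + 3) + k) = bitsOf x k)
    (h2 : ∀ k < N, f (a + (l + 3) + n + k) = false) (hQ0 : 0 < Q) :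
    (featU Q a X).1 *ᵥ kt f = ∑ b : Bits N, ((Φ x b / ‖Φ x‖ : ℝ) : ℂ) •
      kt (write f (a + (l + 3) + n) N (bitsOf b)) := by
  have e : (fun k => f (Sum.elim (block n (a + (l + 3))) (block N (a + (l + 3) + n)) k)) =
      Sum.elim x (zeros (Fin N)) := by
    ext (k | k)
    · exact (h1 k k.2).trans (bitsOf_fin x k)
    · exact h2 k k.2
  rw [featU, opAt_kt (valid_load hQ0 (by omega) (by omega) (by simp)), if_pos (by simp), e,
    ← (Equiv.sumArrowEquivProdArrow (Fin n) (Fin N) Bool).symm.sum_comp, Fintype.sum_prod_type,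
    Finset.sum_eq_single x]
  · refine Finset.sum_congr rfl fun b _ => ?_
    have e2 : (Equiv.sumArrowEquivProdArrow (Fin n) (Fin N) Bool).symm (x, b) = Sum.elim x b := rfl
    rw [e2, hX.2 x hx, if_pos rfl, extend_blocks (by omega)]
    congr 2
    ext p
    simp only [write, Sum.elim_inl, Sum.elim_inr]
    split_ifs with h3 h4
    · rfl
    · rw [← h1 _ (by omega)]
      congr 1
      omega
    · rfl
  · intro z _ hz
    refine Finset.sum_eq_zero fun b _ => ?_
    have e2 : (Equiv.sumArrowEquivProdArrow (Fin n) (Fin N) Bool).symm (z, b) = Sum.elim z b := rfl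
    rw [e2, hX.2 x hx, if_neg hz, zero_smul]
  · simp

theorem prepU_kt {v : EuclideanSpace ℝ (Fin m)} (hX : PreparesVector X.prep.1 v)
    (hQ : a + (l + 3) ≤ Q) {f : ℕ → Bool} (hg : f (a + (l + 2)) = true)
    (h1 : ∀ k < l, f (a + k) = false) :
    (prepU Q a X).1 *ᵥ kt f = ∑ j : Fin m, ((v j / ‖v‖ : ℝ) : ℂ) •
      kt (write f a l (Nat.testBit j)) := by
  have e : (fun k => f (block l a k)) = zeros (Fin l) := by
    ext k
    exact h1 k k.2
  rw [prepU, opAt_kt (valid_prep (by omega) (by omega) (by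
    intro c hc
    rw [List.mem_singleton] at hc
    omega)), if_pos (by simpa using hg), e]
  simp only [hX.2, Complex.ofReal_sum, Finset.sum_smul, extend_block]
  rw [Finset.sum_comm]
  refine Finset.sum_congr rfl fun j _ => ?_
  rw [Finset.sum_eq_single (binary l j)]
  · rw [if_pos rfl]
    congr 2
    ext p
    simp only [write]
    split_ifs with h3
    · rw [bitsOf, dif_pos (by omega)]
      rfl
    · rfl
  · intro b _ hb
    rw [if_neg (Ne.symm hb), Complex.ofReal_zero, zero_smul]
  · simp

theorem prepU_kt_of_false (hQ : a + (l + 3) ≤ Q) {f : ℕ → Bool} (hg : f (a + (l + 2)) = false) :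
    (prepU Q a X).1 *ᵥ kt f = kt f := by
  rw [prepU, opAt_kt (valid_prep (by omega) (by omega) (by
    intro c hc
    rw [List.mem_singleton] at hc
    omega)), if_neg (by simp [hg])]

/-- Loading the datum, applying the feature map and unloading the datum. -/
theorem load_feat_kt {x : Fin m → Bits n} (hX : LoadsData X.load.1 x)
    {Φ : Bits n → EuclideanSpace ℝ (Bits N)} (hF : IsQuantumFeatureMap X.feat.1 Φ)
    (hQ : a + (l + 3) + n + N ≤ Q) (j : Fin m) (hj : Φ (x j) ≠ 0) {f : ℕ → Bool}
    (h1 : ∀ k < l, f (a + k) = Nat.testBit j k)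
    (h2 : ∀ k < n + N, f (a + (l + 3) + k) = false) :
    ((loadU Q a X)⁻¹ * featU Q a X * loadU Q a X).1 *ᵥ kt f =
      ∑ b : Bits N, ((Φ (x j) b / ‖Φ (x j)‖ : ℝ) : ℂ) •
        kt (write f (a + (l + 3) + n) N (bitsOf b)) := by
  rw [UOp.mul_mulVec, UOp.mul_mulVec, loadU_kt hX (by omega) j h1 (fun k hk => h2 k (by omega)),
    featU_kt hF hQ hj _ _ (by omega), mulVec_sum_smul]
  · refine Finset.sum_congr rfl fun b _ => ?_
    congr 1
    refine UOp.inv_mulVec_eq ?_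
    rw [loadU_kt hX (by omega) j]
    · congr 1
      ext p
      simp only [write]
      split_ifs <;> first | rfl | omega
    · intro k hk
      simp only [write]
      rw [if_neg (by omega), h1 k hk]
    · intro k hk
      simp only [write]
      rw [if_neg (by omega), h2 k (by omega)]
  · intro k hk
    simp only [write]
    rw [if_pos (by omega), Nat.add_sub_cancel_left]
  · intro k hk
    simp only [write]
    rw [if_neg (by omega), add_assoc, h2 _ (by omega)]

theorem spreadU_kt_of_false (hQ : a + (l + 3) ≤ Q) {f : ℕ → Bool}
    (hg : f (a + (l + 2)) = false) : (spreadU Q l a).1 *ᵥ kt f = kt f := by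
  have h : ∀ k ≤ l + 2, (prodU (fun j => gateAt Q [a + (l + 2)] hMat (a + j)) k).1 *ᵥ kt f =
      kt f := by
    intro k hk
    induction k with
    | zero => exact UOp.one_mulVec _
    | succ k ih =>
      rw [prodU, UOp.mul_mulVec, ih (by omega), hGate_kt (by omega) (by
        intro c hc
        rw [List.mem_singleton] at hc
        omega), if_neg (by simp [hg])]
  exact h _ le_rfl

/-- The amplitudes of a uniform superposition. -/
theorem spreadU_kt_apply (hQ : a + (l + 3) ≤ Q) {f : ℕ → Bool}
    (hg : f (a + (l + 2)) = true) (h0 : ∀ k < l + 2, f (a + k) = false) (f' : ℕ → Bool) :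
    ((spreadU Q l a).1 *ᵥ kt f) (fun p : Fin Q => f' p) =
      if ∀ p < Q, (p < a ∨ a + (l + 2) ≤ p) → f' p = f p then
        ((1 / Real.sqrt 2 : ℝ) : ℂ) ^ (l + 2) else 0 := by
  have kt_eq : ∀ f₁ f₂ : ℕ → Bool, (kt f₁ : Bits Q → ℂ) (fun p : Fin Q => f₂ p) =
      if ∀ p < Q, f₂ p = f₁ p then 1 else 0 := by
    intro f₁ f₂
    rw [kt, ket_apply]
    refine if_congr ?_ rfl rfl
    rw [funext_iff]
    exact ⟨fun h p hp => h ⟨p, hp⟩, fun h p => h p p.2⟩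
  have h : ∀ k ≤ l + 2, ∀ f' : ℕ → Bool,
      ((prodU (fun j => gateAt Q [a + (l + 2)] hMat (a + j)) k).1 *ᵥ kt f)
        (fun p : Fin Q => f' p) =
      if ∀ p < Q, (p < a ∨ a + k ≤ p) → f' p = f p then
        ((1 / Real.sqrt 2 : ℝ) : ℂ) ^ k else 0 := by
    intro k hk
    induction k with
    | zero =>
      intro f'
      rw [prodU, UOp.one_mulVec, kt_eq]
      refine if_congr ?_ (by simp) rfl
      exact ⟨fun h p hp _ => h p hp, fun h p hp => h p hp (by omega)⟩
    | succ k ih =>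
      intro f'
      have hc : ∀ c ∈ [a + (l + 2)], c < Q ∧ c ≠ a + k := by
        intro c hc
        rw [List.mem_singleton] at hc
        omega
      have hv := valid_gate (Q := Q) (a := a + k) (cs := [a + (l + 2)]) (by omega) hc
      have hH : hMat * hMatᴴ = 1 := by rw [hMat_conjTranspose, hMat_sq]
      rw [prodU, UOp.mul_mulVec, gateAt, dif_pos hH, opAt_mulVec hv]
      have hcg := hv.forall_control (fun c => f' c = true)
      simp only [actOn, hv.extend_target, extend_one]
      rw [← (Equiv.funUnique (Fin 1) Bool).symm.sum_comp, Fintype.sum_bool, ih (by omega),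
        ih (by omega), ih (by omega)]
      by_cases hg' : f' (a + (l + 2)) = true
      · rw [if_pos (hcg.2 (by simpa using hg'))]
        have e1 : ¬ ∀ p < Q, (p < a ∨ a + k ≤ p) → Function.update f' (a + k) true p = f p := by
          intro h
          have := h (a + k) (by omega) (by omega)
          rw [Function.update_self, h0 k (by omega)] at this
          exact absurd this (by simp)
        have e2 : (∀ p < Q, (p < a ∨ a + k ≤ p) → Function.update f' (a + k) false p = f p) ↔
            ∀ p < Q, (p < a ∨ a + (k + 1) ≤ p) → f' p = f p := by
          constructor
          · intro h p hp hp'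
            have := h p hp (by omega)
            rwa [Function.update_of_ne (by omega)] at this
          · intro h p hp hp'
            by_cases e : p = a + k
            · subst e
              rw [Function.update_self, h0 k (by omega)]
            · rw [Function.update_of_ne e]
              exact h p hp (by omega)
        have e3 : ((Equiv.funUnique (Fin 1) Bool).symm true) 0 = true := rfl
        have e4 : ((Equiv.funUnique (Fin 1) Bool).symm false) 0 = false := rfl
        rw [e3, e4, if_neg e1, mul_zero, zero_add]
        have e5 : onOne hMat (fun i => f' (hv.target i))
            ((Equiv.funUnique (Fin 1) Bool).symm false) = ((1 / Real.sqrt 2 : ℝ) : ℂ) := by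
          simp only [onOne, hMat_apply, e4, Bool.and_false, Bool.false_eq_true, if_false]
        rw [e5]
        by_cases e6 : ∀ p < Q, (p < a ∨ a + (k + 1) ≤ p) → f' p = f p
        · rw [if_pos (e2.2 e6), if_pos e6, pow_succ']
        · rw [if_neg fun h => e6 (e2.1 h), if_neg e6, mul_zero]
      · rw [if_neg fun h => hg' (hcg.1 h _ (by simp)), if_neg, if_neg]
        · intro h
          exact hg' ((h _ (by omega) (by omega)).trans hg)
        · intro h
          exact hg' ((h _ (by omega) (by omega)).trans hg)
  exact h _ le_rfl f'

end Overlap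

/-! ### The mirror -/

section Mirror

variable {m l n N Q a : ℕ} {X : Boxes l n N}

/-- The unitary operators of the black boxes do what is required of them, for the data `x`, the
feature map `Φ` and the stored vector `v`, which vanishes where the feature vector does. -/
structure Realizes (X : Boxes l n N) (x : Fin m → Bits n) (Φ : Bits n → EuclideanSpace ℝ (Bits N))
    (v : EuclideanSpace ℝ (Fin m)) : Prop where
  load : LoadsData X.load.1 x
  prep : PreparesVector X.prep.1 v
  feat : IsQuantumFeatureMap X.feat.1 Φ
  zero : ∀ j, Φ (x j) = 0 → v j = 0

/-- The inner product of the two states; `(1 / √2) ^ (l + 2)` is the amplitude of a uniform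
superposition. Where a feature vector vanishes, the quotients are zero. -/
noncomputable def overlap (l : ℕ) (x : Fin m → Bits n) (Φ : Bits n → EuclideanSpace ℝ (Bits N))
    (v : EuclideanSpace ℝ (Fin m)) (i : Fin m) : ℝ :=
  ∑ j, ∑ b, (v j / ‖v‖) * (Φ (x j) b / ‖Φ (x j)‖) * (Φ (x i) b / ‖Φ (x i)‖) *
    (1 / Real.sqrt 2) ^ (l + 2)

variable {x : Fin m → Bits n} {Φ : Bits n → EuclideanSpace ℝ (Bits N)}
  {v : EuclideanSpace ℝ (Fin m)} {i : Fin m}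

theorem flipBits_of_false {l i a : ℕ} {f : ℕ → Bool} (h : f (a + (l + 2)) = false) :
    flipBits l i a f = f := by
  ext p
  simp [flipBits, h]

/-- The state that is prepared when the selecting qubit is `0`. -/
theorem stateU_kt_zero (hX : Realizes X x Φ v) (hQ : a + (l + n + (N + 3)) ≤ Q)
    {f : ℕ → Bool} (hf : ∀ k < l + n + (N + 3), f (a + k) = false) :
    (stateU Q i a X).1 *ᵥ kt f = ∑ j : Fin m, ((v j / ‖v‖ : ℝ) : ℂ) •
      ∑ b : Bits N, ((Φ (x j) b / ‖Φ (x j)‖ : ℝ) : ℂ) •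
        kt (write (write f (a + (l + 3) + n) N (bitsOf b)) a l (Nat.testBit j)) := by
  have hg : f (a + (l + 2)) = false := hf _ (by omega)
  have e : stateU Q i a X = spreadU Q l a * flipU Q l i a * gateAt Q [] xMat (a + (l + 2)) *
      ((loadU Q a X)⁻¹ * featU Q a X * loadU Q a X) * prepU Q a X *
        gateAt Q [] xMat (a + (l + 2)) * flipU Q l i a := by
    simp only [stateU, mul_assoc]
  rw [e, UOp.mul_mulVec, flipU_kt (by omega), flipBits_of_false hg, UOp.mul_mulVec,
    xGate_kt (by omega) (by simp), if_pos (by simp), UOp.mul_mulVec,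
    prepU_kt hX.prep (by omega) (by simp [hg]), mulVec_sum_smul]
  · refine Finset.sum_congr rfl fun j _ => ?_
    by_cases hj : Φ (x j) = 0
    · rw [hX.zero j hj]
      simp
    · congr 1
      rw [UOp.mul_mulVec, load_feat_kt hX.load hX.feat (by omega) j hj, mulVec_sum_smul]
      · refine Finset.sum_congr rfl fun b _ => ?_
        congr 1
        rw [UOp.mul_mulVec, xGate_kt (by omega) (by simp), if_pos (by simp)]
        have e2 : ∀ g : ℕ → Bool, g = write (write f (a + (l + 3) + n) N (bitsOf b)) a l
            (Nat.testBit j) → (spreadU Q l a * flipU Q l i a).1 *ᵥ kt g =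
              kt (write (write f (a + (l + 3) + n) N (bitsOf b)) a l (Nat.testBit j)) := by
          rintro g rfl
          have h3 : write (write f (a + (l + 3) + n) N (bitsOf b)) a l (Nat.testBit j)
              (a + (l + 2)) = false := by
            simp only [write]
            rw [if_neg (by omega), if_neg (by omega), hg]
          rw [UOp.mul_mulVec, flipU_kt (by omega), flipBits_of_false h3,
            spreadU_kt_of_false (by omega) h3]
        refine e2 _ ?_
        ext p
        by_cases hp : p = a + (l + 2)
        · subst hp
          simp only [Function.update_self, write]
          rw [if_neg (by omega), if_neg (by omega), if_neg (by omega), if_neg (by omega),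
            Bool.not_not]
        · rw [Function.update_of_ne hp]
          simp only [write, Function.update_of_ne hp]
          split_ifs <;> first | rfl | omega
      · intro k hk
        simp only [write]
        rw [if_pos (by omega), Nat.add_sub_cancel_left]
      · intro k hk
        simp only [write]
        rw [if_neg (by omega), Function.update_of_ne (by omega), add_assoc, hf _ (by omega)]
  · intro k hk
    rw [Function.update_of_ne (by omega), hf _ (by omega)]

/-- The state that is prepared when the selecting qubit is `1`. -/
theorem stateU_kt_one (hX : Realizes X x Φ v) (hi : Φ (x i) ≠ 0)
    (hQ : a + (l + n + (N + 3)) ≤ Q)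
    {f : ℕ → Bool} (hf : ∀ k < l + n + (N + 3), f (a + k) = false) :
    (stateU Q i a X).1 *ᵥ kt (Function.update f (a + (l + 2)) true) =
      ∑ b : Bits N, ((Φ (x i) b / ‖Φ (x i)‖ : ℝ) : ℂ) • (spreadU Q l a).1 *ᵥ
        kt (write (Function.update f (a + (l + 2)) true) (a + (l + 3) + n) N (bitsOf b)) := by
  have hg : f (a + (l + 2)) = false := hf _ (by omega)
  have e : stateU Q i a X = spreadU Q l a * (flipU Q l i a * (gateAt Q [] xMat (a + (l + 2)) *
      ((loadU Q a X)⁻¹ * featU Q a X * loadU Q a X))) * prepU Q a X *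
        gateAt Q [] xMat (a + (l + 2)) * flipU Q l i a := by
    simp only [stateU, mul_assoc]
  rw [e, UOp.mul_mulVec, flipU_kt (by omega), UOp.mul_mulVec,
    xGate_kt (by omega) (by simp), if_pos (by simp)]
  have e1 : Function.update (flipBits l i a (Function.update f (a + (l + 2)) true))
      (a + (l + 2)) (!flipBits l i a (Function.update f (a + (l + 2)) true) (a + (l + 2))) =
        write f a l (Nat.testBit i) := by
    ext p
    by_cases hp : p = a + (l + 2)
    · subst hp
      have h2 : ¬ a + (l + 2) < a + l := by omega
      simp [flipBits, write, h2, hg]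
    · rw [Function.update_of_ne hp]
      simp only [flipBits, write, Function.update_self, Function.update_of_ne hp, and_true]
      split_ifs with h
      · obtain ⟨k, rfl⟩ : ∃ k, p = a + k := ⟨p - a, by omega⟩
        rw [hf k (by omega), Bool.false_xor]
      · rfl
  have h3 : write f a l (Nat.testBit i) (a + (l + 2)) = false := by
    simp only [write]
    rw [if_neg (by omega), hg]
  rw [e1, UOp.mul_mulVec, prepU_kt_of_false (by omega) h3, UOp.mul_mulVec, UOp.mul_mulVec,
    UOp.mul_mulVec, load_feat_kt hX.load hX.feat (by omega) i hi]
  · rw [mulVec_sum_smul, mulVec_sum_smul, mulVec_sum_smul]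
    refine Finset.sum_congr rfl fun b _ => ?_
    congr 2
    rw [xGate_kt (by omega) (by simp), if_pos (by simp), flipU_kt (by omega)]
    congr 1
    have h2 : ¬ a + (l + 2) < a + l := by omega
    have h4 : ¬ a + (l + 3) + n ≤ a + (l + 2) := by omega
    ext p
    by_cases hp : p = a + (l + 2)
    · subst hp
      simp [flipBits, write, h2, h4, hg]
    · simp only [flipBits, write, Function.update_self, Function.update_of_ne hp, h2, h4,
        false_and, and_false, if_false, hg, Bool.not_false, and_true]
      split_ifs with h5 h6 h7 <;> first | rfl | omega | skip
      obtain ⟨k, rfl⟩ : ∃ k, p = a + k := ⟨p - a, by omega⟩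
      rw [hf k (by omega), Bool.xor_self]
  · intro k hk
    simp only [write]
    rw [if_pos (by omega), Nat.add_sub_cancel_left]
  · intro k hk
    simp only [write]
    rw [if_neg (by omega), add_assoc, hf _ (by omega)]

theorem inn_eq_zero {φ ψ : Bits Q → ℂ} {p : Fin Q} {u : Bool} (h : Holds φ p u)
    (h' : Holds ψ p (!u)) : inn φ ψ = 0 := by
  refine Finset.sum_eq_zero fun b _ => ?_
  by_cases h1 : φ b = 0
  · simp [h1]
  · by_cases h2 : ψ b = 0
    · simp [h2]
    · have := (h b h1).symm.trans (h' b h2)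
      cases u <;> simp at this

theorem holds_sum {J : Type*} {s : Finset J} {ψ : J → Bits Q → ℂ} {p : Fin Q} {u : Bool}
    (h : ∀ j ∈ s, Holds (ψ j) p u) : Holds (∑ j ∈ s, ψ j) p u := by
  intro b hb
  rw [Finset.sum_apply] at hb
  obtain ⟨j, hj, hb'⟩ := Finset.exists_ne_zero_of_sum_ne_zero hb
  exact h j hj b hb'

theorem holds_kt {f : ℕ → Bool} {p : Fin Q} : Holds (kt f) p (f p) := by
  intro b hb
  rw [kt, ket_apply] at hb
  have : b = fun p : Fin Q => f p := by
    by_contra e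
    exact hb (if_neg e)
  rw [this]

/-- A controlled `X` gate inverts its target when the control is `1`. -/
theorem holds_xGate {ψ : Bits Q → ℂ} {p g : Fin Q} {u : Bool} (hpg : p ≠ g)
    (h : Holds ψ p true) (h' : Holds ψ g u) :
    Holds ((gateAt Q [p] xMat g).1 *ᵥ ψ) g (!u) := by
  rw [eq_sum_ket ψ, mulVec_sum_smul]
  refine holds_sum fun b _ => ?_
  by_cases hb : ψ b = 0
  · rw [hb, zero_smul]
    exact fun _ h => absurd rfl h
  · refine Holds.smul ?_ _
    obtain ⟨f, hf⟩ := kt_surj b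
    have e : ∀ q : Fin Q, f q = b q := fun q => by
      have := holds_kt (f := f) (p := q)
      rw [← hf] at this
      exact (this b (by simp [ket])).symm
    rw [hf, xGate_kt g.2 (by
      intro c hc
      rw [List.mem_singleton] at hc
      subst hc
      exact ⟨p.2, fun h => hpg (Fin.ext h)⟩), if_pos (by simp [e, h b hb])]
    have := holds_kt (Q := Q) (f := Function.update f g (!f g)) (p := g)
    rw [← (e g).trans (h' b hb)]
    rwa [Function.update_self] at this

theorem loadU_mem_keeps {p : Fin Q} (hp : (p : ℕ) < a ∨ a + (l + 3) + n ≤ p ∨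
    (p : ℕ) = a + (l + 2)) : loadU Q a X ∈ keeps p := by
  refine opAt_mem_keeps _ _ _ ?_
  rintro (k | k) <;> simp only [Sum.elim_inl, Sum.elim_inr, block] <;> omega

theorem featU_mem_keeps {p : Fin Q} (hp : (p : ℕ) < a ∨ a + (l + 3) + n + N ≤ p ∨
    (p : ℕ) = a + (l + 2)) : featU Q a X ∈ keeps p := by
  refine opAt_mem_keeps _ _ _ ?_
  rintro (k | k) <;> simp only [Sum.elim_inl, Sum.elim_inr, block] <;> omega

theorem stateU_mem_keeps {i : ℕ} {p : Fin Q} (hp : (p : ℕ) < a ∨ a + (l + n + (N + 3)) ≤ p) :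
    stateU Q i a X ∈ keeps p := by
  have h1 : flipU Q l i a ∈ keeps p := flip_mem_keeps (by omega)
  have h2 : gateAt Q [] xMat (a + (l + 2)) ∈ keeps p := gateAt_mem_keeps _ (by omega)
  have h3 : prepU Q a X ∈ keeps p := opAt_mem_keeps _ _ _ fun k => by
    simp only [block]
    omega
  have h4 : loadU Q a X ∈ keeps p := loadU_mem_keeps (by omega)
  have h5 : featU Q a X ∈ keeps p := featU_mem_keeps (by omega)
  have h6 : spreadU Q l a ∈ keeps p := spread_mem_keeps (by omega)
  exact mul_mem (mul_mem (mul_mem (mul_mem (mul_mem (mul_mem (mul_mem (mul_mem h6 h1) h2)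
    (inv_mem h4)) h5) h4) h3) h2) h1

theorem mirrorU_mem_keeps {i : ℕ} {p : Fin Q} (hp : (p : ℕ) < a ∨ a + (l + n + (N + 3)) ≤ p) :
    mirrorU Q i a X ∈ keeps p := by
  have h1 : gateAt Q [] hMat (a + (l + 2)) ∈ keeps p := gateAt_mem_keeps _ (by omega)
  have h2 : ∀ cs, gateAt Q cs xMat (a + (l + 2)) ∈ keeps p := fun _ =>
    gateAt_mem_keeps _ (by omega)
  have h3 : stateU Q i a X ∈ keeps p := stateU_mem_keeps hp
  exact mul_mem (mul_mem (mul_mem (mul_mem h1 (inv_mem h3)) (h2 _)) h3) h1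

/-- Applied twice, the mirror does nothing. -/
theorem mirrorU_sq {i : ℕ} : mirrorU Q i a X * mirrorU Q i a X = 1 := by
  have h1 : gateAt Q [] hMat (a + (l + 2)) * gateAt Q [] hMat (a + (l + 2)) = 1 := hGate_sq
  have h2 : gateAt Q [a + (l + n + (N + 3)) + (l + n + (N + 3) + 1)] xMat (a + (l + 2)) *
    gateAt Q [a + (l + n + (N + 3)) + (l + n + (N + 3) + 1)] xMat (a + (l + 2)) = 1 := xGate_sq
  unfold mirrorU
  generalize gateAt Q [] hMat (a + (l + 2)) = H at *
  generalize gateAt Q [a + (l + n + (N + 3)) + (l + n + (N + 3) + 1)] xMat (a + (l + 2)) = Y at *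
  generalize stateU Q i a X = D
  calc H * D⁻¹ * Y * D * H * (H * D⁻¹ * Y * D * H)
      = H * D⁻¹ * Y * D * (H * H) * D⁻¹ * Y * D * H := by group
    _ = H * D⁻¹ * (Y * Y) * D * H := by rw [h1]; group
    _ = 1 := by rw [h2]; simp [h1]

/-- If the controlling qubit is `0`, the mirror does nothing. -/
theorem mirrorU_of_false {i : ℕ} (hQ : a + (l + n + (N + 3)) + (l + n + (N + 3) + 2) ≤ Q)
    {ψ : Bits Q → ℂ}
    (h : Holds ψ ⟨a + (l + n + (N + 3)) + (l + n + (N + 3) + 1), by omega⟩ false) :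
    (mirrorU Q i a X).1 *ᵥ ψ = ψ := by
  set p : Fin Q := ⟨a + (l + n + (N + 3)) + (l + n + (N + 3) + 1), by omega⟩ with hp
  set H := gateAt Q [] hMat (a + (l + 2)) with hH
  set D := stateU Q i a X with hD
  have h1 : H ∈ keeps p := gateAt_mem_keeps _ (by simp only [hp]; omega)
  have h2 : D ∈ keeps p := stateU_mem_keeps (by simp only [hp]; omega)
  have h3 : Holds ((D * H).1 *ᵥ ψ) p false := h.mulVec (mul_mem h2 h1)
  have h4 : ∀ φ : Bits Q → ℂ, Holds φ p false →
      (gateAt Q [a + (l + n + (N + 3)) + (l + n + (N + 3) + 1)] xMat (a + (l + 2))).1 *ᵥ φ =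
        φ := by
    intro φ hφ
    rw [← UOp.one_mulVec φ, ← UOp.mul_mulVec, mul_one]
    refine mulVec_congr fun b hb => ?_
    have h5 := hφ b hb
    obtain ⟨f, hf⟩ := kt_surj b
    have h6 := holds_kt (f := f) (p := p)
    rw [← hf] at h6
    have h7 := h6 b (by simp [ket])
    rw [hf, xGate_kt (by omega) (by
      intro c hc
      rw [List.mem_singleton] at hc
      omega), if_neg, UOp.one_mulVec]
    intro e
    have := e _ (List.mem_singleton_self _)
    rw [h5] at h7
    exact absurd (h7.trans this) (by simp)
  have e : mirrorU Q i a X = (H * D⁻¹) *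
      (gateAt Q [a + (l + n + (N + 3)) + (l + n + (N + 3) + 1)] xMat (a + (l + 2)) * (D * H)) := by
    simp only [mirrorU, hH, hD, mul_assoc]
  rw [e, UOp.mul_mulVec, UOp.mul_mulVec _ (D * H), h4 _ h3, ← UOp.mul_mulVec]
  have h1 : H * H = 1 := hGate_sq
  have : H * D⁻¹ * (D * H) = 1 := by
    simp [mul_assoc, h1]
  rw [this, UOp.one_mulVec]

end Mirror

/-! ### The expectation of the mirror -/

section Expect

variable {m l n N Q a : ℕ} {X : Boxes l n N}
variable {x : Fin m → Bits n} {Φ : Bits n → EuclideanSpace ℝ (Bits N)}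
  {v : EuclideanSpace ℝ (Fin m)} {i : Fin m}

theorem inn_sum_left {J : Type*} (s : Finset J) (c : J → ℂ) (φ : J → Bits Q → ℂ)
    (ψ : Bits Q → ℂ) : inn (∑ j ∈ s, c j • φ j) ψ = ∑ j ∈ s, star (c j) * inn (φ j) ψ := by
  classical
  induction s using Finset.induction_on with
  | empty => simp [inn]
  | insert j s hj ih => rw [Finset.sum_insert hj, Finset.sum_insert hj, inn_add_left, ih,
      inn_smul_left]

theorem inn_kt (f : ℕ → Bool) (ψ : Bits Q → ℂ) : inn (kt f) ψ = ψ fun p => f p := inn_ket _ _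

/-- The inner product of the two states, prepared from basis states that are zero on the current
block; they are orthogonal if these basis states differ outside the block. -/
theorem inn_states (hX : Realizes X x Φ v) (hi : Φ (x i) ≠ 0)
    (hQ : a + (l + n + (N + 3)) + (l + n + (N + 3) + 2) ≤ Q) {f f' : ℕ → Bool}
    (hf : ∀ k < l + n + (N + 3), f (a + k) = false)
    (hf' : ∀ k < l + n + (N + 3), f' (a + k) = false)
    (hh : f (a + (l + n + (N + 3)) + (l + n + (N + 3) + 1)) = true) :
    inn ((gateAt Q [a + (l + n + (N + 3)) + (l + n + (N + 3) + 1)] xMat (a + (l + 2))).1 *ᵥ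
        ((stateU Q i a X).1 *ᵥ kt f))
      ((stateU Q i a X).1 *ᵥ kt (Function.update f' (a + (l + 2)) true)) =
      if ∀ p < Q, f p = f' p then (overlap l x Φ v i : ℂ) else 0 := by
  have hc : ∀ c ∈ [a + (l + n + (N + 3)) + (l + n + (N + 3) + 1)], c < Q ∧ c ≠ a + (l + 2) := by
    intro c hc
    rw [List.mem_singleton] at hc
    omega
  have key : ∀ (j : Fin m) (b b' : Bits N),
      ((spreadU Q l a).1 *ᵥ
        kt (write (Function.update f' (a + (l + 2)) true) (a + (l + 3) + n) N (bitsOf b')))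
        (fun p : Fin Q => Function.update (write (write f (a + (l + 3) + n) N (bitsOf b)) a l
          (Nat.testBit j)) (a + (l + 2)) true p) =
        if b' = b then (if ∀ p < Q, f p = f' p then
          ((1 / Real.sqrt 2 : ℝ) : ℂ) ^ (l + 2) else 0) else 0 := by
    intro j b b'
    rw [spreadU_kt_apply (by omega)]
    · rw [← ite_and]
      refine if_congr ?_ rfl rfl
      constructor
      · intro h
        refine ⟨?_, fun p hp => ?_⟩
        · ext k
          have := h (a + (l + 3) + n + k) (by omega) (by omega)
          rw [Function.update_of_ne (by omega)] at this
          simp only [write] at this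
          rw [if_neg (by omega), if_pos (by omega), if_pos (by omega), Nat.add_sub_cancel_left,
            bitsOf_fin, bitsOf_fin] at this
          exact this.symm
        · by_cases hp' : a ≤ p ∧ p < a + (l + n + (N + 3))
          · obtain ⟨k, rfl⟩ : ∃ k, p = a + k := ⟨p - a, by omega⟩
            rw [hf k (by omega), hf' k (by omega)]
          · have := h p hp (by omega)
            rw [Function.update_of_ne (by omega)] at this
            simp only [write] at this
            rwa [if_neg (by omega), if_neg (by omega), if_neg (by omega),
              Function.update_of_ne (by omega)] at this
      · rintro ⟨rfl, h⟩ p hp hp'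
        by_cases e : p = a + (l + 2)
        · subst e
          rw [Function.update_self]
          simp only [write]
          rw [if_neg (by omega), Function.update_self]
        · rw [Function.update_of_ne e]
          simp only [write]
          rw [if_neg (by omega), Function.update_of_ne e, h p hp]
    · simp only [write]
      rw [if_neg (by omega), Function.update_self]
    · intro k hk
      simp only [write]
      rw [if_neg (by omega), Function.update_of_ne (by omega), hf' k (by omega)]
  rw [stateU_kt_zero hX (by omega) hf, stateU_kt_one hX hi (by omega) hf', mulVec_sum_smul,
    inn_sum_left]
  have e1 : ∀ j : Fin m, star ((v j / ‖v‖ : ℝ) : ℂ) * inn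
      ((gateAt Q [a + (l + n + (N + 3)) + (l + n + (N + 3) + 1)] xMat (a + (l + 2))).1 *ᵥ
        ∑ b : Bits N, ((Φ (x j) b / ‖Φ (x j)‖ : ℝ) : ℂ) •
          kt (write (write f (a + (l + 3) + n) N (bitsOf b)) a l (Nat.testBit j)))
      (∑ b : Bits N, ((Φ (x i) b / ‖Φ (x i)‖ : ℝ) : ℂ) • (spreadU Q l a).1 *ᵥ
        kt (write (Function.update f' (a + (l + 2)) true) (a + (l + 3) + n) N (bitsOf b))) =
      if ∀ p < Q, f p = f' p then ((∑ b, (v j / ‖v‖) * (Φ (x j) b / ‖Φ (x j)‖) *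
        (Φ (x i) b / ‖Φ (x i)‖) * (1 / Real.sqrt 2) ^ (l + 2) : ℝ) : ℂ) else 0 := by
    intro j
    have e2 : ∀ r : ℝ, star (r : ℂ) = r := fun r => Complex.conj_ofReal r
    rw [mulVec_sum_smul, inn_sum_left, e2, Finset.mul_sum, Complex.ofReal_sum]
    have e3 : ∀ b : Bits N, inn
        ((gateAt Q [a + (l + n + (N + 3)) + (l + n + (N + 3) + 1)] xMat (a + (l + 2))).1 *ᵥ
          kt (write (write f (a + (l + 3) + n) N (bitsOf b)) a l (Nat.testBit j)))
        (∑ b : Bits N, ((Φ (x i) b / ‖Φ (x i)‖ : ℝ) : ℂ) • (spreadU Q l a).1 *ᵥ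
          kt (write (Function.update f' (a + (l + 2)) true) (a + (l + 3) + n) N (bitsOf b))) =
        ((Φ (x i) b / ‖Φ (x i)‖ : ℝ) : ℂ) * if ∀ p < Q, f p = f' p then
          ((1 / Real.sqrt 2 : ℝ) : ℂ) ^ (l + 2) else 0 := by
      intro b
      have e4 : write (write f (a + (l + 3) + n) N (bitsOf b)) a l (Nat.testBit j)
          (a + (l + 2)) = false := by
        simp only [write]
        rw [if_neg (by omega), if_neg (by omega), hf _ (by omega)]
      rw [xGate_kt (by omega) hc, if_pos, e4, Bool.not_false, inn_kt, Finset.sum_apply]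
      · simp only [Pi.smul_apply, key, smul_eq_mul, mul_ite, mul_zero, Finset.sum_ite_eq',
          Finset.mem_univ, if_true]
      · intro c hc'
        rw [List.mem_singleton] at hc'
        subst hc'
        simp only [write]
        rw [if_neg (by omega), if_neg (by omega), hh]
    simp only [e3, e2]
    split_ifs
    · refine Finset.sum_congr rfl fun b _ => ?_
      push_cast
      ring
    · simp
  rw [Finset.sum_congr rfl fun j _ => e1 j, overlap]
  split_ifs
  · rw [Complex.ofReal_sum]
  · simp

theorem inn_halves {Y : UOp Q} {A B A' B' : Bits Q → ℂ} {c : ℂ} (h1 : inn A (Y.1 *ᵥ A') = 0)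
    (h2 : inn A (Y.1 *ᵥ B') = c) (h3 : inn B (Y.1 *ᵥ A') = c) (h4 : inn B (Y.1 *ᵥ B') = 0) :
    inn (((1 / Real.sqrt 2 : ℝ) : ℂ) • (A + B))
      (Y.1 *ᵥ (((1 / Real.sqrt 2 : ℝ) : ℂ) • (A' + B'))) = c := by
  have hs : star ((1 / Real.sqrt 2 : ℝ) : ℂ) = ((1 / Real.sqrt 2 : ℝ) : ℂ) :=
    Complex.conj_ofReal _
  rw [Matrix.mulVec_smul, inn_smul_left, inn_smul_right, hs, Matrix.mulVec_add, inn_add_left,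
    inn_add_right, inn_add_right, h1, h2, h3, h4, ← mul_assoc, sqrt_half_mul_self]
  ring

theorem hGate_kt_of_false {p : ℕ} (hp : p < Q) {f : ℕ → Bool} (hf : f p = false) :
    (gateAt Q [] hMat p).1 *ᵥ kt f =
      ((1 / Real.sqrt 2 : ℝ) : ℂ) • (kt f + kt (Function.update f p true)) := by
  rw [hGate_kt hp (by simp), if_pos (by simp), hf]
  have : Function.update f p false = f := by rw [← hf, Function.update_eq_self]
  rw [this]
  simp only [Bool.false_eq_true, if_false, one_smul]

theorem holds_stateU_zero (hX : Realizes X x Φ v) (hQ : a + (l + n + (N + 3)) ≤ Q)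
    {f : ℕ → Bool} (hf : ∀ k < l + n + (N + 3), f (a + k) = false) {g : Fin Q}
    (hg : (g : ℕ) = a + (l + 2)) : Holds ((stateU Q i a X).1 *ᵥ kt f) g false := by
  rw [stateU_kt_zero hX hQ hf]
  refine holds_sum fun j _ => Holds.smul (holds_sum fun b _ => Holds.smul ?_ _) _
  have := holds_kt (Q := Q)
    (f := write (write f (a + (l + 3) + n) N (bitsOf b)) a l (Nat.testBit j)) (p := g)
  rwa [show write (write f (a + (l + 3) + n) N (bitsOf b)) a l (Nat.testBit j) g = false by
    simp only [write, hg]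
    rw [if_neg (by omega), if_neg (by omega), hf _ (by omega)]] at this

theorem holds_stateU_one (hX : Realizes X x Φ v) (hi : Φ (x i) ≠ 0)
    (hQ : a + (l + n + (N + 3)) ≤ Q)
    {f : ℕ → Bool} (hf : ∀ k < l + n + (N + 3), f (a + k) = false) {g : Fin Q}
    (hg : (g : ℕ) = a + (l + 2)) :
    Holds ((stateU Q i a X).1 *ᵥ kt (Function.update f (a + (l + 2)) true)) g true := by
  rw [stateU_kt_one hX hi hQ hf]
  refine holds_sum fun b _ => Holds.smul (Holds.mulVec ?_ (spread_mem_keeps (by omega))) _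
  have := holds_kt (Q := Q) (f := write (Function.update f (a + (l + 2)) true)
    (a + (l + 3) + n) N (bitsOf b)) (p := g)
  rwa [show write (Function.update f (a + (l + 2)) true) (a + (l + 3) + n) N (bitsOf b) g =
    true by
      simp only [write, hg]
      rw [if_neg (by omega), Function.update_self]] at this

theorem holds_xGate_at {ψ : Bits Q → ℂ} {p g : Fin Q} {c b : ℕ} (hp : (p : ℕ) = c)
    (hg : (g : ℕ) = b) (hcb : c ≠ b) {u : Bool} (h : Holds ψ p true) (h' : Holds ψ g u) :
    Holds ((gateAt Q [c] xMat b).1 *ᵥ ψ) g (!u) := by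
  subst hp hg
  exact holds_xGate (fun e => hcb (congrArg _ e)) h h'

/-- The matrix entries of the mirror between basis states that are zero on the block. -/
theorem inn_mirror (hX : Realizes X x Φ v) (hi : Φ (x i) ≠ 0)
    (hQ : a + (l + n + (N + 3)) + (l + n + (N + 3) + 2) ≤ Q) {f f' : ℕ → Bool}
    (hf : ∀ k < l + n + (N + 3), f (a + k) = false)
    (hf' : ∀ k < l + n + (N + 3), f' (a + k) = false)
    (hh : f (a + (l + n + (N + 3)) + (l + n + (N + 3) + 1)) = true)
    (hh' : f' (a + (l + n + (N + 3)) + (l + n + (N + 3) + 1)) = true) :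
    inn (kt f) ((mirrorU Q i a X).1 *ᵥ kt f') =
      if ∀ p < Q, f p = f' p then (overlap l x Φ v i : ℂ) else 0 := by
  have e1 := inn_states hX hi hQ hf hf' hh
  have e2 := inn_states hX hi hQ hf' hf hh'
  have h0 := hGate_kt_of_false (Q := Q) (p := a + (l + 2)) (by omega) (hf (l + 2) (by omega))
  have h0' := hGate_kt_of_false (Q := Q) (p := a + (l + 2)) (by omega) (hf' (l + 2) (by omega))
  obtain ⟨g, hg⟩ : ∃ g : Fin Q, (g : ℕ) = a + (l + 2) := ⟨⟨a + (l + 2), by omega⟩, rfl⟩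
  obtain ⟨p, hp⟩ : ∃ p : Fin Q, (p : ℕ) = a + (l + n + (N + 3)) + (l + n + (N + 3) + 1) :=
    ⟨⟨a + (l + n + (N + 3)) + (l + n + (N + 3) + 1), by omega⟩, rfl⟩
  have a0 := holds_stateU_zero (i := i) hX (by omega) hf hg
  have a0' := holds_stateU_zero (i := i) hX (by omega) hf' hg
  have a1 := holds_stateU_one hX hi (by omega) hf hg
  have a1' := holds_stateU_one hX hi (by omega) hf' hg
  have hpD : ∀ (F : ℕ → Bool), F (a + (l + n + (N + 3)) + (l + n + (N + 3) + 1)) = true →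
      Holds ((stateU Q i a X).1 *ᵥ kt F) p true := by
    intro F hF
    have := (holds_kt (Q := Q) (f := F) (p := p)).mulVec
      (stateU_mem_keeps (X := X) (i := i) (a := a) (by omega))
    rwa [hp, hF] at this
  have hYx : ∀ (φ : Bits Q → ℂ) (u : Bool), Holds φ p true → Holds φ g u →
      Holds ((gateAt Q [a + (l + n + (N + 3)) + (l + n + (N + 3) + 1)] xMat (a + (l + 2))).1 *ᵥ φ)
        g (!u) :=
    fun φ u h1 h2 => holds_xGate_at hp hg (by omega) h1 h2
  have p0' := hpD f' hh'
  have p1' := hpD (Function.update f' (a + (l + 2)) true)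
    (by rw [Function.update_of_ne (by omega), hh'])
  have hYY : gateAt Q [a + (l + n + (N + 3)) + (l + n + (N + 3) + 1)] xMat (a + (l + 2)) *
    gateAt Q [a + (l + n + (N + 3)) + (l + n + (N + 3) + 1)] xMat (a + (l + 2)) = 1 := xGate_sq
  have hHH : gateAt Q [] hMat (a + (l + 2)) * gateAt Q [] hMat (a + (l + 2)) = 1 := hGate_sq
  unfold mirrorU
  generalize gateAt Q [] hMat (a + (l + 2)) = H at *
  generalize gateAt Q [a + (l + n + (N + 3)) + (l + n + (N + 3) + 1)] xMat (a + (l + 2)) = Y at *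
  generalize stateU Q i a X = D at *
  have hYa : ∀ φ χ : Bits Q → ℂ, inn φ (Y.1 *ᵥ χ) = inn (Y.1 *ᵥ φ) χ := by
    intro φ χ
    rw [← inn_mulVec Y φ, ← UOp.mul_mulVec, hYY, UOp.one_mulVec]
  have hM : H * D⁻¹ * Y * D * H = (D * H)⁻¹ * (Y * (D * H)) := by
    rw [_root_.mul_inv_rev, inv_eq_of_mul_eq_one_left hHH]
    simp only [mul_assoc]
  rw [hM, UOp.mul_mulVec, inn_inv, UOp.mul_mulVec, UOp.mul_mulVec, UOp.mul_mulVec, h0, h0',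
    Matrix.mulVec_smul, Matrix.mulVec_smul, Matrix.mulVec_add, Matrix.mulVec_add]
  refine inn_halves (inn_eq_zero a0 (hYx _ _ p0' a0')) ?_ ?_ (inn_eq_zero a1 (hYx _ _ p1' a1'))
  · rw [hYa, e1]
  · rw [← inn_conj, e2]
    have : (∀ p < Q, f' p = f p) ↔ ∀ p < Q, f p = f' p :=
      forall₂_congr fun _ _ => eq_comm
    simp only [this]
    split_ifs
    · exact Complex.conj_ofReal _
    · simp

/-- On the basis states that are zero on the current block, the amplitudes of a state that lives
there are multiplied by the overlap: compressed to this subspace, the mirror is a scalar. -/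
theorem mirrorU_apply (hX : Realizes X x Φ v) (hi : Φ (x i) ≠ 0)
    (hQ : a + (l + n + (N + 3)) + (l + n + (N + 3) + 2) ≤ Q) {ψ : Bits Q → ℂ}
    (hψ : ∀ p : Fin Q, a ≤ p → (p : ℕ) < a + (l + n + (N + 3)) → Holds ψ p false)
    (hψ' : Holds ψ ⟨a + (l + n + (N + 3)) + (l + n + (N + 3) + 1), by omega⟩ true)
    {f : ℕ → Bool} (hf : ∀ k < l + n + (N + 3), f (a + k) = false)
    (hh : f (a + (l + n + (N + 3)) + (l + n + (N + 3) + 1)) = true) :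
    ((mirrorU Q i a X).1 *ᵥ ψ) (fun p => f p) =
      (overlap l x Φ v i : ℂ) * ψ (fun p => f p) := by
  have inn_sum_right : ∀ φ : Bits Q → ℂ, inn φ (∑ b, ψ b • (mirrorU Q i a X).1 *ᵥ ket b) =
      ∑ b, ψ b * inn φ ((mirrorU Q i a X).1 *ᵥ ket b) := by
    intro φ
    rw [inn, dotProduct_sum]
    exact Finset.sum_congr rfl fun b _ => inn_smul_right _ _ _
  rw [← inn_kt f ((mirrorU Q i a X).1 *ᵥ ψ)]
  conv_lhs => rw [eq_sum_ket ψ]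
  rw [mulVec_sum_smul]
  rw [inn_sum_right, Finset.sum_eq_single fun p : Fin Q => f p]
  · rw [show (ket fun p : Fin Q => f p) = kt f from rfl, inn_mirror hX hi hQ hf hf hh hh,
      if_pos fun _ _ => rfl, mul_comm]
  · intro b _ hb
    by_cases hb0 : ψ b = 0
    · rw [hb0, zero_mul]
    · obtain ⟨f', hf'⟩ := kt_surj b
      have e : ∀ q : Fin Q, f' q = b q := fun q => by
        have := holds_kt (f := f') (p := q)
        rw [← hf'] at this
        exact (this b (by simp [ket])).symm
      rw [hf', inn_mirror hX hi hQ hf _ hh, if_neg, mul_zero]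
      · intro h
        exact hb (funext fun q => by rw [← e q, ← h q q.2])
      · have := e ⟨a + (l + n + (N + 3)) + (l + n + (N + 3) + 1), by omega⟩
        rw [this]
        exact hψ' b hb0
      · intro k hk
        have := e ⟨a + k, by omega⟩
        rw [this]
        exact hψ ⟨a + k, by omega⟩ (by simp) (by simpa using hk) b hb0
  · simp

end Expect

/-! ### The phases of the walk -/

section Sign

variable {Q q a : ℕ}

/-- The action of `ladderU` on the bits of a basis state, up to step `k`: exclusive disjunctions, as
the auxiliary qubits need not be zero at first. -/
def ladderBits (q a : ℕ) (f : ℕ → Bool) : ℕ → ℕ → Bool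
  | 0 => Function.update f (a + q) (!f (a + q))
  | k + 1 => Function.update (ladderBits q a f k) (a + q + (k + 1))
      (xor (ladderBits q a f k (a + q + (k + 1)))
        (ladderBits q a f k (a + q + k) && !ladderBits q a f k (a + k)))

theorem ladderU_kt (hQ : a + q + (q + 2) ≤ Q) (f : ℕ → Bool) :
    (ladderU Q q a).1 *ᵥ kt f = kt (ladderBits q a f q) := by
  have h : ∀ k ≤ q, (prodU (ladderStep Q q a) k * gateAt Q [] xMat (a + q)).1 *ᵥ kt f =
      kt (ladderBits q a f k) := by
    intro k hk
    induction k with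
    | zero =>
      rw [prodU, one_mul, xGate_kt (by omega) (by simp), if_pos (by simp)]
      rfl
    | succ k ih =>
      rw [prodU, mul_assoc, UOp.mul_mulVec, ih (by omega), ladderStep, UOp.mul_mulVec,
        xGate_kt (by omega) (by
          intro c hc
          rw [List.mem_singleton] at hc
          omega)]
      have hc : ∀ c ∈ [a + q + k, a + k], c < Q ∧ c ≠ a + q + (k + 1) := by
        intro c hc
        simp only [List.mem_cons, List.not_mem_nil, or_false] at hc
        omega
      have e1 : a + q + k ≠ a + q + (k + 1) := by omega
      have e2 : a + k ≠ a + q + (k + 1) := by omega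
      rw [ladderBits]
      generalize ladderBits q a f k = F
      by_cases h1 : F (a + q + k) = true
      · rw [if_pos (by simpa using h1), xGate_kt (by omega) hc]
        by_cases h2 : F (a + k) = true
        · rw [if_pos (by simp [Function.update_of_ne e2, h1, h2])]
          simp [h2]
        · rw [if_neg (by simp [Function.update_of_ne e2, h1, h2])]
          simp [h1, h2]
      · rw [if_neg (by simpa using h1), xGate_kt (by omega) hc, if_neg (by simp [h1])]
        simp [h1]
  exact h q le_rfl

theorem ladderBits_of_ne {f : ℕ → Bool} {k p : ℕ} (hp : p < a + q ∨ a + q + k < p) :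
    ladderBits q a f k p = f p := by
  induction k with
  | zero => rw [ladderBits, Function.update_of_ne (by omega)]
  | succ k ih => rw [ladderBits, Function.update_of_ne (by omega), ih (by omega)]

/-- If the auxiliary qubits are zero at first, the `k`-th of them then tells whether the first `k`
bits of the block are zero. -/
theorem ladderBits_last {f : ℕ → Bool} (hf : ∀ j ≤ q, f (a + q + j) = false) {k : ℕ}
    (hk : k ≤ q) : ladderBits q a f k (a + q + k) = true ↔ ∀ j < k, f (a + j) = false := by
  induction k with
  | zero => simp [ladderBits, show f (a + q) = false from hf 0 (by omega)]
  | succ k ih =>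
    rw [ladderBits, Function.update_self, ladderBits_of_ne (by omega), hf _ hk, Bool.false_xor,
      Bool.and_eq_true, ih (by omega), ladderBits_of_ne (by omega)]
    constructor
    · rintro ⟨h1, h2⟩ j hj
      rcases Nat.lt_succ_iff_lt_or_eq.1 hj with hj | rfl
      · exact h1 j hj
      · simpa using h2
    · intro h
      exact ⟨fun j hj => h j (by omega), by simp [h k (by omega)]⟩

theorem signU_kt (hQ : a + q + (q + 2) ≤ Q) (f : ℕ → Bool) :
    (signU Q q a).1 *ᵥ kt f =
      (if f (a + q + (q + 1)) = true ∧ ladderBits q a f q (a + q + q) = true then (-1 : ℂ) else 1) •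
        kt f := by
  have hc : ∀ c ∈ [a + q + (q + 1)], c < Q ∧ c ≠ a + q + q := by
    intro c hc
    rw [List.mem_singleton] at hc
    omega
  have e : Complex.exp (2 * Real.pi * Complex.I * ((1 / 2 : ℝ) : ℂ)) = -1 := by
    rw [← Complex.exp_pi_mul_I]
    congr 1
    push_cast
    ring
  rw [signU, mul_assoc, UOp.mul_mulVec, UOp.mul_mulVec, ladderU_kt hQ,
    phaseGate_kt (by omega) hc, Matrix.mulVec_smul, e]
  congr 1
  · refine if_congr ?_ rfl rfl
    rw [List.forall_mem_singleton, ladderBits_of_ne (p := a + q + (q + 1)) (by omega)]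
  · exact UOp.inv_mulVec_eq (ladderU_kt hQ f)

theorem signU_mem_keeps {p : Fin Q} (hp : (p : ℕ) < a + q ∨ a + q + q < p) :
    signU Q q a ∈ keeps p := by
  have h1 : ladderU Q q a ∈ keeps p := by
    refine mul_mem (prodU_mem fun j hj => ?_) (gateAt_mem_keeps _ (by omega))
    exact mul_mem (gateAt_mem_keeps _ (by omega)) (gateAt_mem_keeps _ (by omega))
  exact mul_mem (mul_mem (inv_mem h1) (gateAt_mem_keeps _ (by omega))) h1

theorem kt_bits {f : ℕ → Bool} {b : Bits Q} (h : ket b = kt f) (p : Fin Q) : f p = b p := by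
  have := holds_kt (f := f) (p := p)
  rw [← h] at this
  exact (this b (by simp [ket])).symm

theorem signU_of_false (hQ : a + q + (q + 2) ≤ Q) {ψ : Bits Q → ℂ} {p : Fin Q}
    (hp : (p : ℕ) = a + q + (q + 1)) (h : Holds ψ p false) : (signU Q q a).1 *ᵥ ψ = ψ := by
  rw [← UOp.one_mulVec ψ, ← UOp.mul_mulVec, mul_one]
  refine mulVec_congr fun b hb => ?_
  obtain ⟨f, hf⟩ := kt_surj b
  have e : f (a + q + (q + 1)) = false := by rw [← hp, kt_bits hf, h b hb]
  rw [hf, signU_kt hQ, e, UOp.one_mulVec]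
  simp

/-- The sign of the amplitudes changes where the block is zero. -/
theorem signU_apply (hQ : a + q + (q + 2) ≤ Q) {ψ : Bits Q → ℂ} {p : Fin Q}
    (hp : (p : ℕ) = a + q + (q + 1)) (h : Holds ψ p true)
    (h' : ∀ r : Fin Q, a + q ≤ r → (r : ℕ) ≤ a + q + q → Holds ψ r false) (f : ℕ → Bool) :
    ((signU Q q a).1 *ᵥ ψ) (fun p => f p) =
      (if ∀ k < q, f (a + k) = false then (-1 : ℂ) else 1) * ψ (fun p => f p) := by
  conv_lhs => rw [eq_sum_ket ψ]
  rw [mulVec_sum_smul, Finset.sum_apply, Finset.sum_eq_single fun p : Fin Q => f p]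
  · change ψ (fun p => f p) * ((signU Q q a).1 *ᵥ kt f) (fun p => f p) = _
    by_cases h0 : ψ (fun p => f p) = 0
    · rw [h0, zero_mul, mul_zero]
    · have e1 : f (a + q + (q + 1)) = true := by
        rw [← hp]
        exact h _ h0
      have e2 : ∀ j ≤ q, f (a + q + j) = false := fun j hj =>
        h' ⟨a + q + j, by omega⟩ (by simp) (by simpa using hj) _ h0
      rw [signU_kt hQ, e1, Pi.smul_apply, kt, ket_apply, if_pos rfl, smul_eq_mul, mul_one, mul_comm]
      simp only [true_and, ladderBits_last e2 le_rfl]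
  · intro b _ hb
    obtain ⟨f', hf'⟩ := kt_surj b
    rw [Pi.smul_apply, hf', signU_kt hQ, ← hf', Pi.smul_apply, ket_apply, if_neg (Ne.symm hb)]
    simp
  · simp

end Sign

section WalkSpec

variable {m l n N Q a : ℕ} {X : Boxes l n N}
variable {x : Fin m → Bits n} {Φ : Bits n → EuclideanSpace ℝ (Bits N)}
  {v : EuclideanSpace ℝ (Fin m)} {i : Fin m}

theorem walkU_of_false {i : ℕ} (hQ : a + (l + n + (N + 3)) + (l + n + (N + 3) + 2) ≤ Q)
    {p : Fin Q} (hp : (p : ℕ) = a + (l + n + (N + 3)) + (l + n + (N + 3) + 1))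
    {ψ : Bits Q → ℂ} (h : Holds ψ p false) : (walkU Q i a X).1 *ᵥ ψ = ψ := by
  have hp' : p = ⟨a + (l + n + (N + 3)) + (l + n + (N + 3) + 1), by omega⟩ := Fin.ext hp
  rw [walkU, UOp.mul_mulVec, mirrorU_of_false hQ (hp' ▸ h), signU_of_false hQ hp h]

theorem walkU_mem_keeps {i : ℕ} {p : Fin Q} (hp : (p : ℕ) < a ∨
    a + (l + n + (N + 3)) + (l + n + (N + 3)) < p) : walkU Q i a X ∈ keeps p :=
  mul_mem (signU_mem_keeps (by omega)) (mirrorU_mem_keeps (by omega))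

/-- In a state that is zero on the block except for the controlling qubit, the walk operator acts
as a rotation in a plane, by an angle whose cosine is the negative of the overlap. -/
theorem walkU_plane (hX : Realizes X x Φ v) (hi : Φ (x i) ≠ 0)
    (hQ : a + (l + n + (N + 3)) + (l + n + (N + 3) + 2) ≤ Q) {ψ : Bits Q → ℂ} {p : Fin Q}
    (hp : (p : ℕ) = a + (l + n + (N + 3)) + (l + n + (N + 3) + 1))
    (hψ : ∀ r : Fin Q, a ≤ r → (r : ℕ) < p → Holds ψ r false) (hψ' : Holds ψ p true) :
    (walkU Q i a X).1 *ᵥ ((walkU Q i a X).1 *ᵥ ψ) =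
        (2 * (-overlap l x Φ v i : ℝ) : ℂ) • ((walkU Q i a X).1 *ᵥ ψ) - ψ ∧
      inn ψ ((walkU Q i a X).1 *ᵥ ψ) = ((-overlap l x Φ v i : ℝ) : ℂ) * inn ψ ψ := by
  have hp' : p = ⟨a + (l + n + (N + 3)) + (l + n + (N + 3) + 1), by omega⟩ := Fin.ext hp
  have hM : ∀ f : ℕ → Bool, (∀ k < l + n + (N + 3), f (a + k) = false) → f p = true →
      ((mirrorU Q i a X).1 *ᵥ ψ) (fun p => f p) =
        (overlap l x Φ v i : ℂ) * ψ (fun p => f p) := by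
    intro f hf hf'
    exact mirrorU_apply hX hi hQ (fun r h1 h2 => hψ r h1 (by omega)) (hp' ▸ hψ') hf (hp ▸ hf')
  have hMp : Holds ((mirrorU Q i a X).1 *ᵥ ψ) p true :=
    hψ'.mulVec (mirrorU_mem_keeps (by omega))
  have hMr : ∀ r : Fin Q, a + (l + n + (N + 3)) ≤ r →
      (r : ℕ) ≤ a + (l + n + (N + 3)) + (l + n + (N + 3)) →
        Holds ((mirrorU Q i a X).1 *ᵥ ψ) r false := fun r h1 h2 =>
    (hψ r (by omega) (by omega)).mulVec (mirrorU_mem_keeps (by omega))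
  have hz : ∀ f : ℕ → Bool, ψ (fun p => f p) ≠ 0 →
      (∀ k < l + n + (N + 3), f (a + k) = false) ∧ f p = true := fun f hf =>
    ⟨fun k hk => hψ ⟨a + k, by omega⟩ (by simp) (by simp only; omega) _ hf, hψ' _ hf⟩
  have bits : ∀ b : Bits Q, ∃ f : ℕ → Bool, b = fun p : Fin Q => f p := fun b =>
    ⟨fun p => if h : p < Q then b ⟨p, h⟩ else false, by simp⟩
  have hG : (walkU Q i a X).1 *ᵥ ψ =
      (mirrorU Q i a X).1 *ᵥ ψ - (2 * overlap l x Φ v i : ℂ) • ψ := by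
    rw [walkU, UOp.mul_mulVec]
    funext b
    obtain ⟨f, rfl⟩ := bits b
    rw [signU_apply hQ hp hMp hMr, Pi.sub_apply, Pi.smul_apply, smul_eq_mul]
    by_cases hf : ∀ k < l + n + (N + 3), f (a + k) = false
    · rw [if_pos hf]
      by_cases hfp : f p = true
      · rw [hM f hf hfp]
        ring
      · have h1 : ψ (fun p => f p) = 0 := by
          by_contra h
          exact hfp (hz f h).2
        have h2 : ((mirrorU Q i a X).1 *ᵥ ψ) (fun p => f p) = 0 := by
          by_contra h
          exact hfp (hMp _ h)
        rw [h1, h2]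
        ring
    · have h1 : ψ (fun p => f p) = 0 := by
        by_contra h
        exact hf (hz f h).1
      rw [if_neg hf, h1]
      ring
  have hS : (signU Q (l + n + (N + 3)) a).1 *ᵥ ψ = -ψ := by
    funext b
    obtain ⟨f, rfl⟩ := bits b
    rw [signU_apply hQ hp hψ' (fun r h1 h2 => hψ r (by omega) (by omega)), Pi.neg_apply]
    by_cases h : ψ (fun p => f p) = 0
    · rw [h]
      simp
    · rw [if_pos (hz f h).1]
      ring
  constructor
  · have h1 : (walkU Q i a X).1 *ᵥ ((mirrorU Q i a X).1 *ᵥ ψ) = -ψ := by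
      rw [walkU, UOp.mul_mulVec, ← UOp.mul_mulVec (mirrorU Q i a X), mirrorU_sq, UOp.one_mulVec, hS]
    conv_lhs => rw [hG]
    rw [Matrix.mulVec_sub, Matrix.mulVec_smul, h1]
    push_cast
    module
  · rw [hG, inn_sub_right, inn_smul_right]
    have : inn ψ ((mirrorU Q i a X).1 *ᵥ ψ) = (overlap l x Φ v i : ℂ) * inn ψ ψ := by
      simp only [inn, dotProduct, Finset.mul_sum]
      refine Finset.sum_congr rfl fun b _ => ?_
      obtain ⟨f, rfl⟩ := bits b
      by_cases h : ψ (fun p => f p) = 0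
      · simp [h]
      · rw [hM f (hz f h).1 (hz f h).2]
        ring
    rw [this]
    push_cast
    ring

end WalkSpec

section Eigen

variable {Q : ℕ}

/-- The sign that belongs to a Boolean. -/
def sgn (s : Bool) : ℝ := if s then 1 else -1

/-- The eigenvalue `exp (± i θ)`. -/
noncomputable def eigval (θ : ℝ) (s : Bool) : ℂ := Complex.exp ((sgn s * θ : ℝ) * Complex.I)

/-- The vectors `e true` and `e false` are orthogonal eigenvectors of `G` of equal norm, with
eigenvalues `exp (i θ)` and `exp (- i θ)`. -/
structure EigenPair (G : UOp Q) (θ : ℝ) (e : Bool → Bits Q → ℂ) (ω : ℝ) : Prop where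
  eig : ∀ s, G.1 *ᵥ e s = eigval θ s • e s
  orth : inn (e true) (e false) = 0
  norm : ∀ s, inn (e s) (e s) = (ω / 2 : ℝ)

/-- A vector on which `G` acts as a rotation by `arccos c` is the sum of two orthogonal eigenvectors
of equal norm. The bound of `c` makes the two eigenvalues different. -/
theorem exists_eigenPair {G : UOp Q} {c : ℝ} (hc : |c| ≤ 1 / 2) {ψ : Bits Q → ℂ}
    (h1 : G.1 *ᵥ (G.1 *ᵥ ψ) = (2 * c : ℂ) • (G.1 *ᵥ ψ) - ψ)
    (h2 : inn ψ (G.1 *ᵥ ψ) = (c : ℂ) * inn ψ ψ) :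
    ∃ e : Bool → Bits Q → ℂ, EigenPair G (Real.arccos c) e (nsq ψ) ∧ ψ = e true + e false ∧
      ∀ s, ∃ u w : ℂ, e s = u • (G.1 *ᵥ ψ) + w • ψ := by
  obtain ⟨hc1, hc2⟩ := abs_le.1 hc
  set θ := Real.arccos c with hθ
  have hcos : Real.cos θ = c := Real.cos_arccos (by linarith) (by linarith)
  have hsin : 0 < Real.sin θ := by
    rw [hθ, Real.sin_arccos]
    exact Real.sqrt_pos.2 (by nlinarith)
  have hsq : Real.sin θ ^ 2 = 1 - c ^ 2 := by
    rw [← hcos]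
    linarith [Real.sin_sq_add_cos_sq θ]
  set z : ℂ := (c : ℂ) + (Real.sin θ : ℂ) * Complex.I with hz
  set z' : ℂ := (c : ℂ) - (Real.sin θ : ℂ) * Complex.I with hz'
  have hlam : eigval θ true = z := by
    rw [eigval, sgn, if_pos rfl, one_mul, Complex.exp_mul_I, hz, ← hcos]
    simp
  have hlam' : eigval θ false = z' := by
    have : ((sgn false * θ : ℝ) : ℂ) = -(θ : ℂ) := by simp [sgn]
    rw [eigval, this, Complex.exp_mul_I, hz', ← hcos]
    simp [sub_eq_add_neg]
  have hI : Complex.I * Complex.I = -1 := Complex.I_mul_I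
  have hsqC : (Real.sin θ : ℂ) ^ 2 = 1 - (c : ℂ) ^ 2 := by exact_mod_cast hsq
  have hsum : z + z' = 2 * c := by rw [hz, hz']; ring
  have hprod : z * z' = 1 := by
    rw [hz, hz']
    linear_combination (-(Real.sin θ : ℂ) ^ 2) * hI + hsqC
  have hstar : star z = z' := by
    rw [hz, hz', RCLike.star_def, map_add, map_mul, Complex.conj_ofReal, Complex.conj_ofReal,
      Complex.conj_I]
    ring
  have hstar' : star z' = z := by rw [← hstar, star_star]
  set D : ℂ := z - z' with hD
  have hD2 : D * D = -4 * (1 - (c : ℂ) ^ 2) := by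
    rw [hD, hz, hz', ← hsqC]
    linear_combination (4 * (Real.sin θ : ℂ) ^ 2) * hI
  have hc0 : (1 - (c : ℂ) ^ 2) ≠ 0 := by
    have : (1 - c ^ 2) ≠ 0 := by nlinarith
    exact_mod_cast this
  have hD0 : D ≠ 0 := by
    intro h
    rw [h, mul_zero] at hD2
    exact hc0 (by linear_combination (1 / 4 : ℂ) * hD2)
  have hDs : star D = -D := by
    rw [hD, star_sub, hstar, hstar']
    ring
  set g := G.1 *ᵥ ψ with hg
  have h3 : inn g ψ = (c : ℂ) * inn ψ ψ := by
    rw [← inn_conj, h2, star_mul', inn_conj]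
    congr 1
    exact Complex.conj_ofReal _
  have h4 : inn g g = inn ψ ψ := inn_mulVec G ψ ψ
  have expand : ∀ u w u' w' : ℂ, inn (u • g + w • ψ) (u' • g + w' • ψ) =
      (star u * u' + star w * w' + (star u * w' + star w * u') * c) * inn ψ ψ := by
    intro u w u' w'
    rw [inn_add_left, inn_add_right, inn_add_right]
    simp only [inn_smul_left, inn_smul_right, h2, h3, h4]
    ring
  have hDi : star D⁻¹ = -D⁻¹ := by rw [star_inv₀, hDs, inv_neg]
  have hDD : D⁻¹ * D⁻¹ * (1 - (c : ℂ) ^ 2) = -1 / 4 := by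
    rw [← mul_inv, hD2]
    field_simp
  -- the eigenvectors are the multiples of `g - z' • ψ` and `g - z • ψ` whose sum is `ψ`
  refine ⟨fun s => if s then D⁻¹ • g + (-z' * D⁻¹) • ψ else (-D⁻¹) • g + (z * D⁻¹) • ψ,
    ⟨?_, ?_, ?_⟩, ?_, ?_⟩
  · intro s
    cases s
    · rw [hlam', if_neg (by simp), Matrix.mulVec_add, Matrix.mulVec_smul, Matrix.mulVec_smul, h1]
      rw [← hg, ← hsum, ← sub_eq_zero]
      have : z' * (z * D⁻¹) = D⁻¹ := by linear_combination D⁻¹ * hprod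
      rw [smul_add, smul_smul, smul_smul, this]
      module
    · rw [hlam, if_pos rfl, Matrix.mulVec_add, Matrix.mulVec_smul, Matrix.mulVec_smul, h1]
      rw [← hg, ← hsum, ← sub_eq_zero]
      have : z * (-z' * D⁻¹) = -D⁻¹ := by linear_combination (-D⁻¹) * hprod
      rw [smul_add, smul_smul, smul_smul, this]
      module
  · simp only [if_true, Bool.false_eq_true, if_false]
    rw [expand, star_mul', star_neg, hstar', hDi]
    have : (-D⁻¹ * -D⁻¹ + -z * -D⁻¹ * (z * D⁻¹) + (-D⁻¹ * (z * D⁻¹) + -z * -D⁻¹ * -D⁻¹) * (c : ℂ)) =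
        0 := by
      linear_combination (D⁻¹ * D⁻¹ * z) * hsum - (D⁻¹ * D⁻¹) * hprod
    rw [this, zero_mul]
  · intro s
    have hω : ((nsq ψ / 2 : ℝ) : ℂ) = (1 / 2) * inn ψ ψ := by
      rw [inn_self]
      push_cast
      ring
    rw [hω]
    cases s
    · simp only [Bool.false_eq_true, if_false]
      rw [expand, star_mul', star_neg, hstar, hDi]
      congr 1
      linear_combination (-2) * hDD - (D⁻¹ * D⁻¹) * hprod + (D⁻¹ * D⁻¹ * c) * hsum
    · simp only [if_true]
      rw [expand, star_mul', star_neg, hstar', hDi]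
      congr 1
      linear_combination (-2) * hDD - (D⁻¹ * D⁻¹) * hprod + (D⁻¹ * D⁻¹ * c) * hsum
  · simp only [if_true, Bool.false_eq_true, if_false]
    have : (-z' * D⁻¹ + z * D⁻¹) = 1 := by
      rw [← mul_inv_cancel₀ hD0, hD]
      ring
    have e : D⁻¹ • g + (-z' * D⁻¹) • ψ + (-D⁻¹ • g + (z * D⁻¹) • ψ) =
        (-z' * D⁻¹ + z * D⁻¹) • ψ := by module
    rw [e, this, one_smul]
  · intro s
    cases s
    · exact ⟨_, _, rfl⟩
    · exact ⟨_, _, rfl⟩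

end Eigen

/-! ### Phase estimation: a single measurement -/

section Plane

variable {Q : ℕ} {p : Fin Q}

theorem bits_surj (b : Bits Q) : ∃ f : ℕ → Bool, b = fun q : Fin Q => f q :=
  ⟨fun p => if h : p < Q then b ⟨p, h⟩ else false, by simp⟩

theorem xGate_xGate (ψ : Bits Q → ℂ) :
    (gateAt Q [] xMat p).1 *ᵥ ((gateAt Q [] xMat p).1 *ᵥ ψ) = ψ := by
  rw [← UOp.mul_mulVec, xGate_sq, UOp.one_mulVec]

theorem holds_flip {ψ : Bits Q → ℂ} {v : Bool} (h : Holds ψ p v) :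
    Holds ((gateAt Q [] xMat p).1 *ᵥ ψ) p (!v) := by
  rw [eq_sum_ket ψ, mulVec_sum_smul]
  refine holds_sum fun b _ => ?_
  by_cases hb : ψ b = 0
  · rw [hb, zero_smul]
    exact fun _ h => absurd rfl h
  · refine Holds.smul ?_ _
    obtain ⟨f, rfl⟩ := bits_surj b
    have e : f p = v := h _ hb
    change Holds ((gateAt Q [] xMat p).1 *ᵥ kt f) p (!v)
    rw [xGate_kt p.2 (by simp), if_pos (by simp)]
    have := holds_kt (f := Function.update f p (!f p)) (p := p)
    rw [Function.update_self] at this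
    rw [e] at this ⊢
    exact this

theorem hGate_of_false {ψ : Bits Q → ℂ} (h : Holds ψ p false) :
    (gateAt Q [] hMat p).1 *ᵥ ψ =
      ((1 / Real.sqrt 2 : ℝ) : ℂ) • (ψ + (gateAt Q [] xMat p).1 *ᵥ ψ) := by
  have : (gateAt Q [] hMat p).1 *ᵥ ψ =
      (((1 / Real.sqrt 2 : ℝ) : ℂ) • (1 + (gateAt Q [] xMat p).1)) *ᵥ ψ := by
    refine mulVec_congr fun b hb => ?_
    obtain ⟨f, rfl⟩ := bits_surj b
    have e : f p = false := h _ hb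
    change (gateAt Q [] hMat p).1 *ᵥ kt f = _ *ᵥ kt f
    rw [hGate_kt_of_false p.2 e, Matrix.smul_mulVec, Matrix.add_mulVec, Matrix.one_mulVec,
      xGate_kt p.2 (by simp), if_pos (by simp), e]
    rfl
  rw [this, Matrix.smul_mulVec, Matrix.add_mulVec, Matrix.one_mulVec]

theorem hGate_flip {ψ : Bits Q → ℂ} (h : Holds ψ p false) :
    (gateAt Q [] hMat p).1 *ᵥ ((gateAt Q [] xMat p).1 *ᵥ ψ) =
      ((1 / Real.sqrt 2 : ℝ) : ℂ) • (ψ - (gateAt Q [] xMat p).1 *ᵥ ψ) := by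
  have h1 : (gateAt Q [] hMat p).1 *ᵥ ((gateAt Q [] hMat p).1 *ᵥ ψ) = ψ := by
    rw [← UOp.mul_mulVec, hGate_sq, UOp.one_mulVec]
  rw [hGate_of_false h, Matrix.mulVec_smul, Matrix.mulVec_add, hGate_of_false h] at h1
  set r : ℂ := ((1 / Real.sqrt 2 : ℝ) : ℂ) with hr
  have hrr : r * r = 1 / 2 := sqrt_half_mul_self
  set y := (gateAt Q [] hMat p).1 *ᵥ ((gateAt Q [] xMat p).1 *ᵥ ψ)
  set z := (gateAt Q [] xMat p).1 *ᵥ ψ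
  ext b
  have h2 := congrFun h1 b
  simp only [Pi.smul_apply, Pi.add_apply, Pi.sub_apply, smul_eq_mul] at h2 ⊢
  linear_combination (2 * r) * h2 + (-2 * y b - 2 * r * (ψ b + z b)) * hrr

theorem phaseGate_of_false {ψ : Bits Q → ℂ} (h : Holds ψ p false) (r : ℝ) :
    (gateAt Q [] (phMat r) p).1 *ᵥ ψ = ψ := by
  have : (gateAt Q [] (phMat r) p).1 *ᵥ ψ = (1 : Matrix (Bits Q) (Bits Q) ℂ) *ᵥ ψ := by
    refine mulVec_congr fun b hb => ?_
    obtain ⟨f, rfl⟩ := bits_surj b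
    have e : f p = false := h _ hb
    change _ *ᵥ kt f = _ *ᵥ kt f
    rw [phaseGate_kt p.2 (by simp), if_neg (by simp [e]), one_smul, Matrix.one_mulVec]
  rw [this, Matrix.one_mulVec]

theorem phaseGate_of_true {ψ : Bits Q → ℂ} (h : Holds ψ p true) (r : ℝ) :
    (gateAt Q [] (phMat r) p).1 *ᵥ ψ = Complex.exp (2 * Real.pi * Complex.I * (r : ℂ)) • ψ := by
  have : (gateAt Q [] (phMat r) p).1 *ᵥ ψ =
      (Complex.exp (2 * Real.pi * Complex.I * (r : ℂ)) •
        (1 : Matrix (Bits Q) (Bits Q) ℂ)) *ᵥ ψ := by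
    refine mulVec_congr fun b hb => ?_
    obtain ⟨f, rfl⟩ := bits_surj b
    have e : f p = true := h _ hb
    change _ *ᵥ kt f = _ *ᵥ kt f
    rw [phaseGate_kt p.2 (by simp), if_pos ⟨by simp, e⟩, Matrix.smul_mulVec, Matrix.one_mulVec]
  rw [this, Matrix.smul_mulVec, Matrix.one_mulVec]

/-- The states `f true` and `f false` span the plane in which the phases `± θ` of `G` are
estimated; the qubit `p`, which controls `G`, is zero in them. -/
structure Plane (G : UOp Q) (p : Fin Q) (θ : ℝ) (f : Bool → Bits Q → ℂ) (ω : ℝ) : Prop where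
  holds : ∀ s, Holds (f s) p false
  fixed : ∀ s, G.1 *ᵥ f s = f s
  eig : ∀ s, G.1 *ᵥ ((gateAt Q [] xMat p).1 *ᵥ f s) =
    eigval θ s • ((gateAt Q [] xMat p).1 *ᵥ f s)
  orth : inn (f true) (f false) = 0
  norm : ∀ s, inn (f s) (f s) = (ω / 2 : ℝ)

/-- A general state in the plane. -/
def span (f : Bool → Bits Q → ℂ) (x : Bool → ℂ) : Bits Q → ℂ :=
  x true • f true + x false • f false

/-- The squared norm of the component of `ψ` along `f s`, which has the squared norm `ω / 2`. If `ω`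
is zero, then so is `f s`, and the value is zero. -/
noncomputable def part (f : Bool → Bits Q → ℂ) (ω : ℝ) (s : Bool) (ψ : Bits Q → ℂ) : ℝ :=
  ‖inn (f s) ψ‖ ^ 2 * (2 / ω)

variable {G : UOp Q} {θ ω : ℝ} {f : Bool → Bits Q → ℂ}

theorem Plane.inn_span (h : Plane G p θ f ω) (x : Bool → ℂ) (s : Bool) :
    inn (f s) (span f x) = x s * (ω / 2 : ℝ) := by
  have h' : inn (f false) (f true) = 0 := by rw [← inn_conj, h.orth, star_zero]
  rw [span, inn_add_right, inn_smul_right, inn_smul_right]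
  cases s
  · rw [h', h.norm]
    ring
  · rw [h.orth, h.norm]
    ring

theorem Plane.part_span (h : Plane G p θ f ω) (x : Bool → ℂ) (s : Bool) :
    part f ω s (span f x) = ‖x s‖ ^ 2 * (ω / 2) := by
  rw [part, h.inn_span, norm_mul, Complex.norm_real, Real.norm_eq_abs, mul_pow, sq_abs]
  by_cases h0 : ω = 0
  · simp [h0]
  · field_simp

theorem Plane.nsq_span (h : Plane G p θ f ω) (x : Bool → ℂ) :
    nsq (span f x) = part f ω true (span f x) + part f ω false (span f x) := by
  have h1 : (nsq (span f x) : ℂ) =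
      ((‖x true‖ ^ 2 * (ω / 2) + ‖x false‖ ^ 2 * (ω / 2) : ℝ) : ℂ) := by
    rw [← inn_self]
    nth_rw 1 [span]
    rw [inn_add_left, inn_smul_left, inn_smul_left, h.inn_span, h.inn_span]
    have e : ∀ z : ℂ, star z * z = ((‖z‖ ^ 2 : ℝ) : ℂ) := fun z => by
      rw [RCLike.star_def, Complex.conj_mul']
      push_cast
      rfl
    push_cast [← mul_assoc, e]
    ring
  rw [h.part_span, h.part_span]
  exact_mod_cast h1

theorem part_nonneg (hω : 0 ≤ ω) (s : Bool) (ψ : Bits Q → ℂ) : 0 ≤ part f ω s ψ := by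
  unfold part
  positivity

theorem project_of_holds {ψ : Bits Q → ℂ} {v : Bool} (h : Holds ψ p v) (o : Bool) :
    project p o ψ = if v = o then ψ else 0 := by
  ext b
  simp only [project]
  by_cases hb : ψ b = 0
  · split_ifs <;> simp [hb]
  · rw [h b hb]
    split_ifs <;> rfl

theorem project_add (o : Bool) (ψ φ : Bits Q → ℂ) :
    project p o (ψ + φ) = project p o ψ + project p o φ := by
  ext b
  simp only [project, Pi.add_apply]
  split_ifs <;> simp

theorem project_smul (o : Bool) (c : ℂ) (ψ : Bits Q → ℂ) :
    project p o (c • ψ) = c • project p o ψ := by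
  ext b
  simp only [project, Pi.smul_apply]
  split_ifs <;> simp

/-- The circuit of a trial: a Hadamard test of `G ^ k`, with the additional phase `r`. -/
noncomputable def testU (p : Fin Q) (G : UOp Q) (r : ℝ) (k : ℕ) : UOp Q :=
  gateAt Q [] hMat p * (G ^ k * (gateAt Q [] (phMat r) p * gateAt Q [] hMat p))

/-- The phase seen by a trial. -/
noncomputable def testPhase (θ r : ℝ) (k : ℕ) (s : Bool) : ℂ :=
  Complex.exp (2 * Real.pi * Complex.I * (r : ℂ)) * eigval θ s ^ k

theorem UOp.pow_mulVec {U : UOp Q} {ψ : Bits Q → ℂ} {c : ℂ} (h : U.1 *ᵥ ψ = c • ψ) (k : ℕ) :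
    (U ^ k).1 *ᵥ ψ = c ^ k • ψ := by
  induction k with
  | zero => rw [pow_zero, pow_zero, UOp.one_mulVec, one_smul]
  | succ k ih => rw [pow_succ', UOp.mul_mulVec, ih, Matrix.mulVec_smul, h, smul_smul, pow_succ]

theorem Plane.testU_apply (h : Plane G p θ f ω) (r : ℝ) (k : ℕ) (s : Bool) :
    (testU p G r k).1 *ᵥ f s = ((1 + testPhase θ r k s) / 2) • f s +
      ((1 - testPhase θ r k s) / 2) • ((gateAt Q [] xMat p).1 *ᵥ f s) := by
  have hf := h.holds s
  have hf1 : (G ^ k).1 *ᵥ f s = f s := by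
    simpa using UOp.pow_mulVec (c := 1) (by rw [h.fixed s, one_smul]) k
  rw [testU, UOp.mul_mulVec, UOp.mul_mulVec, UOp.mul_mulVec, hGate_of_false hf,
    Matrix.mulVec_smul, Matrix.mulVec_add, phaseGate_of_false hf,
    phaseGate_of_true (holds_flip hf), Matrix.mulVec_smul, Matrix.mulVec_add, hf1,
    Matrix.mulVec_smul (G ^ k).1, UOp.pow_mulVec (h.eig s), smul_smul, Matrix.mulVec_smul,
    Matrix.mulVec_add, Matrix.mulVec_smul, hGate_of_false hf, hGate_flip hf]
  change _ • (_ + testPhase θ r k s • _) = _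
  set c : ℂ := ((1 / Real.sqrt 2 : ℝ) : ℂ) with hc
  have hcc : c * c = 1 / 2 := sqrt_half_mul_self
  ext b
  simp only [Pi.smul_apply, Pi.add_apply, Pi.sub_apply, smul_eq_mul]
  linear_combination (f s b + ((gateAt Q [] xMat p).1 *ᵥ f s) b +
    testPhase θ r k s * (f s b - ((gateAt Q [] xMat p).1 *ᵥ f s) b)) * hcc

/-- The amplitude of the outcome `o` of a trial. -/
noncomputable def testAmp (θ r : ℝ) (k : ℕ) (o s : Bool) : ℂ :=
  if o then (1 - testPhase θ r k s) / 2 else (1 + testPhase θ r k s) / 2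

/-- After a trial and the reset of the control qubit, the state is in the plane again. -/
theorem Plane.outcome (h : Plane G p θ f ω) (r : ℝ) (k : ℕ) (x : Bool → ℂ) :
    project p false ((testU p G r k).1 *ᵥ span f x) =
        span f (fun s => x s * testAmp θ r k false s) ∧
      (gateAt Q [] xMat p).1 *ᵥ project p true ((testU p G r k).1 *ᵥ span f x) =
        span f fun s => x s * testAmp θ r k true s := by
  simp only [span, Matrix.mulVec_add, Matrix.mulVec_smul, h.testU_apply, project_add, project_smul,
    project_of_holds (h.holds _), project_of_holds (holds_flip (h.holds _)), testAmp]
  simp only [Bool.not_false, if_true, Bool.false_eq_true, if_false, Bool.true_eq_false,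
    smul_zero, add_zero, Matrix.mulVec_zero, zero_add, xGate_xGate, smul_smul]
  trivial

/-- The probability of the outcome `o` on the component `s`: when the phase gate subtracts `k` times
the angle `φ` and a quarter turn, the bias is a sine, which has the sign of a small error of `φ`. -/
theorem norm_testAmp_sq (θ φ : ℝ) (k : ℕ) (o s : Bool) :
    ‖testAmp θ (-(k * φ) - 1 / 4) k o s‖ ^ 2 =
      (1 - sgn o * Real.sin (k * (sgn s * θ - 2 * Real.pi * φ))) / 2 := by
  set τ : ℝ := k * (sgn s * θ - 2 * Real.pi * φ) - Real.pi / 2 with hτ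
  have h1 : testPhase θ (-(k * φ) - 1 / 4) k s = Complex.exp (τ * Complex.I) := by
    rw [testPhase, eigval, ← Complex.exp_nat_mul, ← Complex.exp_add]
    congr 1
    rw [hτ]
    push_cast
    ring
  have h2 : Real.sin (k * (sgn s * θ - 2 * Real.pi * φ)) = Real.cos τ := by
    rw [hτ, Real.cos_sub_pi_div_two]
  have h3 := Real.sin_sq_add_cos_sq τ
  rw [testAmp, h1, h2, Complex.exp_mul_I, ← Complex.ofReal_cos, ← Complex.ofReal_sin]
  rw [Complex.sq_norm, Complex.normSq_apply]
  cases o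
  · simp [sgn, -Complex.ofReal_cos, -Complex.ofReal_sin]
    linarith
  · simp [sgn, -Complex.ofReal_cos, -Complex.ofReal_sin]
    linarith

end Plane

/-! ### Programs with measurements -/

section Leads

variable {l n N w Q : ℕ} {B : BlackBoxes l n N w}

/-- Started in `s`, the program `P` ends in branches with the property `post`, over which the
functional `f` sums up to at least `r`. For the squared norm of the state, `r` is a lower bound of a
probability. -/
def Leads (B : BlackBoxes l n N w) (P : Program) (s : Branch Q) (post : Branch Q → Prop)
    (f : Branch Q → ℝ) (r : ℝ) : Prop :=
  ∃ L, Exec B P s L ∧ (∀ u ∈ L, post u) ∧ r ≤ (L.map f).sum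

theorem Leads.mono {P : Program} {s : Branch Q} {post post' : Branch Q → Prop}
    {f f' : Branch Q → ℝ} {r r' : ℝ} (h : Leads B P s post f r) (hr : r' ≤ r)
    (hp : ∀ u, post u → post' u ∧ f u ≤ f' u) : Leads B P s post' f' r' := by
  obtain ⟨L, hE, hL, hs⟩ := h
  exact ⟨L, hE, fun u hu => (hp u (hL u hu)).1,
    hr.trans (hs.trans (List.sum_le_sum fun u hu => (hp u (hL u hu)).2))⟩

theorem sum_flatMap_ge {L : List (Branch Q)} {g : Branch Q → List (Branch Q)}
    {f f' : Branch Q → ℝ} (h : ∀ u ∈ L, f u ≤ ((g u).map f').sum) :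
    (L.map f).sum ≤ ((L.flatMap g).map f').sum := by
  induction L with
  | nil => simp
  | cons u L ih =>
    rw [List.flatMap_cons, List.map_append, List.sum_append, List.map_cons, List.sum_cons]
    exact add_le_add (h u (by simp)) (ih fun u' hu' => h u' (by simp [hu']))

theorem Leads.seq {P P' : Program} {s : Branch Q} {mid post : Branch Q → Prop}
    {g f : Branch Q → ℝ} {r : ℝ} (h : Leads B P s mid g r)
    (h' : ∀ u, mid u → Leads B P' u post f (g u)) : Leads B (.seq P P') s post f r := by
  classical
  obtain ⟨L, hE, hL, hs⟩ := h
  choose! k hk using h'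
  refine ⟨_, Exec.seq P P' s L k hE fun u hu => (hk u (hL u hu)).1, fun u hu => ?_,
    hs.trans (sum_flatMap_ge fun u hu => (hk u (hL u hu)).2.2)⟩
  obtain ⟨u', hu', hu⟩ := List.mem_flatMap.1 hu
  exact (hk u' (hL u' hu')).2.1 u hu

/-- A loop that is passed `k` times, with an invariant and a functional for every passage. -/
theorem Leads.loop {t : BExp} {P : Program} {J : ℕ → Branch Q → Prop} {F : ℕ → Branch Q → ℝ}
    {k : ℕ} (hlt : ∀ j < k, ∀ u, J j u → t.holds u.mem) (hk : ∀ u, J k u → ¬ t.holds u.mem)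
    (h : ∀ j < k, ∀ u, J j u → Leads B P (u.spend 1) (J (j + 1)) (F (j + 1)) (F j u))
    {post : Branch Q → Prop} {f : Branch Q → ℝ}
    (hpost : ∀ u, J k u → post (u.spend 1) ∧ F k u ≤ f (u.spend 1)) {s : Branch Q}
    (hs : J 0 s) : Leads B (.loop t P) s post f (F 0 s) := by
  suffices H : ∀ i ≤ k, ∀ u, J (k - i) u → Leads B (.loop t P) u post f (F (k - i) u) by
    simpa using H k le_rfl s (by simpa using hs)
  intro i hi
  induction i with
  | zero =>
    intro u hu
    refine ⟨_, Exec.loopDone t P u (hk u hu), fun u' hu' => ?_, ?_⟩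
    · rw [List.mem_singleton.1 hu']
      exact (hpost u hu).1
    · simpa using (hpost u hu).2
  | succ i ih =>
    intro u hu
    have e : k - i = k - (i + 1) + 1 := by omega
    obtain ⟨L, hE, hL, hsum⟩ := h (k - (i + 1)) (by omega) u hu
    have ih' := ih (by omega)
    rw [e] at ih'
    choose! g hg using ih'
    refine ⟨_, Exec.loopStep t P u L g (hlt _ (by omega) u hu) hE
      fun u' hu' => (hg u' (hL u' hu')).1, fun u'' hu'' => ?_,
      hsum.trans (sum_flatMap_ge fun u' hu' => (hg u' (hL u' hu')).2.2)⟩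
    obtain ⟨u', hu', hu''⟩ := List.mem_flatMap.1 hu''
    exact (hg u' (hL u' hu')).2.1 u'' hu''

theorem Impl.leads {P : Program} {pre post : Mem → Prop} {U : UOp Q} {T : ℝ}
    (h : Impl B P pre post U T) {s : Branch Q} (hs : pre s.mem) {post' : Branch Q → Prop}
    {f : Branch Q → ℝ} {r : ℝ} (hp : ∀ u : Branch Q, post u.mem → u.state = U.1 *ᵥ s.state →
      u.time ≤ s.time + T → post' u ∧ r ≤ f u) : Leads B P s post' f r := by
  obtain ⟨M', hM', t, ht, hE⟩ := h s.mem hs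
  have := hp ⟨M', U.1 *ᵥ s.state, s.time + t⟩ hM' rfl (by simpa using ht)
  exact ⟨_, hE s.state s.time, by simpa using this.1, by simpa using this.2⟩

theorem Exec.seq_single {P P' : Program} {s u : Branch Q} {L : List (Branch Q)}
    (h : Exec B P s [u]) (h' : Exec B P' u L) : Exec B (.seq P P') s L := by
  simpa using Exec.seq P P' s [u] (fun _ => L) h (by simpa using h')

/-- After a measurement, the program goes on in two branches. -/
theorem Exec.measure_seq {q a : NExp} {P : Program} {s : Branch Q} {p : Fin Q}
    (hp : (p : ℕ) = q.eval s.mem) {u : Bool → Branch Q}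
    (h : ∀ o, Exec B P (s.outcome p (a.eval s.mem) o) [u o]) :
    Exec B (.seq (.measure q a) P) s [u false, u true] := by
  have := Exec.seq (B := B) (.measure q a) P s _
    (fun b => if b.mem.nat (a.eval s.mem) = 1 then [u true] else [u false])
    (Exec.measure q a s p hp) (by
      intro b hb
      simp only [List.mem_cons, List.not_mem_nil, or_false] at hb
      rcases hb with rfl | rfl
      · simpa [Branch.outcome, Mem.setNat] using h false
      · simpa [Branch.outcome, Mem.setNat] using h true)
  simpa [Branch.outcome, Mem.setNat] using this

end Leads

/-!
### The real work space

The work cells contain: `0` the inverse of the required precision, `1` the tolerance of a round, `2`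
the factor between overlaps and inner products, `3` the result, `4` to `6` the estimate of the phase
with its cosine and sine, `7` to `9` the step with its cosine and sine, `10` the sum of the outcomes
of a round, `11` their number, `12` the quantity that ends a round, `13` a temporary value.
-/

section Memory

variable {l n N w Q : ℕ} {B : BlackBoxes l n N w}

/-- The address of the real work cell `k`; the work cells follow the input. -/
def workAddr (k : ℕ) : NExp := .add (.lit (6 + k)) (.add (cell 4) (cell 4))

/-- The content of the real work cell `k`. -/
def work (k : ℕ) : RExp := .get (workAddr k)

/-- Write the real work cell `k`. -/
def setWork (k : ℕ) (e : RExp) : Program := .setR (workAddr k) e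

/-- A numeral. -/
def num (k : ℕ) : RExp := .ofNat (.lit k)

/-- In `M`, the input is that of `I`, the number of the current vector is `t`, the current block of
qubits starts at `a`, the power of the walk operator is `K` and the work cells contain `v`. -/
structure Sees (I : Mem) (t a K : ℕ) (v : ℕ → ℝ) (M : Mem) : Prop where
  input : ∀ k < 6, M.nat k = I.nat k
  t : M.nat 6 = t
  a : M.nat 7 = a
  K : M.nat 9 = K
  real : M.real = fun j => if j < 6 + 2 * I.nat 4 then I.real j else v (j - (6 + 2 * I.nat 4))

variable {I : Mem} {t a K : ℕ} {v : ℕ → ℝ} {M : Mem}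

theorem Sees.workAddr (h : Sees I t a K v M) (k : ℕ) :
    (workAddr k).eval M = 6 + 2 * I.nat 4 + k := by
  simp only [_root_.workAddr, cell, NExp.eval, h.input 4 (by norm_num)]
  omega

theorem Sees.work (h : Sees I t a K v M) (k : ℕ) : (work k).eval M = v k := by
  rw [_root_.work, RExp.eval, h.workAddr, h.real]
  simp

theorem Sees.cell_real (h : Sees I t a K v M) {j : ℕ} (hj : j < 6 + 2 * I.nat 4) :
    M.real j = I.real j := by
  rw [h.real]
  simp [hj]

theorem Sees.setWork (h : Sees I t a K v M) (k : ℕ) (x : ℝ) :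
    Sees I t a K (Function.update v k x) (M.setReal ((_root_.workAddr k).eval M) x) := by
  refine ⟨h.input, h.t, h.a, h.K, ?_⟩
  rw [h.workAddr, Mem.setReal]
  ext j
  simp only [h.real, Function.update_apply]
  split_ifs with h1 h2 h3 h3 h3
  · omega
  · rfl
  · omega
  · rfl
  · omega
  · rfl

theorem Sees.of_agree {M' : Mem} (h : Sees I t a K v M) {c : ℕ} (hM : Agree c M M')
    (hc : 10 ≤ c) : Sees I t a K v M' :=
  ⟨fun k hk => (hM.2 k (by omega)).trans (h.input k hk), (hM.2 _ (by omega)).trans h.t,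
    (hM.2 _ (by omega)).trans h.a, (hM.2 _ (by omega)).trans h.K, hM.1.trans h.real⟩

theorem Sees.setNat (h : Sees I t a K v M) {c : ℕ} (hc : 10 ≤ c) (x : ℕ) :
    Sees I t a K v (M.setNat c x) :=
  h.of_agree (c := 10) ⟨rfl, fun k hk => Function.update_of_ne (by omega) _ _⟩ le_rfl

theorem impl_setWork {k : ℕ} {e : RExp} {x : ℝ} (he : ∀ M, Sees I t a K v M → e.eval M = x) :
    Impl B (setWork k e) (Sees I t a K v) (Sees I t a K (Function.update v k x)) (1 : UOp Q) 1 :=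
  impl_setR _ _ fun M hM => by
    rw [he M hM]
    exact hM.setWork k x

theorem Impl.congr {P : Program} {v' v'' : ℕ → ℝ} {pre : Mem → Prop} {U U' : UOp Q} {T T' : ℝ}
    (h : Impl B P pre (Sees I t a K v') U T) (hv : v' = v'') (hU : U = U') (hT : T ≤ T') :
    Impl B P pre (Sees I t a K v'') U' T' := by
  subst hv hU
  exact h.mono (fun _ h => h) (fun _ h => h) hT

end Memory

/-! ### Trials -/

section Trial

variable {l n N w Q i : ℕ} {B : BlackBoxes l n N w} {X : Boxes l n N}
variable {I : Mem} {t a K : ℕ} {v : ℕ → ℝ}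

/-- The angle of the phase gate of a trial, in full turns: it subtracts the estimate, times the
power of the walk operator, and a quarter turn, which makes the bias of the outcome a sine. -/
def testAngle : RExp := .sub (.sub (num 0) (.mul (.ofNat (cell 9)) (work 4))) (.div (num 1) (num 4))

/-- The Hadamard test of a power of the walk operator. -/
def testP : Program :=
  .seq (.gate [] .H eH) (.seq (.gate [] (.phase testAngle) eH)
    (.seq (forLoop 11 (cell 9) walkP) (.gate [] .H eH)))

/-- Reset of the control qubit, and bookkeeping: the sum of the outcomes (`1` for the outcome
`false`, `-1` for `true`), their number, and a quantity that tells when to stop. It is multiplied by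
`37 / 36 ≤ exp (1 / 36)` in every trial, as the machine has no exponential. -/
def recordP : Program :=
  .seq (.ite (.ltN (.lit 0) (cell 10))
    (.seq (.gate [] .X eH) (setWork 10 (.sub (work 10) (num 1))))
    (setWork 10 (.add (work 10) (num 1))))
  (.seq (setWork 11 (.add (work 11) (num 1)))
    (setWork 12 (.mul (work 12) (.div (num 37) (num 36)))))

/-- A trial: one bit of information on the phase. -/
def trialP : Program := .seq testP (.seq (.measure eH (.lit 10)) recordP)

/-- The work cells after a trial with the outcome `o`. -/
noncomputable def record (v : ℕ → ℝ) (o : Bool) : ℕ → ℝ :=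
  Function.update (Function.update (Function.update v 10 (v 10 - sgn o)) 11 (v 11 + 1)) 12
    (v 12 * (37 / 36))

/-- The input of the machine in `I` describes registers of the lengths `l, n, N` and the index
`i`. -/
structure Shape (l n N i : ℕ) (I : Mem) : Prop where
  l : I.nat 0 = l
  n : I.nat 1 = n
  N : I.nat 2 = N
  i : I.nat 5 = i

theorem Sees.ctx {M : Mem} (h : Sees I t a K v M) (hI : Shape l n N i I) : Ctx l n N i t a M :=
  ⟨(h.input 0 (by norm_num)).trans hI.l, (h.input 1 (by norm_num)).trans hI.n,
    (h.input 2 (by norm_num)).trans hI.N, (h.input 5 (by norm_num)).trans hI.i, h.t, h.a⟩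

theorem impl_test (hI : Shape l n N i I) {t : Fin w} (hX : IsBoxes B t X) {p : Fin Q}
    (hp : (p : ℕ) = a + (l + n + (N + 3)) + (l + n + (N + 3) + 1)) :
    Impl B testP (Sees I t a K v) (Sees I t a K v)
      (testU p (walkU Q i a X) (-(K * v 4) - 1 / 4) K) (K * (walkTime B + 2) + 5) := by
  intro M hM
  have hS : ∀ M', Agree 11 M M' → Sees I t a K v M' := fun M' h => hM.of_agree h (by norm_num)
  have hH := does_gate (B := B) (c := 11) (M₀ := M) (ce := []) (g := .H) (q := eH) (cs := [])
    (a := p) (G := hMat) p.2 (by simp) (fun _ _ => rfl)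
    (fun M' h => by rw [((hS M' h).ctx hI).eH, hp]) (fun _ _ => rfl)
  have hP := does_gate (B := B) (c := 11) (M₀ := M) (ce := []) (g := .phase testAngle) (q := eH)
    (cs := []) (a := p) (G := phMat (-(K * v 4) - 1 / 4)) p.2 (by simp) (fun _ _ => rfl)
    (fun M' h => by rw [((hS M' h).ctx hI).eH, hp]) (fun M' h => by
      have e : testAngle.eval M' = -(K * v 4) - 1 / 4 := by
        simp [testAngle, RExp.eval, num, NExp.eval, cell, (hS M' h).work, (hS M' h).K]
      change phMat (testAngle.eval M') = _
      rw [e])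
  have hG := does_forLoop (B := B) (c := 11) (k := K) (M₀ := M) (len := cell 9) (P := walkP)
    (U := fun _ => walkU Q i a X) (T := walkTime B) (fun M' h => (hS M' h).K) (fun j _ =>
      does_walk ((hM.setNat (by norm_num) j).ctx hI) hX (by have := p.2; omega))
  have h := hH.seq (hP.seq (hG.seq hH))
  rw [prodU_const] at h
  obtain ⟨M', hM', T, hT, hE⟩ := h M ⟨rfl, fun _ _ => rfl⟩
  refine ⟨M', hS M' hM', T, by linarith, fun ψ τ => ?_⟩
  rw [testU, mul_assoc, mul_assoc] at *
  exact hE ψ τ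

theorem impl_record (hI : Shape l n N i I) {p : Fin Q}
    (hp : (p : ℕ) = a + (l + n + (N + 3)) + (l + n + (N + 3) + 1)) (o : Bool) :
    Impl B recordP (fun M => Sees I t a K v M ∧ M.nat 10 = if o then 1 else 0)
      (Sees I t a K (record v o)) (if o then gateAt Q [] xMat p else 1) 5 := by
  have h2 := impl_setWork (B := B) (Q := Q) (I := I) (t := t) (a := a) (K := K)
    (v := Function.update v 10 (v 10 - sgn o)) (k := 11) (e := .add (work 11) (num 1))
    (x := v 11 + 1) (fun M hM => by
      simp [RExp.eval, num, NExp.eval, hM.work])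
  have h3 := impl_setWork (B := B) (Q := Q) (I := I) (t := t) (a := a) (K := K)
    (v := Function.update (Function.update v 10 (v 10 - sgn o)) 11 (v 11 + 1)) (k := 12)
    (e := .mul (work 12) (.div (num 37) (num 36))) (x := v 12 * (37 / 36)) (fun M hM => by
      simp [RExp.eval, num, NExp.eval, hM.work])
  cases o with
  | false =>
    have h1 : Impl B (.ite (.ltN (.lit 0) (cell 10))
        (.seq (.gate [] .X eH) (setWork 10 (.sub (work 10) (num 1))))
        (setWork 10 (.add (work 10) (num 1))))
        (fun M => Sees I t a K v M ∧ M.nat 10 = if false then 1 else 0)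
        (Sees I t a K (Function.update v 10 (v 10 - sgn false))) (if False then 1 else 1 : UOp Q)
        (1 + 1) := by
      refine Impl.ite (fun M hM => ?_) (fun h => h.elim) fun _ => ?_
      · simp [BExp.holds, NExp.eval, cell, hM.2]
      · refine (impl_setWork fun M hM => ?_).mono (fun M hM => hM.1) (fun _ h => h) le_rfl
        simp [RExp.eval, num, NExp.eval, hM.work, sgn]
    exact (h1.seq (h2.seq h3)).congr rfl (by simp) (by norm_num)
  | true =>
    have hX : Impl B (.gate [] .X eH) (Sees I t a K v) (Sees I t a K v) (gateAt Q [] xMat p) 1 := by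
      intro M hM
      have hS : ∀ M', Agree 11 M M' → Sees I t a K v M' := fun M' h => hM.of_agree h (by norm_num)
      have hX := does_gate (B := B) (c := 11) (M₀ := M) (ce := []) (g := .X) (q := eH) (cs := [])
        (a := p) (G := xMat) p.2 (by simp) (fun _ _ => rfl)
        (fun M' h => by rw [((hS M' h).ctx hI).eH, hp]) (fun _ _ => rfl)
      obtain ⟨M', hM', T, hT, hE⟩ := hX M ⟨rfl, fun _ _ => rfl⟩
      exact ⟨M', hS M' hM', T, hT, hE⟩
    have h1 : Impl B (.ite (.ltN (.lit 0) (cell 10))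
        (.seq (.gate [] .X eH) (setWork 10 (.sub (work 10) (num 1))))
        (setWork 10 (.add (work 10) (num 1))))
        (fun M => Sees I t a K v M ∧ M.nat 10 = if true then 1 else 0)
        (Sees I t a K (Function.update v 10 (v 10 - sgn true)))
        (if True then 1 * gateAt Q [] xMat p else 1 : UOp Q) (1 + (1 + 1)) := by
      refine Impl.ite (fun M hM => ?_) (fun _ => ?_) fun h => (h trivial).elim
      · simp [BExp.holds, NExp.eval, cell, hM.2]
      · refine Impl.mono (hX.seq (impl_setWork fun M hM => ?_)) (fun M hM => hM.1) (fun _ h => h)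
          le_rfl
        simp [RExp.eval, num, NExp.eval, hM.work, sgn]
    exact (h1.seq (h2.seq h3)).congr rfl (by simp) (by norm_num)

/-- A trial in the plane has two outcomes, after each of which the state is in the plane. -/
theorem exec_trial (hI : Shape l n N i I) {t : Fin w} (hX : IsBoxes B t X) {p : Fin Q}
    (hp : (p : ℕ) = a + (l + n + (N + 3)) + (l + n + (N + 3) + 1)) {θ ω : ℝ}
    {f : Bool → Bits Q → ℂ} (hf : Plane (walkU Q i a X) p θ f ω) {s : Branch Q}
    (hs : Sees I t a K v s.mem) {x : Bool → ℂ} (hx : s.state = span f x) :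
    ∃ u : Bool → Branch Q, Exec B trialP s [u false, u true] ∧ ∀ o,
      Sees I t a K (record v o) (u o).mem ∧
      (u o).state = span f (fun σ => x σ * testAmp θ (-(K * v 4) - 1 / 4) K o σ) ∧
      (u o).time ≤ s.time + (K * (walkTime B + 2) + 11) := by
  obtain ⟨M', hM', T, hT, hE⟩ := impl_test (v := v) hI hX hp s.mem hs
  have hrec := fun o => impl_record (B := B) (v := v) hI hp o (M'.setNat 10 (if o then 1 else 0))
    ⟨hM'.setNat (by norm_num) _, by simp [Mem.setNat]⟩
  choose M'' hM'' T' hT' hE' using hrec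
  have ha : (NExp.lit 10).eval M' = 10 := rfl
  refine ⟨_, Exec.seq_single (hE s.state s.time) (Exec.measure_seq (p := p)
    (by rw [(hM'.ctx hI).eH, hp]) (u := fun o => _) fun o => hE' o _ _), fun o => ⟨hM'' o, ?_, ?_⟩⟩
  · have := hf.outcome (-(K * v 4) - 1 / 4) K x
    cases o
    · rw [← this.1, hx]
      simp
    · rw [← this.2, hx]
      simp
  · have := hT' o
    simp only
    linarith

end Trial

/-! ### Rounds of trials -/

section Deviation

/-- The exponential functional that controls the deviation of the sum `S` of `j` outcomes from
`j * μ`, in both directions. A deviation of `j / 3` outweighs the correction `exp (-j κ²)` best for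
`κ = 1 / 6`. -/
noncomputable def deviation (μ : ℝ) (j : ℕ) (S : ℝ) : ℝ :=
  (Real.exp ((S - j * μ) / 6) + Real.exp (-(S - j * μ) / 6)) * Real.exp (-(j / 36))

theorem deviation_zero (μ : ℝ) : deviation μ 0 0 = 2 := by
  norm_num [deviation]

/-- The moment generating function of an outcome `± 1` with the mean `μ`. -/
theorem exp_average_le {μ κ : ℝ} (hμ : |μ| ≤ 1) (hκ : |κ| ≤ 1) :
    (1 + μ) / 2 * Real.exp κ + (1 - μ) / 2 * Real.exp (-κ) ≤ Real.exp (κ * μ + κ ^ 2) := by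
  obtain ⟨h1, h2⟩ := abs_le.1 hμ
  have h3 := (abs_le.1 (Real.abs_exp_sub_one_sub_id_le hκ)).2
  have h4 := (abs_le.1 (Real.abs_exp_sub_one_sub_id_le (x := -κ) (by rwa [abs_neg]))).2
  have h5 := Real.add_one_le_exp (κ * μ + κ ^ 2)
  nlinarith [mul_le_mul_of_nonneg_left h3 (show (0 : ℝ) ≤ (1 + μ) / 2 by linarith),
    mul_le_mul_of_nonneg_left h4 (show (0 : ℝ) ≤ (1 - μ) / 2 by linarith)]

/-- The functional is a supermartingale. -/
theorem deviation_step {μ : ℝ} (hμ : |μ| ≤ 1) (j : ℕ) (S : ℝ) :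
    (1 + μ) / 2 * deviation μ (j + 1) (S + 1) + (1 - μ) / 2 * deviation μ (j + 1) (S - 1) ≤
      deviation μ j S := by
  have h1 := exp_average_le hμ (κ := 1 / 6) (by norm_num [abs_of_pos])
  have h2 := exp_average_le hμ (κ := -(1 / 6)) (by norm_num [abs_of_pos])
  set D := S - j * μ with hD
  have key : ∀ κ : ℝ, (1 + μ) / 2 * Real.exp κ + (1 - μ) / 2 * Real.exp (-κ) ≤
      Real.exp (κ * μ + κ ^ 2) → κ ^ 2 = 1 / 36 →
      (1 + μ) / 2 * (Real.exp (κ * (D + 1 - μ)) * Real.exp (-((j + 1) / 36))) +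
        (1 - μ) / 2 * (Real.exp (κ * (D - 1 - μ)) * Real.exp (-((j + 1) / 36))) ≤
      Real.exp (κ * D) * Real.exp (-(j / 36)) := by
    intro κ h hκ
    have e1 : Real.exp (κ * (D + 1 - μ)) * Real.exp (-((j + 1) / 36)) =
        Real.exp (κ * D - j / 36 - (κ * μ + κ ^ 2)) * Real.exp κ := by
      rw [← Real.exp_add, ← Real.exp_add, hκ]
      congr 1
      ring
    have e2 : Real.exp (κ * (D - 1 - μ)) * Real.exp (-((j + 1) / 36)) =
        Real.exp (κ * D - j / 36 - (κ * μ + κ ^ 2)) * Real.exp (-κ) := by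
      rw [← Real.exp_add, ← Real.exp_add, hκ]
      congr 1
      ring
    have e3 : Real.exp (κ * D) * Real.exp (-(j / 36)) =
        Real.exp (κ * D - j / 36 - (κ * μ + κ ^ 2)) * Real.exp (κ * μ + κ ^ 2) := by
      rw [← Real.exp_add, ← Real.exp_add]
      congr 1
      ring
    rw [e1, e2, e3]
    have := mul_le_mul_of_nonneg_left h (Real.exp_pos (κ * D - j / 36 - (κ * μ + κ ^ 2))).le
    linarith
  have k1 := key _ h1 (by norm_num)
  have k2 := key _ h2 (by norm_num)
  simp only [deviation]
  push_cast
  have e1 : (S + 1 - (j + 1) * μ) / 6 = 1 / 6 * (D + 1 - μ) := by rw [hD]; ring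
  have e2 : -(S + 1 - (j + 1) * μ) / 6 = -(1 / 6) * (D + 1 - μ) := by rw [hD]; ring
  have e3 : (S - 1 - (j + 1) * μ) / 6 = 1 / 6 * (D - 1 - μ) := by rw [hD]; ring
  have e4 : -(S - 1 - (j + 1) * μ) / 6 = -(1 / 6) * (D - 1 - μ) := by rw [hD]; ring
  have e5 : D / 6 = 1 / 6 * D := by ring
  have e6 : -D / 6 = -(1 / 6) * D := by ring
  rw [e1, e2, e3, e4, e5, e6]
  linarith

theorem deviation_nonneg (μ : ℝ) (j : ℕ) (S : ℝ) : 0 ≤ deviation μ j S := by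
  unfold deviation
  positivity

/-- If the mean deviates by at least `1 / 3`, then the functional is large: it has grown at least as
much as the quantity that ends a round. -/
theorem one_le_mul_deviation {μ S y : ℝ} {j : ℕ} (hy : 0 < y) (hj : 1 ≤ y * (37 / 36) ^ j)
    (h : (j : ℝ) / 3 ≤ |S - j * μ|) : 1 ≤ y * deviation μ j S := by
  refine hj.trans (mul_le_mul_of_nonneg_left ?_ hy.le)
  have h1 : ((37 : ℝ) / 36) ^ j ≤ Real.exp (j / 36) := by
    have : (j : ℝ) / 36 = j * (1 / 36) := by ring
    rw [this, Real.exp_nat_mul]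
    refine pow_le_pow_left₀ (by norm_num) ?_ _
    have := Real.add_one_le_exp (1 / 36 : ℝ)
    linarith
  refine h1.trans ?_
  have h2 : Real.exp (j / 36) = Real.exp (j / 18) * Real.exp (-(j / 36)) := by
    rw [← Real.exp_add]
    congr 1
    ring
  rw [h2, deviation]
  refine mul_le_mul_of_nonneg_right ?_ (Real.exp_pos _).le
  rcases le_abs.1 h with h | h
  · have : Real.exp (j / 18) ≤ Real.exp ((S - j * μ) / 6) := Real.exp_le_exp.2 (by linarith)
    linarith [Real.exp_pos (-(S - j * μ) / 6)]
  · have : Real.exp (j / 18) ≤ Real.exp (-(S - j * μ) / 6) := Real.exp_le_exp.2 (by linarith)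
    linarith [Real.exp_pos ((S - j * μ) / 6)]

/-- The conclusion `d` is right about the bias `μ` of the trials: its sign, or that it is small. -/
def Correct (d μ : ℝ) : Prop := (d = 1 ∧ 0 < μ) ∨ (d = -1 ∧ μ < 0) ∨ (d = 0 ∧ |μ| ≤ 2 / 3)

open Classical in
/-- The conclusion drawn from the sum `S` of `c` outcomes. With the threshold `c / 3`, it is right
whenever the mean of the outcomes deviates by less than `1 / 3` from the bias. -/
noncomputable def verdict (S c : ℝ) : ℝ := if c / 3 < S then 1 else if S < -(c / 3) then -1 else 0

theorem correct_verdict {S μ : ℝ} {j : ℕ} (h : |S - j * μ| < (j : ℝ) / 3) :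
    Correct (verdict S j) μ := by
  obtain ⟨h1, h2⟩ := abs_lt.1 h
  have hj : (0 : ℝ) < j := by linarith [abs_nonneg (S - j * μ)]
  unfold verdict
  split_ifs with h3 h4
  · exact Or.inl ⟨rfl, pos_of_mul_pos_right (a := (j : ℝ)) (by linarith) hj.le⟩
  · exact Or.inr (Or.inl ⟨rfl, by nlinarith⟩)
  · refine Or.inr (Or.inr ⟨rfl, abs_le.2 ⟨?_, ?_⟩⟩)
    · by_contra! h5
      nlinarith
    · by_contra! h5
      nlinarith

end Deviation

section Round

variable {l n N w Q i : ℕ} {B : BlackBoxes l n N w} {X : Boxes l n N}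
variable {I : Mem} {t a K : ℕ} {v : ℕ → ℝ}

/-- The content of the real work cell `k` in a branch. -/
def val (I : Mem) (u : Branch Q) (k : ℕ) : ℝ := u.mem.real (6 + 2 * I.nat 4 + k)

theorem Sees.val {u : Branch Q} (h : Sees I t a K v u.mem) (k : ℕ) : val I u k = v k := by
  simp [_root_.val, h.real]

/-- The work cells contain the estimate `φ` and the step `st`, with their cosines and sines. All
angles are in full turns. -/
structure Angles (φ st : ℝ) (v : ℕ → ℝ) : Prop where
  angle : v 4 = φ
  cos : v 5 = Real.cos (2 * Real.pi * φ)
  sin : v 6 = Real.sin (2 * Real.pi * φ)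
  step : v 7 = st
  step_cos : v 8 = Real.cos (2 * Real.pi * st)
  step_sin : v 9 = Real.sin (2 * Real.pi * st)

theorem Angles.congr {φ st : ℝ} {v v' : ℕ → ℝ} (h : Angles φ st v) (hv : ∀ k < 10, v' k = v k) :
    Angles φ st v' :=
  ⟨(hv _ (by norm_num)).trans h.angle, (hv _ (by norm_num)).trans h.cos,
    (hv _ (by norm_num)).trans h.sin, (hv _ (by norm_num)).trans h.step,
    (hv _ (by norm_num)).trans h.step_cos, (hv _ (by norm_num)).trans h.step_sin⟩

/-- Increase the angle by the step. -/
def turnP : Program :=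
  .seq (setWork 13 (.sub (.mul (work 5) (work 8)) (.mul (work 6) (work 9))))
    (.seq (setWork 6 (.add (.mul (work 6) (work 8)) (.mul (work 5) (work 9))))
      (.seq (setWork 5 (work 13)) (setWork 4 (.add (work 4) (work 7)))))

/-- Decrease the angle by the step. -/
def turnBackP : Program :=
  .seq (setWork 13 (.add (.mul (work 5) (work 8)) (.mul (work 6) (work 9))))
    (.seq (setWork 6 (.sub (.mul (work 6) (work 8)) (.mul (work 5) (work 9))))
      (.seq (setWork 5 (work 13)) (setWork 4 (.sub (work 4) (work 7)))))

/-- Change the angle according to the outcomes of the trials. -/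
def decideP : Program :=
  .ite (.ltR (.div (work 11) (num 3)) (work 10)) turnP
    (.ite (.ltR (work 10) (.sub (num 0) (.div (work 11) (num 3)))) turnBackP (setWork 13 (num 0)))

/-- The memories after the angle has been changed to `φ` and the step to `st`. -/
def Turned (I : Mem) (t a K : ℕ) (v : ℕ → ℝ) (φ st : ℝ) (M : Mem) : Prop :=
  ∃ v', Sees I t a K v' M ∧ (∀ k < 4, v' k = v k) ∧ Angles φ st v'

theorem impl_turn {φ st : ℝ} (h : Angles φ st v) :
    Impl B turnP (Sees I t a K v) (Turned I t a K v (φ + 1 * st) st) (1 : UOp Q) 4 := by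
  have h1 := impl_setWork (B := B) (Q := Q) (I := I) (t := t) (a := a) (K := K) (v := v) (k := 13)
    (e := .sub (.mul (work 5) (work 8)) (.mul (work 6) (work 9))) fun M hM => by
      simp only [RExp.eval, hM.work]; rfl
  have h2 := impl_setWork (B := B) (Q := Q) (I := I) (t := t) (a := a) (K := K)
    (v := Function.update v 13 (v 5 * v 8 - v 6 * v 9)) (k := 6)
    (e := .add (.mul (work 6) (work 8)) (.mul (work 5) (work 9))) fun M hM => by
      simp only [RExp.eval, hM.work]; rfl
  have h3 := impl_setWork (B := B) (Q := Q) (I := I) (t := t) (a := a) (K := K)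
    (v := Function.update (Function.update v 13 (v 5 * v 8 - v 6 * v 9)) 6
      (v 6 * v 8 + v 5 * v 9)) (k := 5) (e := work 13) (x := v 5 * v 8 - v 6 * v 9) fun M hM => by
      rw [hM.work]; simp
  have h4 := impl_setWork (B := B) (Q := Q) (I := I) (t := t) (a := a) (K := K)
    (v := Function.update (Function.update (Function.update v 13 (v 5 * v 8 - v 6 * v 9)) 6
      (v 6 * v 8 + v 5 * v 9)) 5 (v 5 * v 8 - v 6 * v 9)) (k := 4) (e := .add (work 4) (work 7))
      (x := v 4 + v 7) fun M hM => by
      simp [RExp.eval, hM.work]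
  have h5 := (h1.seq (h2.seq (h3.seq h4))).congr rfl (U' := 1) (by simp) (T' := 4) (by norm_num)
  refine h5.mono (fun _ h => h) (fun M hM => ⟨_, hM, fun k hk => ?_, ?_⟩) le_rfl
  · interval_cases k <;> simp
  · have e : 2 * Real.pi * (φ + 1 * st) = 2 * Real.pi * φ + 2 * Real.pi * st := by ring
    constructor
    · simp [h.angle, h.step]
    · rw [e, Real.cos_add]
      simp [h.cos, h.sin, h.step_cos, h.step_sin]
    · rw [e, Real.sin_add]
      simp [h.cos, h.sin, h.step_cos, h.step_sin]
    · simp [h.step]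
    · simp [h.step_cos]
    · simp [h.step_sin]

theorem impl_turnBack {φ st : ℝ} (h : Angles φ st v) :
    Impl B turnBackP (Sees I t a K v) (Turned I t a K v (φ + -1 * st) st) (1 : UOp Q) 4 := by
  have h1 := impl_setWork (B := B) (Q := Q) (I := I) (t := t) (a := a) (K := K) (v := v) (k := 13)
    (e := .add (.mul (work 5) (work 8)) (.mul (work 6) (work 9))) fun M hM => by
      simp only [RExp.eval, hM.work]; rfl
  have h2 := impl_setWork (B := B) (Q := Q) (I := I) (t := t) (a := a) (K := K)
    (v := Function.update v 13 (v 5 * v 8 + v 6 * v 9)) (k := 6)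
    (e := .sub (.mul (work 6) (work 8)) (.mul (work 5) (work 9))) fun M hM => by
      simp only [RExp.eval, hM.work]; rfl
  have h3 := impl_setWork (B := B) (Q := Q) (I := I) (t := t) (a := a) (K := K)
    (v := Function.update (Function.update v 13 (v 5 * v 8 + v 6 * v 9)) 6
      (v 6 * v 8 - v 5 * v 9)) (k := 5) (e := work 13) (x := v 5 * v 8 + v 6 * v 9) fun M hM => by
      rw [hM.work]; simp
  have h4 := impl_setWork (B := B) (Q := Q) (I := I) (t := t) (a := a) (K := K)
    (v := Function.update (Function.update (Function.update v 13 (v 5 * v 8 + v 6 * v 9)) 6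
      (v 6 * v 8 - v 5 * v 9)) 5 (v 5 * v 8 + v 6 * v 9)) (k := 4) (e := .sub (work 4) (work 7))
      (x := v 4 - v 7) fun M hM => by
      simp [RExp.eval, hM.work]
  have h5 := (h1.seq (h2.seq (h3.seq h4))).congr rfl (U' := 1) (by simp) (T' := 4) (by norm_num)
  refine h5.mono (fun _ h => h) (fun M hM => ⟨_, hM, fun k hk => ?_, ?_⟩) le_rfl
  · interval_cases k <;> simp
  · have e : 2 * Real.pi * (φ + -1 * st) = 2 * Real.pi * φ - 2 * Real.pi * st := by ring
    constructor
    · simp [h.angle, h.step, sub_eq_add_neg]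
    · rw [e, Real.cos_sub]
      simp [h.cos, h.sin, h.step_cos, h.step_sin]
    · rw [e, Real.sin_sub]
      simp [h.cos, h.sin, h.step_cos, h.step_sin]
    · simp [h.step]
    · simp [h.step_cos]
    · simp [h.step_sin]

open Classical in
theorem impl_decide {φ st : ℝ} (h : Angles φ st v) :
    Impl B decideP (Sees I t a K v) (Turned I t a K v (φ + verdict (v 10) (v 11) * st) st)
      (1 : UOp Q) 6 := by
  have hn : Impl B (setWork 13 (num 0)) (Sees I t a K v) (Turned I t a K v (φ + 0 * st) st)
      (1 : UOp Q) 1 := by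
    have := impl_setWork (B := B) (Q := Q) (I := I) (t := t) (a := a) (K := K) (v := v) (k := 13)
      (e := num 0) (x := 0) (fun M hM => by simp [num, RExp.eval, NExp.eval])
    refine this.mono (fun _ h => h) (fun M hM => ⟨_, hM, fun k hk => ?_, ?_⟩) le_rfl
    · rw [Function.update_of_ne (by omega)]
    · rw [zero_mul, add_zero]
      exact h.congr fun k hk => Function.update_of_ne (by omega) _ _
  have h2 : Impl B (.ite (.ltR (work 10) (.sub (num 0) (.div (work 11) (num 3)))) turnBackP
      (setWork 13 (num 0))) (Sees I t a K v)
      (Turned I t a K v (φ + (if v 10 < -(v 11 / 3) then -1 else 0) * st) st)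
      (if v 10 < -(v 11 / 3) then 1 else 1 : UOp Q) (1 + 4) := by
    refine Impl.ite (fun M hM => ?_) (fun hc => ?_) fun hc => ?_
    · simp [BExp.holds, RExp.eval, num, NExp.eval, hM.work]
    · rw [if_pos hc]
      exact impl_turnBack h
    · rw [if_neg hc]
      exact hn.mono (fun _ h => h) (fun _ h => h) (by norm_num)
  rw [ite_self] at h2
  have h3 : Impl B decideP (Sees I t a K v)
      (Turned I t a K v (φ + verdict (v 10) (v 11) * st) st)
      (if v 11 / 3 < v 10 then 1 else 1 : UOp Q) (1 + (1 + 4)) := by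
    refine Impl.ite (fun M hM => ?_) (fun hc => ?_) fun hc => ?_
    · simp [BExp.holds, RExp.eval, num, NExp.eval, hM.work]
    · rw [verdict, if_pos hc]
      exact (impl_turn h).mono (fun _ h => h) (fun _ h => h) (by norm_num)
    · rw [verdict, if_neg hc]
      exact h2
  rw [ite_self] at h3
  exact h3.mono (fun _ h => h) (fun _ h => h) (by norm_num)

/-- Trials, until their error probability is within the tolerance; then the angle is changed. -/
def roundP : Program :=
  .seq (.seq (setWork 10 (num 0)) (.seq (setWork 11 (num 0)) (setWork 12 (work 1))))
    (.seq (.loop (.ltR (work 12) (num 1)) trialP) decideP)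

open Classical in
/-- The total weight of the components of `ψ` with the property `g`, with the coefficients `c`. -/
noncomputable def gain (f : Bool → Bits Q → ℂ) (ω : ℝ) (g : Bool → Prop) (c : Bool → ℝ)
    (ψ : Bits Q → ℂ) : ℝ :=
  ∑ σ : Bool, if g σ then part f ω σ ψ * c σ else 0

theorem gain_mono {f : Bool → Bits Q → ℂ} {ω : ℝ} (hω : 0 ≤ ω) {g g' : Bool → Prop}
    {c c' : Bool → ℝ} {ψ : Bits Q → ℂ} (h : ∀ σ, g σ → g' σ ∧ c σ ≤ c' σ ∨ c σ ≤ 0)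
    (h' : ∀ σ, 0 ≤ c' σ) : gain f ω g c ψ ≤ gain f ω g' c' ψ := by
  classical
  refine Finset.sum_le_sum fun σ _ => ?_
  have hp := part_nonneg (f := f) hω σ ψ
  by_cases hg : g σ
  · rw [if_pos hg]
    rcases h σ hg with ⟨h1, h2⟩ | h1
    · rw [if_pos h1]
      exact mul_le_mul_of_nonneg_left h2 hp
    · refine (mul_nonpos_of_nonneg_of_nonpos hp h1).trans ?_
      split_ifs
      · exact mul_nonneg hp (h' σ)
      · exact le_rfl
  · rw [if_neg hg]
    split_ifs
    · exact mul_nonneg hp (h' σ)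
    · exact le_rfl

/-- The bias of the trials on the component `σ`. -/
noncomputable def bias (θ φ : ℝ) (K : ℕ) (σ : Bool) : ℝ :=
  Real.sin (K * (sgn σ * θ - 2 * Real.pi * φ))

variable {t : Fin w} {p : Fin Q} {θ ω : ℝ} {f : Bool → Bits Q → ℂ}

/-- During a trial, the weight of the components with the property `g`, minus the functional of the
deviation on each of them, does not decrease on average. -/
theorem leads_trial (hI : Shape l n N i I) (hX : IsBoxes B t X)
    (hp : (p : ℕ) = a + (l + n + (N + 3)) + (l + n + (N + 3) + 1))
    (hf : Plane (walkU Q i a X) p θ f ω) {s : Branch Q}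
    (hs : Sees I t a K v s.mem) {x : Bool → ℂ} (hx : s.state = span f x) (g : Bool → Prop)
    (A y : ℝ) (hy : 0 ≤ y) (hω : 0 ≤ ω) (j : ℕ) :
    Leads B trialP s (fun u => ∃ o x', Sees I t a K (record v o) u.mem ∧ u.state = span f x' ∧
        u.time ≤ s.time + (K * (walkTime B + 2) + 11))
      (fun u => gain f ω g (fun σ => A - y * deviation (bias θ (v 4) K σ) (j + 1) (val I u 10))
        u.state)
      (gain f ω g (fun σ => A - y * deviation (bias θ (v 4) K σ) j (v 10)) s.state) := by
  classical
  obtain ⟨u, hE, hu⟩ := exec_trial hI hX hp hf hs hx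
  refine ⟨_, hE, fun b hb => ?_, ?_⟩
  · simp only [List.mem_cons, List.not_mem_nil, or_false] at hb
    rcases hb with rfl | rfl
    · exact ⟨_, _, hu _⟩
    · exact ⟨_, _, hu _⟩
  · simp only [List.map_cons, List.map_nil, List.sum_cons, List.sum_nil, add_zero]
    rw [gain, gain, gain, ← Finset.sum_add_distrib]
    refine Finset.sum_le_sum fun σ _ => ?_
    by_cases hg : g σ
    · simp only [if_pos hg]
      have hS : ∀ o, val I (u o) 10 = v 10 - sgn o := fun o => by
        rw [(hu o).1.val]
        simp [record]
      have hpart : ∀ o, part f ω σ (u o).state =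
          part f ω σ s.state * ((1 - sgn o * bias θ (v 4) K σ) / 2) := fun o => by
        rw [(hu o).2.1, hx, hf.part_span, hf.part_span, norm_mul, mul_pow, norm_testAmp_sq, bias]
        ring
      rw [hpart, hpart, hS, hS]
      have hμ : |bias θ (v 4) K σ| ≤ 1 := Real.abs_sin_le_one _
      have h1 := deviation_step hμ j (v 10)
      have h2 := mul_le_mul_of_nonneg_left h1
        (mul_nonneg (part_nonneg (f := f) hω σ s.state) hy)
      simp only [sgn, if_true, Bool.false_eq_true, if_false, sub_neg_eq_add]
      linarith
    · simp only [if_neg hg, add_zero, le_refl]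

/-- One round of trials: for the components with the property `g`, the bias of the trials is found
correctly up to a fraction `2 * v 1` of the weight. Here `g` says what is known of the phase before
the round, and `g'` what is known after it. -/
theorem leads_round (hI : Shape l n N i I) (hX : IsBoxes B t X)
    (hp : (p : ℕ) = a + (l + n + (N + 3)) + (l + n + (N + 3) + 1))
    (hf : Plane (walkU Q i a X) p θ f ω) {s : Branch Q}
    (hs : Sees I t a K v s.mem) {x : Bool → ℂ} (hx : s.state = span f x) (hω : 0 ≤ ω)
    {φ st : ℝ} (hv : Angles φ st v) (hy : 0 < v 1) {k : ℕ}
    (hk : ∀ j < k, v 1 * (37 / 36) ^ j < 1) (hk' : 1 ≤ v 1 * (37 / 36) ^ k) {g : Bool → Prop}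
    {g' : Bool → ℝ → Prop}
    (hg : ∀ σ, g σ → ∀ d, Correct d (bias θ φ K σ) → g' σ (φ + d * st)) {A : ℝ} (hA : 0 ≤ A)
    (hA' : A ≤ 1) :
    Leads B roundP s (fun u => ∃ v' φ' x', Sees I t a K v' u.mem ∧ (∀ k < 4, v' k = v k) ∧
        Angles φ' st v' ∧ u.state = span f x' ∧
        u.time ≤ s.time + (k * (K * (walkTime B + 2) + 12) + 10))
      (fun u => gain f ω (fun σ => g' σ (val I u 4)) (fun _ => A) u.state)
      (gain f ω g (fun _ => A - 2 * v 1) s.state) := by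
  set v₀ : ℕ → ℝ := Function.update (Function.update (Function.update v 10 0) 11 0) 12 (v 1)
    with hv₀
  have hv₀' : ∀ k < 10, v₀ k = v k := fun k hk => by
    rw [hv₀, Function.update_of_ne (by omega), Function.update_of_ne (by omega),
      Function.update_of_ne (by omega)]
  have e4 : v₀ 4 = φ := by rw [hv₀' 4 (by norm_num), hv.angle]
  have e10 : v₀ 10 = 0 := by simp [hv₀]
  have e11 : v₀ 11 = 0 := by simp [hv₀]
  have e12 : v₀ 12 = v 1 := by simp [hv₀]
  have h1 := impl_setWork (B := B) (Q := Q) (I := I) (t := t) (a := a) (K := K) (v := v) (k := 10)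
    (e := num 0) (x := 0) fun M hM => by simp [num, RExp.eval, NExp.eval]
  have h2 := impl_setWork (B := B) (Q := Q) (I := I) (t := t) (a := a) (K := K)
    (v := Function.update v 10 0) (k := 11) (e := num 0) (x := 0) fun M hM => by
      simp [num, RExp.eval, NExp.eval]
  have h3 := impl_setWork (B := B) (Q := Q) (I := I) (t := t) (a := a) (K := K)
    (v := Function.update (Function.update v 10 0) 11 0) (k := 12) (e := work 1) (x := v 1)
    fun M hM => by rw [hM.work]; simp
  let J : ℕ → Branch Q → Prop := fun j u => ∃ v' x', Sees I t a K v' u.mem ∧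
    (∀ k < 10, v' k = v₀ k) ∧ v' 11 = j ∧ v' 12 = v 1 * (37 / 36) ^ j ∧ u.state = span f x' ∧
    u.time ≤ s.time + 3 + j * (K * (walkTime B + 2) + 12)
  let F : ℕ → Branch Q → ℝ := fun j u =>
    gain f ω g (fun σ => A - v 1 * deviation (bias θ φ K σ) j (val I u 10)) u.state
  have hloop : ∀ u : Branch Q, J 0 u → Leads B (.loop (.ltR (work 12) (num 1)) trialP) u
      (fun u => ∃ v' x', Sees I t a K v' u.mem ∧ (∀ k < 10, v' k = v₀ k) ∧ v' 11 = k ∧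
        u.state = span f x' ∧ u.time ≤ s.time + 3 + k * (K * (walkTime B + 2) + 12) + 1)
      (F k) (F 0 u) := by
    intro u hu
    refine Leads.loop (J := J) (F := F) (k := k) ?_ ?_ ?_ ?_ hu
    · rintro j hj u ⟨v', x', hM, -, -, h12, -⟩
      simpa [BExp.holds, RExp.eval, num, NExp.eval, hM.work, h12] using hk j hj
    · rintro u ⟨v', x', hM, -, -, h12, -⟩
      simpa [BExp.holds, RExp.eval, num, NExp.eval, hM.work, h12] using hk'
    · rintro j hj u ⟨v', x', hM, hv', h11, h12, hx', hT⟩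
      have h4 : v' 4 = φ := (hv' 4 (by norm_num)).trans e4
      have := leads_trial hI hX hp hf (s := u.spend 1) hM hx' g A (v 1) hy.le hω j
      rw [h4] at this
      refine this.mono ?_ ?_
      · simp only [F]
        rw [hM.val]
        exact le_rfl
      · rintro b ⟨o, x'', hM', hx'', hT'⟩
        refine ⟨⟨_, x'', hM', fun k hk => ?_, ?_, ?_, hx'', ?_⟩, le_rfl⟩
        · rw [← hv' k hk, record, Function.update_of_ne (by omega),
            Function.update_of_ne (by omega), Function.update_of_ne (by omega)]
        · simp [record, h11]
        · simp [record, h12, pow_succ]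
          ring
        · have : (u.spend 1).time = u.time + 1 := rfl
          push_cast
          linarith
    · rintro u ⟨v', x', hM, hv', h11, h12, hx', hT⟩
      exact ⟨⟨v', x', hM, hv', h11, hx', by simpa [Branch.spend] using hT⟩, le_rfl⟩
  have hdec : ∀ u : Branch Q, (∃ v' x', Sees I t a K v' u.mem ∧ (∀ k < 10, v' k = v₀ k) ∧
      v' 11 = k ∧ u.state = span f x' ∧
      u.time ≤ s.time + 3 + k * (K * (walkTime B + 2) + 12) + 1) →
      Leads B decideP u (fun u => ∃ v' φ' x', Sees I t a K v' u.mem ∧ (∀ k < 4, v' k = v k) ∧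
        Angles φ' st v' ∧ u.state = span f x' ∧
        u.time ≤ s.time + (k * (K * (walkTime B + 2) + 12) + 10))
      (fun u => gain f ω (fun σ => g' σ (val I u 4)) (fun _ => A) u.state) (F k u) := by
    rintro u ⟨v', x', hM, hv', h11, hx', hT⟩
    have ha : Angles φ st v' := hv.congr fun k hk => (hv' k hk).trans (hv₀' k hk)
    refine (impl_decide ha).leads hM ?_
    rintro b ⟨v'', hM', hv'', ha'⟩ hb hbT
    rw [UOp.one_mulVec] at hb
    refine ⟨⟨v'', _, x', hM', fun k hk => ?_, ha', hb.trans hx', by linarith⟩, ?_⟩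
    · rw [hv'' k hk, hv' k (by omega), hv₀' k (by omega)]
    · simp only [F]
      rw [hb, hM.val, hM'.val, ha'.angle, h11]
      refine gain_mono hω (fun σ hσ => ?_) fun _ => hA
      have h0 := mul_nonneg hy.le (deviation_nonneg (bias θ φ K σ) k (v' 10))
      by_cases hc : |v' 10 - k * bias θ φ K σ| < (k : ℝ) / 3
      · exact Or.inl ⟨hg σ hσ _ (correct_verdict hc), by linarith⟩
      · -- the sum of the outcomes misleads, but then the functional is not positive
        have := one_le_mul_deviation hy hk' (not_lt.1 hc)
        exact Or.inr (by linarith)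
  have hpre := (h1.seq (h2.seq h3)).leads (s := s) hs (post' := J 0) (f := F 0)
    (r := gain f ω g (fun _ => A - 2 * v 1) s.state) (by
      intro b hM hb hbT
      rw [mul_one, mul_one, UOp.one_mulVec] at hb
      refine ⟨⟨v₀, x, hM, fun _ _ => rfl, by simp [e11], by simp [e12], hb.trans hx, by
        push_cast; linarith⟩, ?_⟩
      simp only [F]
      rw [hb, hM.val]
      change _ ≤ gain f ω g (fun σ => A - v 1 * deviation (bias θ φ K σ) 0 (v₀ 10)) s.state
      simp only [e10, deviation_zero]
      rw [mul_comm])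
  exact hpre.seq fun u hu => (hloop u hu).seq hdec

end Round

/-! ### Estimation of one inner product -/

section Angle

theorem abs_le_of_abs_sin_le {x : ℝ} (hx : |x| ≤ Real.pi / 2) (h : |Real.sin x| ≤ 2 / 3) :
    |x| ≤ Real.pi / 4 := by
  by_contra! h1
  have h2 : Real.sin (Real.pi / 4) < Real.sin |x| :=
    Real.sin_lt_sin_of_lt_of_le_pi_div_two (by linarith [Real.pi_pos]) hx h1
  have h3 : Real.sin |x| = |Real.sin x| := by
    rcases abs_cases x with ⟨e, h⟩ | ⟨e, h⟩
    · rw [e] at hx ⊢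
      rw [abs_of_nonneg (Real.sin_nonneg_of_nonneg_of_le_pi h (by linarith [Real.pi_pos]))]
    · rw [e] at hx ⊢
      rw [Real.sin_neg, abs_of_nonpos]
      exact Real.sin_nonpos_of_nonpos_of_neg_pi_le (by linarith) (by linarith [Real.pi_pos])
  rw [Real.sin_pi_div_four, h3] at h2
  have h4 : (4 / 3 : ℝ) < Real.sqrt 2 := Real.lt_sqrt_of_sq_lt (by norm_num)
  linarith

/-- A correct conclusion on the sign of the sine halves the interval that is known to contain the
angle. -/
theorem abs_sub_le_of_correct {Δ d κ : ℝ} (hκ : 0 < κ) (h : |Δ| ≤ Real.pi / (2 * κ))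
    (hd : Correct d (Real.sin (κ * Δ))) : |Δ - d * (Real.pi / (4 * κ))| ≤ Real.pi / (4 * κ) := by
  have hπ := Real.pi_pos
  have h1 : |κ * Δ| ≤ Real.pi / 2 := by
    rw [abs_mul, abs_of_pos hκ]
    calc κ * |Δ| ≤ κ * (Real.pi / (2 * κ)) := mul_le_mul_of_nonneg_left h hκ.le
      _ = Real.pi / 2 := by field_simp
  obtain ⟨h2, h3⟩ := abs_le.1 h1
  obtain ⟨h4, h5⟩ := abs_le.1 h
  have e : Real.pi / (2 * κ) = 2 * (Real.pi / (4 * κ)) := by field_simp; norm_num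
  rw [e] at h4 h5
  rcases hd with ⟨rfl, h6⟩ | ⟨rfl, h6⟩ | ⟨rfl, h6⟩
  · have : 0 < Δ := by
      by_contra! h7
      have : Real.sin (κ * Δ) ≤ 0 := Real.sin_nonpos_of_nonpos_of_neg_pi_le
        (mul_nonpos_of_nonneg_of_nonpos hκ.le h7) (by linarith)
      linarith
    rw [abs_le]
    constructor <;> linarith
  · have : Δ < 0 := by
      by_contra! h7
      have : 0 ≤ Real.sin (κ * Δ) := Real.sin_nonneg_of_nonneg_of_le_pi
        (mul_nonneg hκ.le h7) (by linarith)
      linarith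
    rw [abs_le]
    constructor <;> linarith
  · have h7 := abs_le_of_abs_sin_le h1 h6
    rw [abs_mul, abs_of_pos hκ] at h7
    rw [zero_mul, sub_zero]
    calc |Δ| = (κ * |Δ|) / κ := by field_simp
      _ ≤ (Real.pi / 4) / κ := div_le_div_of_nonneg_right h7 hκ.le
      _ = Real.pi / (4 * κ) := by field_simp

/-- As the angle is `± θ` with a large sine, the first conclusion is its sign, and a quarter turn in
this direction is within a quarter turn of the angle. -/
theorem abs_sub_le_of_correct_one {θ d : ℝ} (h1 : Real.pi / 3 ≤ θ) (h2 : θ ≤ 2 * Real.pi / 3)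
    (σ : Bool) (hd : Correct d (Real.sin (sgn σ * θ))) :
    |sgn σ * θ - d * (Real.pi / 2)| ≤ Real.pi / 2 := by
  have hπ := Real.pi_pos
  have h3 : 2 / 3 < Real.sin θ := by
    have h4 : Real.sqrt 3 / 2 ≤ Real.sin θ := by
      rw [← Real.sin_pi_div_three]
      rcases le_total θ (Real.pi / 2) with h | h
      · exact Real.sin_le_sin_of_le_of_le_pi_div_two (by linarith) h h1
      · rw [← Real.sin_pi_sub θ]
        exact Real.sin_le_sin_of_le_of_le_pi_div_two (by linarith) (by linarith) (by linarith)
    have : (4 / 3 : ℝ) < Real.sqrt 3 := Real.lt_sqrt_of_sq_lt (by norm_num)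
    linarith
  have h5 : |Real.sin (sgn σ * θ)| = Real.sin θ := by
    cases σ
    · simp [sgn, abs_of_pos (show 0 < Real.sin θ by linarith)]
    · simp [sgn, abs_of_pos (show 0 < Real.sin θ by linarith)]
  cases σ
  · simp only [sgn, Bool.false_eq_true, if_false, neg_mul, one_mul, Real.sin_neg] at hd ⊢
    rcases hd with ⟨rfl, h6⟩ | ⟨rfl, h6⟩ | ⟨rfl, h6⟩
    · linarith
    · rw [abs_le]
      constructor <;> linarith
    · rw [abs_neg, abs_of_pos (by linarith)] at h6
      linarith
  · simp only [sgn, if_true, one_mul] at hd ⊢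
    rcases hd with ⟨rfl, h6⟩ | ⟨rfl, h6⟩ | ⟨rfl, h6⟩
    · rw [abs_le]
      constructor <;> linarith
    · linarith
    · rw [abs_of_pos (by linarith)] at h6
      linarith

theorem abs_cos_sub_cos_le (x y : ℝ) : |Real.cos x - Real.cos y| ≤ |x - y| := by
  have h := Real.lipschitzWith_cos.dist_le_mul x y
  simpa [Real.dist_eq] using h

end Angle

section Estimate

variable {l n N w Q i : ℕ} {B : BlackBoxes l n N w} {X : Boxes l n N}
variable {I : Mem} {t a K : ℕ} {v : ℕ → ℝ}

/-- Halve the step; the cosine and the sine are updated by the half-angle formulas. For steps of at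
most a quarter turn the new cosine is positive. -/
def halveP : Program :=
  .seq (setWork 7 (.div (work 7) (num 2)))
    (.seq (setWork 8 (.sqrt (.div (.add (num 1) (work 8)) (num 2))))
      (setWork 9 (.div (work 9) (.mul (num 2) (work 8)))))

theorem impl_halve {φ st : ℝ} (h : Angles φ st v) (h0 : 0 < st) (h1 : st ≤ 1 / 4) :
    Impl B halveP (Sees I t a K v) (Turned I t a K v φ (st / 2)) (1 : UOp Q) 3 := by
  have hπ := Real.pi_pos
  have hc : Real.sqrt ((1 + v 8) / 2) = Real.cos (2 * Real.pi * (st / 2)) := by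
    have e : 2 * Real.pi * (st / 2) = 2 * Real.pi * st / 2 := by ring
    rw [e, h.step_cos, Real.cos_half]
    · nlinarith
    · nlinarith
  have hpos : 0 < Real.cos (2 * Real.pi * (st / 2)) :=
    Real.cos_pos_of_mem_Ioo ⟨by nlinarith, by nlinarith⟩
  have hs : v 9 / (2 * Real.cos (2 * Real.pi * (st / 2))) = Real.sin (2 * Real.pi * (st / 2)) := by
    have e : 2 * Real.pi * st = 2 * (2 * Real.pi * (st / 2)) := by ring
    rw [h.step_sin, e, Real.sin_two_mul, div_eq_iff (by positivity)]
    ring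
  have h1 := impl_setWork (B := B) (Q := Q) (I := I) (t := t) (a := a) (K := K) (v := v) (k := 7)
    (e := .div (work 7) (num 2)) (x := st / 2) fun M hM => by
      simp [RExp.eval, num, NExp.eval, hM.work, h.step]
  have h2 := impl_setWork (B := B) (Q := Q) (I := I) (t := t) (a := a) (K := K)
    (v := Function.update v 7 (st / 2)) (k := 8)
    (e := .sqrt (.div (.add (num 1) (work 8)) (num 2))) (x := Real.cos (2 * Real.pi * (st / 2)))
    fun M hM => by
      rw [← hc]
      simp [RExp.eval, num, NExp.eval, hM.work]
  have h3 := impl_setWork (B := B) (Q := Q) (I := I) (t := t) (a := a) (K := K)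
    (v := Function.update (Function.update v 7 (st / 2)) 8 (Real.cos (2 * Real.pi * (st / 2))))
    (k := 9) (e := .div (work 9) (.mul (num 2) (work 8)))
    (x := Real.sin (2 * Real.pi * (st / 2))) fun M hM => by
      rw [← hs]
      simp [RExp.eval, num, NExp.eval, hM.work]
  have h4 := (h1.seq (h2.seq h3)).congr rfl (U' := 1) (by simp) (T' := 3) (by norm_num)
  refine h4.mono (fun _ h => h) (fun M hM => ⟨_, hM, fun k hk => ?_, ?_⟩) le_rfl
  · interval_cases k <;> simp
  · constructor
    · simp [h.angle]
    · simp [h.cos]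
    · simp [h.sin]
    · simp
    · simp
    · simp

theorem impl_setK {e : NExp} {K' : ℕ} (he : ∀ M, Sees I t a K v M → e.eval M = K') :
    Impl B (.setN (.lit 9) e) (Sees I t a K v) (Sees I t a K' v) (1 : UOp Q) 1 :=
  impl_setN _ _ fun M hM => by
    rw [he M hM]
    refine ⟨fun k hk => ?_, ?_, ?_, ?_, hM.real⟩
    · simp only [Mem.setNat, NExp.eval]
      rw [Function.update_of_ne (by omega), hM.input k hk]
    · simp [Mem.setNat, NExp.eval, hM.t]
    · simp [Mem.setNat, NExp.eval, hM.a]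
    · simp [Mem.setNat, NExp.eval]

/-- The estimate `0`, the step of a quarter turn and the first power of the walk operator. -/
def initP : Program :=
  .seq (setWork 4 (num 0)) (.seq (setWork 5 (num 1)) (.seq (setWork 6 (num 0))
    (.seq (setWork 7 (.div (num 1) (num 4))) (.seq (setWork 8 (num 0)) (.seq (setWork 9 (num 1))
      (.setN (.lit 9) (.lit 1)))))))

theorem impl_init : Impl B initP (Sees I t a K v) (Turned I t a 1 v 0 (1 / 4)) (1 : UOp Q) 7 := by
  have h : ∀ (v : ℕ → ℝ) k j, Impl B (setWork k (num j)) (Sees I t a K v)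
      (Sees I t a K (Function.update v k j)) (1 : UOp Q) 1 := fun v k j =>
    impl_setWork fun M hM => rfl
  have h' : ∀ v : ℕ → ℝ, Impl B (setWork 7 (.div (num 1) (num 4))) (Sees I t a K v)
      (Sees I t a K (Function.update v 7 (1 / 4))) (1 : UOp Q) 1 := fun v =>
    impl_setWork fun M hM => by simp [RExp.eval, num, NExp.eval]
  have h4 := ((h v 4 0).seq ((h _ 5 1).seq ((h _ 6 0).seq ((h' _).seq ((h _ 8 0).seq
    ((h _ 9 1).seq (impl_setK (e := .lit 1) (K' := 1) fun M _ => rfl))))))).congr rfl (U' := 1)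
    (by simp) (T' := 7) (by norm_num)
  refine h4.mono (fun _ h => h) (fun M hM => ⟨_, hM, fun k hk => ?_, ?_⟩) le_rfl
  · interval_cases k <;> simp
  · constructor <;> simp [show 2 * Real.pi * 4⁻¹ = Real.pi / 2 by ring]

/-- Estimation of the phase of the walk operator, by rounds of trials with doubling powers. The
power is not doubled after the first round, which only finds the sign of the phase. -/
def estimateP : Program :=
  .seq initP (.seq (.seq roundP halveP) (.loop (.ltR (.ofNat (cell 9)) (work 0))
    (.seq roundP (.seq halveP (.setN (.lit 9) (.add (cell 9) (cell 9)))))))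

variable {t : Fin w} {p : Fin Q} {θ ω : ℝ} {f : Bool → Bits Q → ℂ}

open Classical in
/-- The phase of the walk operator is found up to an error of `π / (2 * 2 ^ J)`; the error
probability is at most `2 * v 1` in each of the `J + 1` rounds. The two components of the state have
opposite phases, and the same cosine. -/
theorem leads_estimate (hI : Shape l n N i I) (hX : IsBoxes B t X)
    (hp : (p : ℕ) = a + (l + n + (N + 3)) + (l + n + (N + 3) + 1))
    (hf : Plane (walkU Q i a X) p θ f ω) (hθ : Real.pi / 3 ≤ θ) (hθ' : θ ≤ 2 * Real.pi / 3)
    {s : Branch Q} (hs : Sees I t a K v s.mem) {x : Bool → ℂ} (hx : s.state = span f x)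
    (hω : 0 ≤ ω) (hy : 0 < v 1) {k : ℕ} (hk0 : 1 ≤ k)
    (hk : ∀ j < k, v 1 * (37 / 36) ^ j < 1) (hk' : 1 ≤ v 1 * (37 / 36) ^ k) {J : ℕ}
    (hJ : ∀ j < J, 2 ^ j < v 0) (hJ' : v 0 ≤ 2 ^ J) {A : ℝ} (hA : 0 ≤ A - 2 * v 1 * (J + 1))
    (hA' : A ≤ 1) (hB : 80 ≤ walkTime B) :
    Leads B estimateP s (fun u => ∃ v' x', Sees I t a (2 ^ J) v' u.mem ∧ (∀ k < 4, v' k = v k) ∧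
        u.state = span f x' ∧ u.time ≤ s.time + (2 * k * (walkTime B + 2) * 2 ^ J + 1))
      (fun u => if |Real.cos θ - val I u 5| ≤ Real.pi / (2 * 2 ^ J) then A * nsq u.state else 0)
      ((A - 2 * v 1 * (J + 1)) * nsq s.state) := by
  have hπ := Real.pi_pos
  have hk1 : (1 : ℝ) ≤ k := by exact_mod_cast hk0
  set D := walkTime B + 2 with hD
  have hyJ : ∀ j ≤ J, 0 ≤ A - 2 * v 1 * (J - j) ∧ A - 2 * v 1 * (J - j) ≤ 1 := by
    intro j hj
    have : (j : ℝ) ≤ J := by exact_mod_cast hj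
    constructor
    · nlinarith
    · nlinarith
  let I' : ℕ → Branch Q → Prop := fun j u => ∃ v' φ' x', Sees I t a (2 ^ j) v' u.mem ∧
    (∀ k < 4, v' k = v k) ∧ Angles φ' (1 / 8 / 2 ^ j) v' ∧ u.state = span f x' ∧
    u.time ≤ s.time + 2 * k * D * 2 ^ j
  -- the weight of the components whose phase is in the current interval, diminished by the error
  -- probability of the rounds to come
  let F : ℕ → Branch Q → ℝ := fun j u => gain f ω
    (fun σ => |sgn σ * θ - 2 * Real.pi * val I u 4| ≤ Real.pi / (2 * 2 ^ j))
    (fun _ => A - 2 * v 1 * (J - j)) u.state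
  have hgain : ∀ (c : ℝ) (x' : Bool → ℂ),
      gain f ω (fun _ => True) (fun _ => c) (span f x') = c * nsq (span f x') := by
    intro c x'
    rw [gain, Fintype.sum_bool, if_pos trivial, if_pos trivial, hf.nsq_span]
    ring
  refine Leads.seq (mid := fun u => ∃ v', Sees I t a 1 v' u.mem ∧ (∀ k < 4, v' k = v k) ∧
      Angles 0 (1 / 4) v' ∧ u.state = span f x ∧ u.time ≤ s.time + 7)
    (g := fun u => (A - 2 * v 1 * (J + 1)) * nsq u.state) (impl_init.leads hs ?_) ?_
  · rintro u ⟨v', hM, hv', ha⟩ hu hT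
    rw [UOp.one_mulVec] at hu
    exact ⟨⟨v', hM, hv', ha, hu.trans hx, hT⟩, by rw [hu]⟩
  rintro u ⟨v', hM, hv', ha, hu, hT⟩
  have hv1 : v' 1 = v 1 := hv' 1 (by norm_num)
  refine Leads.seq (mid := I' 0) (g := F 0) ?_ ?_
  · refine Leads.seq (leads_round hI hX hp hf hM hu hω ha (by rwa [hv1]) (k := k)
      (by rwa [hv1]) (by rwa [hv1]) (g := fun _ => True) (A := A - 2 * v 1 * J)
      (g' := fun σ φ => |sgn σ * θ - 2 * Real.pi * φ| ≤ Real.pi / (2 * 2 ^ 0)) ?_ ?_ ?_ |>.mono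
        ?_ fun u' hu' => ⟨hu', le_rfl⟩) ?_
    · intro σ _ d hd
      rw [bias] at hd
      have h1 : sgn σ * θ - 2 * Real.pi * (0 + d * (1 / 4)) = sgn σ * θ - d * (Real.pi / 2) := by
        ring
      have h2 : Real.pi / (2 * 2 ^ 0) = Real.pi / 2 := by norm_num
      rw [h1, h2]
      exact abs_sub_le_of_correct_one hθ hθ' σ (by simpa using hd)
    · simpa using (hyJ 0 (Nat.zero_le J)).1
    · simpa using (hyJ 0 (Nat.zero_le J)).2
    · rw [hu, hgain, hv1]
      refine le_of_eq ?_
      ring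
    · rintro b ⟨v'', φ', x', hM', hv'', ha', hb, hbT⟩
      refine (impl_halve ha' (by norm_num) (by norm_num)).leads hM' ?_
      rintro c ⟨v₃, hM₃, hv₃, ha₃⟩ hc hcT
      rw [UOp.one_mulVec] at hc
      refine ⟨⟨v₃, φ', x', by simpa using hM₃, fun k hk => ?_, ?_, hc.trans hb, ?_⟩, ?_⟩
      · rw [hv₃ k hk, hv'' k hk, hv' k hk]
      · have e : (1 / 8 / 2 ^ 0 : ℝ) = 1 / 4 / 2 := by norm_num
        rw [e]
        exact ha₃
      · push_cast at hbT
        nlinarith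
      · simp only [F]
        rw [hc, hM'.val, hM₃.val, ha'.angle, ha₃.angle]
        simp
  · intro u hu
    refine Leads.loop (J := I') (F := F) (k := J) ?_ ?_ ?_ ?_ hu
    · rintro j hj u ⟨v', φ', x', hM, hv', -⟩
      have := hJ j hj
      simpa [BExp.holds, RExp.eval, NExp.eval, cell, hM.work, hM.K, hv' 0 (by norm_num)] using this
    · rintro u ⟨v', φ', x', hM, hv', -⟩
      simpa [BExp.holds, RExp.eval, NExp.eval, cell, hM.work, hM.K, hv' 0 (by norm_num)] using hJ'
    · rintro j hj u ⟨v', φ, x', hM, hv', ha, hu, hT⟩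
      have hv1 : v' 1 = v 1 := hv' 1 (by norm_num)
      have h2j : (1 : ℝ) ≤ 2 ^ j := one_le_pow₀ (by norm_num)
      refine Leads.seq (leads_round hI hX hp hf (s := u.spend 1) hM hu hω ha (by rwa [hv1])
        (k := k) (by rwa [hv1]) (by rwa [hv1])
        (g := fun σ => |sgn σ * θ - 2 * Real.pi * φ| ≤ Real.pi / (2 * 2 ^ j))
        (A := A - 2 * v 1 * (J - (j + 1 : ℕ)))
        (g' := fun σ φ => |sgn σ * θ - 2 * Real.pi * φ| ≤ Real.pi / (2 * 2 ^ (j + 1)))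
        ?_ ?_ ?_ |>.mono ?_ fun u' hu' => ⟨hu', le_rfl⟩) ?_
      · intro σ hσ d hd
        rw [bias] at hd
        have h1 : sgn σ * θ - 2 * Real.pi * (φ + d * (1 / 8 / 2 ^ j)) =
            (sgn σ * θ - 2 * Real.pi * φ) - d * (Real.pi / (4 * 2 ^ j)) := by
          field_simp
          ring
        have h2 : Real.pi / (2 * 2 ^ (j + 1)) = Real.pi / (4 * 2 ^ j) := by
          rw [pow_succ]
          congr 1
          ring
        rw [h1, h2]
        refine abs_sub_le_of_correct (by positivity) hσ ?_
        push_cast at hd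
        exact hd
      · exact (hyJ _ hj).1
      · exact (hyJ _ hj).2
      · simp only [F]
        rw [hM.val, ha.angle, hv1]
        refine le_of_eq ?_
        change gain f ω _ _ u.state = gain f ω _ _ u.state
        congr 1
        ext σ
        push_cast
        ring
      · rintro b ⟨v'', φ', x'', hM', hv'', ha', hb, hbT⟩
        have hst : (1 : ℝ) / 8 / 2 ^ j ≤ 1 / 4 := by
          rw [div_le_iff₀ (by positivity)]
          linarith
        refine Leads.seq (mid := fun c => ∃ v₃, Sees I t a (2 ^ j) v₃ c.mem ∧
          (∀ k < 4, v₃ k = v'' k) ∧ Angles φ' (1 / 8 / 2 ^ j / 2) v₃ ∧ c.state = b.state ∧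
          c.time ≤ b.time + 3) (g := F (j + 1))
          ((impl_halve ha' (by positivity) hst).leads hM' ?_) ?_
        · rintro c ⟨v₃, hM₃, hv₃, ha₃⟩ hc hcT
          rw [UOp.one_mulVec] at hc
          refine ⟨⟨v₃, hM₃, hv₃, ha₃, hc, hcT⟩, ?_⟩
          simp only [F]
          rw [hc, hM'.val, hM₃.val, ha'.angle, ha₃.angle]
        · rintro c ⟨v₃, hM₃, hv₃, ha₃, hc, hcT⟩
          refine (impl_setK (K' := 2 ^ (j + 1)) fun M hM => ?_).leads hM₃ ?_
          · simp only [NExp.eval, cell, hM.K, pow_succ]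
            ring
          · intro d hd hd' hdT
            rw [UOp.one_mulVec] at hd'
            refine ⟨⟨v₃, φ', x'', hd, fun k hk => ?_, ?_, by rw [hd', hc, hb], ?_⟩, ?_⟩
            · rw [hv₃ k hk, hv'' k hk, hv' k hk]
            · have e : (1 / 8 / 2 ^ (j + 1) : ℝ) = 1 / 8 / 2 ^ j / 2 := by
                rw [pow_succ]
                field_simp
              rw [e]
              exact ha₃
            · have e1 : (u.spend 1).time = u.time + 1 := rfl
              rw [e1] at hbT
              push_cast at hbT
              have h3 : (k : ℝ) * 27 ≤ k * 2 ^ j * D := by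
                rw [mul_assoc]
                exact mul_le_mul_of_nonneg_left (by nlinarith) (by linarith)
              rw [pow_succ]
              linarith
            · simp only [F]
              rw [hd', hM₃.val, hd.val]
    · rintro u ⟨v', φ, x', hM, hv', ha, hu, hT⟩
      refine ⟨⟨v', x', hM, hv', hu, ?_⟩, ?_⟩
      · change u.time + 1 ≤ _
        linarith
      · change F J u ≤ if |Real.cos θ - val I u 5| ≤ Real.pi / (2 * 2 ^ J) then A * nsq u.state
          else 0
        simp only [F]
        rw [hM.val, hM.val, ha.angle, ha.cos, sub_self, mul_zero, sub_zero]
        have hA0 : 0 ≤ A := by simpa using (hyJ J le_rfl).1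
        have hcos : ∀ σ, |sgn σ * θ - 2 * Real.pi * φ| ≤ Real.pi / (2 * 2 ^ J) →
            |Real.cos θ - Real.cos (2 * Real.pi * φ)| ≤ Real.pi / (2 * 2 ^ J) := by
          intro σ hσ
          have e : Real.cos θ = Real.cos (sgn σ * θ) := by cases σ <;> simp [sgn]
          rw [e]
          exact (abs_cos_sub_cos_le _ _).trans hσ
        split_ifs with h
        · rw [hu, ← hgain]
          exact gain_mono hω (fun σ _ => Or.inl ⟨trivial, le_rfl⟩) fun _ => hA0
        · refine le_of_eq (Finset.sum_eq_zero fun σ _ => if_neg fun hσ => h (hcos σ hσ))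

end Estimate

/-! ### The sum of the estimates -/

section Blocks

variable {m l n N w Q a : ℕ} {B : BlackBoxes l n N w} {I : Mem} {K : ℕ} {v : ℕ → ℝ}
variable {x : Fin m → Bits n} {Φ : Bits n → EuclideanSpace ℝ (Bits N)} {i : Fin m}

/-- All qubits from the address `a` on are zero; nothing is said about the qubits before, which have
been used for other vectors. -/
def Fresh (a : ℕ) (ψ : Bits Q → ℂ) : Prop := ∀ r : Fin Q, a ≤ r → Holds ψ r false

/-- On a fresh block of qubits, the current state spans a plane on which the walk operator has the
phases `± arccos (- overlap)`. -/
theorem exists_plane {X : Boxes l n N} {vec : EuclideanSpace ℝ (Fin m)}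
    (hX : Realizes X x Φ vec) (hi : Φ (x i) ≠ 0) (ho : |overlap l x Φ vec i| ≤ 1 / 2) {p : Fin Q}
    (hp : (p : ℕ) = a + (l + n + (N + 3)) + (l + n + (N + 3) + 1)) {ψ : Bits Q → ℂ}
    (hψ : Fresh a ψ) : ∃ f : Bool → Bits Q → ℂ,
      Plane (walkU Q i a X) p (Real.arccos (-overlap l x Φ vec i)) f (nsq ψ) ∧
        ψ = span f (fun _ => 1) ∧ ∀ s, Fresh (p + 1) (f s) := by
  have hQ : a + (l + n + (N + 3)) + (l + n + (N + 3) + 2) ≤ Q := by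
    have := p.2
    omega
  set φ := (gateAt Q [] xMat p).1 *ᵥ ψ with hφ
  have hφ1 : Holds φ p true := holds_flip (hψ p (by omega))
  have hφ2 : ∀ r : Fin Q, a ≤ r → r ≠ p → Holds φ r false := fun r hr hrp =>
    (hψ r hr).mulVec (gateAt_mem_keeps _ fun e => hrp (Fin.ext e.symm))
  obtain ⟨h1, h2⟩ := walkU_plane hX hi hQ hp
    (fun r hr hrp => hφ2 r hr (ne_of_lt hrp)) hφ1
  obtain ⟨e, he, hsum, hlin⟩ := exists_eigenPair (by rwa [abs_neg]) h1 h2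
  have hnsq : nsq φ = nsq ψ := nsq_mulVec _ _
  have hhold : ∀ (r : Fin Q) (b : Bool), (r : ℕ) < a ∨
      a + (l + n + (N + 3)) + (l + n + (N + 3)) < r → Holds φ r b → ∀ s, Holds (e s) r b := by
    intro r b hr hb s
    obtain ⟨c, d, hcd⟩ := hlin s
    rw [hcd]
    exact ((hb.mulVec (walkU_mem_keeps hr)).smul c).add (hb.smul d)
  have hflip : ∀ s, Holds ((gateAt Q [] xMat p).1 *ᵥ e s) p false := fun s =>
    holds_flip (hhold p true (by omega) hφ1 s)
  refine ⟨fun s => (gateAt Q [] xMat p).1 *ᵥ e s, ⟨hflip, fun s => ?_, fun s => ?_, ?_,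
    fun s => ?_⟩, ?_, fun s r hr => ?_⟩
  · exact walkU_of_false hQ hp (hflip s)
  · rw [xGate_xGate]
    exact he.eig s
  · rw [inn_mulVec, he.orth]
  · rw [inn_mulVec, he.norm, hnsq]
  · rw [span, one_smul, one_smul, ← Matrix.mulVec_add, ← hsum, hφ, xGate_xGate]
  · exact (hhold r false (by omega) (hφ2 r (by omega) (by
      rintro rfl
      omega)) s).mulVec (gateAt_mem_keeps _ (by omega))

theorem Fresh.span {f : Bool → Bits Q → ℂ} (h : ∀ s, Fresh a (f s)) (c : Bool → ℂ) :
    Fresh a (span f c) := fun r hr => ((h _ r hr).smul _).add ((h _ r hr).smul _)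

theorem arccos_mem {c : ℝ} (h : |c| ≤ 1 / 2) :
    Real.pi / 3 ≤ Real.arccos c ∧ Real.arccos c ≤ 2 * Real.pi / 3 := by
  obtain ⟨h1, h2⟩ := abs_le.1 h
  have hπ := Real.pi_pos
  constructor
  · rw [← Real.arccos_cos (x := Real.pi / 3) (by linarith) (by linarith), Real.cos_pi_div_three]
    exact Real.arccos_le_arccos h2
  · have e : Real.cos (2 * Real.pi / 3) = -(1 / 2) := by
      have : 2 * Real.pi / 3 = Real.pi - Real.pi / 3 := by ring
      rw [this, Real.cos_pi_sub, Real.cos_pi_div_three]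
    rw [← Real.arccos_cos (x := 2 * Real.pi / 3) (by linarith) (by linarith), e]
    exact Real.arccos_le_arccos h1

/-- The coefficient, and the norm of the stored vector, that belong to the current vector. -/
def coeffR (k : ℕ) : RExp := .get (.add (.lit k) (.add (cell 6) (cell 6)))

/-- Add the estimate of the current inner product to the result, and pass to the next vector and
the next block of qubits. The estimate enters with a minus sign, because the cosine of the phase is
the negative of the overlap. -/
def finishP : Program :=
  .seq (setWork 3 (.sub (work 3) (.mul (.mul (.mul (coeffR 6) (coeffR 7)) (work 2)) (work 5))))
    (.seq (.setN (.lit 7) (.add (cell 7) (.add (.add eSize eSize) (.lit 2))))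
      (.setN (.lit 6) (.add (cell 6) (.lit 1))))

theorem impl_finish (hI : Shape l n N i I) (hw : I.nat 4 = w) (t : Fin w) :
    Impl B finishP (Sees I t a K v) (Sees I (t + 1 : ℕ) (a + (2 * (l + n + (N + 3)) + 2)) K
      (Function.update v 3 (v 3 - I.real (6 + 2 * t) * I.real (7 + 2 * t) * v 2 * v 5)))
      (1 : UOp Q) 3 := by
  have hco : ∀ M, Sees I t a K v M → ∀ k, k = 6 ∨ k = 7 →
      (coeffR k).eval M = I.real (k + 2 * t) := by
    intro M hM k hk
    have ht := t.2
    have e : k + ((t : ℕ) + t) = k + 2 * t := by ring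
    simp only [coeffR, RExp.eval, NExp.eval, cell, hM.t]
    rw [hM.cell_real (by omega), e]
  have h1 := impl_setWork (B := B) (Q := Q) (I := I) (t := t) (a := a) (K := K) (v := v) (k := 3)
    (e := .sub (work 3) (.mul (.mul (.mul (coeffR 6) (coeffR 7)) (work 2)) (work 5)))
    (x := v 3 - I.real (6 + 2 * t) * I.real (7 + 2 * t) * v 2 * v 5) fun M hM => by
      simp only [RExp.eval, hM.work, hco M hM 6 (by simp), hco M hM 7 (by simp)]
  have h2 : ∀ v', Impl B (.setN (.lit 7) (.add (cell 7) (.add (.add eSize eSize) (.lit 2))))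
      (Sees I t a K v') (Sees I t (a + (2 * (l + n + (N + 3)) + 2)) K v') (1 : UOp Q) 1 :=
    fun v' => impl_setN _ _ fun M hM => by
      have e : (NExp.add (cell 7) (.add (.add eSize eSize) (.lit 2))).eval M =
          a + (2 * (l + n + (N + 3)) + 2) := by
        simp only [NExp.eval, (hM.ctx hI).eSize, cell, hM.a]
        ring
      rw [e]
      refine ⟨fun k hk => ?_, ?_, ?_, ?_, hM.real⟩
      · simp only [Mem.setNat, NExp.eval]
        rw [Function.update_of_ne (by omega), hM.input k hk]
      · simp [Mem.setNat, NExp.eval, hM.t]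
      · simp [Mem.setNat, NExp.eval]
      · simp [Mem.setNat, NExp.eval, hM.K]
  have h3 : ∀ a' v', Impl B (.setN (.lit 6) (.add (cell 6) (.lit 1)))
      (Sees I t a' K v') (Sees I (t + 1 : ℕ) a' K v') (1 : UOp Q) 1 :=
    fun a' v' => impl_setN _ _ fun M hM => by
      refine ⟨fun k hk => ?_, ?_, ?_, ?_, hM.real⟩
      · simp only [Mem.setNat, NExp.eval]
        rw [Function.update_of_ne (by omega), hM.input k hk]
      · simp [Mem.setNat, NExp.eval, cell, hM.t]
      · simp [Mem.setNat, NExp.eval, hM.a]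
      · simp [Mem.setNat, NExp.eval, hM.K]
  exact (h1.seq ((h2 _).seq (h3 _ _))).congr rfl (by simp) (by norm_num)

/-- The computation for one vector. -/
def blockP : Program := .seq estimateP finishP

open Classical in
/-- The estimate for the vector `t`, on a fresh block of qubits. The qubits of earlier blocks may be
in any state. -/
theorem leads_block (hI : Shape l n N i I) (hw : I.nat 4 = w) {t : Fin w} {X : Boxes l n N}
    (hXB : IsBoxes B t X) {vec : EuclideanSpace ℝ (Fin m)} (hX : Realizes X x Φ vec)
    (hi : Φ (x i) ≠ 0) (ho : |overlap l x Φ vec i| ≤ 1 / 2)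
    (hQ : a + (2 * (l + n + (N + 3)) + 2) ≤ Q) {s : Branch Q} (hs : Sees I t a K v s.mem)
    (hfresh : Fresh a s.state) (hy : 0 < v 1) {k : ℕ} (hk0 : 1 ≤ k)
    (hk : ∀ j < k, v 1 * (37 / 36) ^ j < 1) (hk' : 1 ≤ v 1 * (37 / 36) ^ k) {J : ℕ}
    (hJ : ∀ j < J, 2 ^ j < v 0) (hJ' : v 0 ≤ 2 ^ J) {A : ℝ} (hA : 0 ≤ A - 2 * v 1 * (J + 1))
    (hA' : A ≤ 1) (hB : 80 ≤ walkTime B) :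
    Leads B blockP s (fun u => ∃ K' v', Sees I (t + 1 : ℕ) (a + (2 * (l + n + (N + 3)) + 2)) K' v'
          u.mem ∧ (∀ k < 3, v' k = v k) ∧ Fresh (a + (2 * (l + n + (N + 3)) + 2)) u.state ∧
        u.time ≤ s.time + (2 * k * (walkTime B + 2) * 2 ^ J + 4))
      (fun u => if |val I u 3 - (v 3 +
          I.real (6 + 2 * t) * I.real (7 + 2 * t) * v 2 * overlap l x Φ vec i)| ≤
            |I.real (6 + 2 * t) * I.real (7 + 2 * t) * v 2| * (Real.pi / (2 * 2 ^ J))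
        then A * nsq u.state else 0)
      ((A - 2 * v 1 * (J + 1)) * nsq s.state) := by
  obtain ⟨p, hp⟩ : ∃ p : Fin Q, (p : ℕ) = a + (l + n + (N + 3)) + (l + n + (N + 3) + 1) :=
    ⟨⟨_, by omega⟩, rfl⟩
  obtain ⟨f, hf, hspan, hfr⟩ := exists_plane hX hi ho hp hfresh
  obtain ⟨hθ, hθ'⟩ := arccos_mem (c := -overlap l x Φ vec i) (by rwa [abs_neg])
  have hcos : Real.cos (Real.arccos (-overlap l x Φ vec i)) = -overlap l x Φ vec i := by
    obtain ⟨h1, h2⟩ := abs_le.1 ho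
    exact Real.cos_arccos (by linarith) (by linarith)
  refine Leads.seq (leads_estimate hI hXB hp hf hθ hθ' hs hspan (nsq_nonneg _) hy hk0 hk hk' hJ hJ'
    hA hA' hB) ?_
  rintro u ⟨v', c, hM, hv', hu, hT⟩
  refine (impl_finish hI hw t).leads hM ?_
  intro b hM' hb hbT
  rw [UOp.one_mulVec] at hb
  refine ⟨⟨_, _, hM', fun k hk => ?_, ?_, by linarith⟩, ?_⟩
  · rw [Function.update_of_ne (by omega), hv' k (by omega)]
  · rw [hb, hu]
    refine Fresh.span (fun σ r hr => hfr σ r (by omega)) c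
  · rw [hM.val, hM'.val, hcos, hb, Function.update_self, hv' 2 (by norm_num), hv' 3 (by norm_num)]
    set z := I.real (6 + 2 * t) * I.real (7 + 2 * t) * v 2
    have e : v 3 - z * v' 5 - (v 3 + z * overlap l x Φ vec i) =
        z * (-overlap l x Φ vec i - v' 5) := by ring
    rw [e, abs_mul]
    have hA0 : 0 ≤ A * nsq u.state := by
      refine mul_nonneg (hA.trans ?_) (nsq_nonneg _)
      have : 0 ≤ 2 * v 1 * (J + 1) := by positivity
      linarith
    split_ifs with h1 h2 h2
    · exact le_rfl
    · exact absurd (mul_le_mul_of_nonneg_left h1 (abs_nonneg z)) h2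
    · exact hA0
    · exact le_rfl

theorem Leads.of_nonneg {P : Program} {s : Branch Q} {post : Branch Q → Prop}
    {f f' : Branch Q → ℝ} {r : ℝ} (h : Leads B P s post f r) (hf : ∀ u, 0 ≤ f' u) :
    Leads B P s post f' 0 := by
  obtain ⟨L, hE, hL, -⟩ := h
  refine ⟨L, hE, hL, List.sum_nonneg fun y hy => ?_⟩
  obtain ⟨u, -, rfl⟩ := List.mem_map.1 hy
  exact hf u

open Classical in
/-- The sum over all vectors. -/
theorem leads_blocks (hI : Shape l n N i I) (hw : I.nat 4 = w) {X : Fin w → Boxes l n N}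
    (hXB : ∀ t, IsBoxes B t (X t)) {vec : Fin w → EuclideanSpace ℝ (Fin m)}
    (hX : ∀ t, Realizes (X t) x Φ (vec t)) (hi : Φ (x i) ≠ 0)
    (ho : ∀ t, |overlap l x Φ (vec t) i| ≤ 1 / 2)
    (hQ : w * (2 * (l + n + (N + 3)) + 2) ≤ Q) {s : Branch Q} (hs : Sees I 0 0 K v s.mem)
    (hfresh : Fresh 0 s.state) (hv3 : v 3 = 0) (hy : 0 < v 1) {k : ℕ} (hk0 : 1 ≤ k)
    (hk : ∀ j < k, v 1 * (37 / 36) ^ j < 1) (hk' : 1 ≤ v 1 * (37 / 36) ^ k) {J : ℕ}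
    (hJ : ∀ j < J, 2 ^ j < v 0) (hJ' : v 0 ≤ 2 ^ J) (hA : 0 ≤ 1 - 2 * v 1 * (J + 1) * w)
    (hB : 80 ≤ walkTime B) :
    Leads B (.loop (.ltN (cell 6) (cell 4)) blockP) s
      (fun u => (∃ K' a' v', Sees I w a' K' v' u.mem) ∧
        u.time ≤ s.time + (w * (2 * k * (walkTime B + 2) * 2 ^ J + 5) + 1))
      (fun u => if |val I u 3 - ∑ t : Fin w,
          I.real (6 + 2 * t) * I.real (7 + 2 * t) * v 2 * overlap l x Φ (vec t) i| ≤
            ∑ t : Fin w,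
              |I.real (6 + 2 * t) * I.real (7 + 2 * t) * v 2| * (Real.pi / (2 * 2 ^ J))
        then nsq u.state else 0)
      ((1 - 2 * v 1 * (J + 1) * w) * nsq s.state) := by
  set c := 2 * v 1 * ((J : ℝ) + 1) with hc
  have hc0 : 0 ≤ c := by positivity
  have hπ := Real.pi_pos
  let z : ℕ → ℝ := fun t => if h : t < w then
    I.real (6 + 2 * t) * I.real (7 + 2 * t) * v 2 * overlap l x Φ (vec ⟨t, h⟩) i else 0
  let E : ℕ → ℝ := fun t =>
    |I.real (6 + 2 * t) * I.real (7 + 2 * t) * v 2| * (Real.pi / (2 * 2 ^ J))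
  let J' : ℕ → Branch Q → Prop := fun t u => ∃ K' v',
    Sees I t (t * (2 * (l + n + (N + 3)) + 2)) K' v' u.mem ∧ (∀ k < 3, v' k = v k) ∧
    Fresh (t * (2 * (l + n + (N + 3)) + 2)) u.state ∧
    u.time ≤ s.time + t * (2 * k * (walkTime B + 2) * 2 ^ J + 5)
  -- branches in which the error is already too large are given up
  let F : ℕ → Branch Q → ℝ := fun t u =>
    if |val I u 3 - ∑ r ∈ Finset.range t, z r| ≤ ∑ r ∈ Finset.range t, E r then
      (1 - c * (w - t)) * nsq u.state else 0
  have hcw : ∀ t ≤ w, 0 ≤ 1 - c * (w - t) ∧ 1 - c * (w - t) ≤ 1 := by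
    intro t ht
    have : (t : ℝ) ≤ w := by exact_mod_cast ht
    have h0 : (0 : ℝ) ≤ t := Nat.cast_nonneg t
    constructor
    · nlinarith
    · nlinarith
  have hs0 : J' 0 s := ⟨K, v, by simpa using hs, fun _ _ => rfl, by simpa using hfresh, by simp⟩
  have hF0 : F 0 s = (1 - c * w) * nsq s.state := by
    simp only [F]
    rw [hs.val, hv3]
    simp
  rw [← hF0]
  refine Leads.loop (J := J') (F := F) (k := w) ?_ ?_ ?_ ?_ hs0
  · rintro t ht u ⟨K', v', hM, -⟩
    simp [BExp.holds, NExp.eval, cell, hM.t, hM.input 4 (by norm_num), hw, ht]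
  · rintro u ⟨K', v', hM, -⟩
    simp [BExp.holds, NExp.eval, cell, hM.t, hM.input 4 (by norm_num), hw]
  · rintro t ht u ⟨K', v', hM, hv', hfr, hT⟩
    have h1 : v' 1 = v 1 := hv' 1 (by norm_num)
    have h0 : v' 0 = v 0 := hv' 0 (by norm_num)
    have h2 : v' 2 = v 2 := hv' 2 (by norm_num)
    have hQ' : t * (2 * (l + n + (N + 3)) + 2) + (2 * (l + n + (N + 3)) + 2) ≤ Q := by
      refine le_trans ?_ hQ
      have := Nat.mul_le_mul_right (2 * (l + n + (N + 3)) + 2) (Nat.succ_le_of_lt ht)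
      rwa [Nat.succ_mul] at this
    have e1 : (t + 1) * (2 * (l + n + (N + 3)) + 2) =
        t * (2 * (l + n + (N + 3)) + 2) + (2 * (l + n + (N + 3)) + 2) := by ring
    have key := leads_block (A := 1 - c * (w - (t + 1 : ℕ))) hI hw (hXB ⟨t, ht⟩) (hX ⟨t, ht⟩) hi
      (ho ⟨t, ht⟩) hQ' (s := u.spend 1) hM hfr (by rwa [h1]) hk0 (by rwa [h1]) (by rwa [h1])
      (by rwa [h0]) (by rwa [h0]) (by
        rw [h1, ← hc]
        have := (hcw t ht.le).1
        push_cast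
        linarith) (hcw (t + 1) ht).2 hB
    have hpost : ∀ b : Branch Q, (∃ K' v'', Sees I (t + 1 : ℕ)
        (t * (2 * (l + n + (N + 3)) + 2) + (2 * (l + n + (N + 3)) + 2)) K' v'' b.mem ∧
        (∀ k < 3, v'' k = v' k) ∧
        Fresh (t * (2 * (l + n + (N + 3)) + 2) + (2 * (l + n + (N + 3)) + 2)) b.state ∧
        b.time ≤ (u.spend 1).time + (2 * k * (walkTime B + 2) * 2 ^ J + 4)) → J' (t + 1) b := by
      rintro b ⟨K'', v'', hM', hv'', hfr', hbT⟩
      refine ⟨K'', v'', by rwa [e1], fun k hk => (hv'' k hk).trans (hv' k hk), by rwa [e1], ?_⟩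
      have : (u.spend 1).time = u.time + 1 := rfl
      push_cast
      linarith
    by_cases hgood : |val I u 3 - ∑ r ∈ Finset.range t, z r| ≤ ∑ r ∈ Finset.range t, E r
    · refine key.mono ?_ fun b hb => ⟨hpost b hb, ?_⟩
      · simp only [F]
        rw [if_pos hgood, h1, ← hc]
        refine le_of_eq ?_
        change _ = _ * nsq u.state
        push_cast
        ring
      · simp only [F]
        rw [hM.val] at hgood
        have hz : z t = I.real (6 + 2 * t) * I.real (7 + 2 * t) * v 2 *
            overlap l x Φ (vec ⟨t, ht⟩) i := dif_pos ht
        rw [h2]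
        simp only [← hz]
        rw [Finset.sum_range_succ, Finset.sum_range_succ]
        split_ifs with h3 h4 h4
        · exact le_rfl
        · refine absurd ?_ h4
          have e2 : val I b 3 - (∑ r ∈ Finset.range t, z r + z t) =
              (val I b 3 - (v' 3 + z t)) + (v' 3 - ∑ r ∈ Finset.range t, z r) := by ring
          rw [e2]
          refine (abs_add_le _ _).trans ?_
          rw [add_comm (∑ r ∈ Finset.range t, E r)]
          exact add_le_add h3 hgood
        · exact mul_nonneg (hcw (t + 1) ht).1 (nsq_nonneg _)
        · exact le_rfl
    · have e2 : F t u = 0 := if_neg hgood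
      rw [e2]
      refine (key.of_nonneg (f' := F (t + 1)) fun b => ?_).mono le_rfl
        fun b hb => ⟨hpost b hb, le_rfl⟩
      simp only [F]
      split_ifs
      · exact mul_nonneg (hcw (t + 1) ht).1 (nsq_nonneg _)
      · exact le_rfl
  · rintro u ⟨K', v', hM, hv', hfr, hT⟩
    refine ⟨⟨⟨K', _, v', hM⟩, ?_⟩, ?_⟩
    · change u.time + 1 ≤ _
      linarith
    · simp only [F]
      rw [Finset.sum_range, Finset.sum_range]
      have hz : ∀ t : Fin w, z t = I.real (6 + 2 * t) * I.real (7 + 2 * t) * v 2 *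
          overlap l x Φ (vec t) i := fun t => dif_pos t.2
      simp only [hz, sub_self, mul_zero, sub_zero, one_mul]
      exact le_rfl

end Blocks

/-! ### The program -/

section Main

variable {m l n N w Q : ℕ} {B : BlackBoxes l n N w} {I : Mem}

/-- Compute `2 ^ l`; it is left in cell `9`. -/
def powP : Program :=
  .seq (.setN (.lit 9) (.lit 1)) (.seq (.setN (.lit 10) (.lit 0))
    (.loop (.ltN (cell 10) (cell 0)) (.seq (.setN (.lit 9) (.add (cell 9) (cell 9)))
      (.setN (.lit 10) (.add (cell 10) (.lit 1))))))

theorem impl_pow {t a K : ℕ} {v : ℕ → ℝ} (hl : I.nat 0 = l) :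
    Impl B powP (Sees I t a K v) (Sees I t a (2 ^ l) v) (1 : UOp Q) (3 * l + 3) := by
  have h1 := impl_setK (B := B) (Q := Q) (I := I) (t := t) (a := a) (K := K) (v := v)
    (e := .lit 1) (K' := 1) fun M _ => rfl
  let J : ℕ → Mem → Prop := fun j M => Sees I t a (2 ^ j) v M ∧ M.nat 10 = j
  have h2 : Impl B (.setN (.lit 10) (.lit 0)) (Sees I t a 1 v) (J 0) (1 : UOp Q) 1 :=
    impl_setN _ _ fun M hM => ⟨by
      rw [pow_zero]
      exact hM.setNat (le_refl 10) 0, by simp [Mem.setNat, NExp.eval]⟩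
  have h3 := Impl.loop (B := B) (Q := Q) (t := .ltN (cell 10) (cell 0))
    (P := .seq (.setN (.lit 9) (.add (cell 9) (cell 9)))
      (.setN (.lit 10) (.add (cell 10) (.lit 1)))) (J := J) (U := fun _ => 1 * 1) (T := 1 + 1)
    (k := l) (fun j hj M hM => by
      simpa [BExp.holds, NExp.eval, cell, hM.2, hM.1.input 0 (by norm_num), hl] using hj)
    (fun M hM => by
      simp [BExp.holds, NExp.eval, cell, hM.2, hM.1.input 0 (by norm_num), hl])
    (fun j _ => by
      refine Impl.seq (mid := fun M => Sees I t a (2 ^ (j + 1)) v M ∧ M.nat 10 = j)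
        (impl_setN _ _ ?_) (impl_setN _ _ ?_)
      · rintro M ⟨hM, h10⟩
        simp only [NExp.eval, cell]
        refine ⟨⟨fun k hk => ?_, ?_, ?_, ?_, hM.real⟩, ?_⟩
        · simp only [Mem.setNat]
          rw [Function.update_of_ne (by omega), hM.input k hk]
        · simp [Mem.setNat, hM.t]
        · simp [Mem.setNat, hM.a]
        · simp only [Mem.setNat, Function.update_self, hM.K, pow_succ]
          ring
        · simp [Mem.setNat, h10]
      · rintro M ⟨hM, h10⟩
        exact ⟨hM.setNat (le_refl 10) _, by simp [Mem.setNat, NExp.eval, cell, h10]⟩)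
  rw [mul_one, prodU_const, one_pow] at h3
  refine Impl.mono (U := 1) ?_ (fun _ h => h) (fun M (hM : J l M) => hM.1) le_rfl
  have h4 := h1.seq (h2.seq h3)
  rw [mul_one, mul_one] at h4
  refine h4.mono (fun _ h => h) (fun _ h => h) ?_
  linarith

/-- The real input cell `k`. -/
def inp (k : ℕ) : RExp := .get (.lit k)

theorem Sees.inp {t a K : ℕ} {v : ℕ → ℝ} {M : Mem} (h : Sees I t a K v M) {k : ℕ} (hk : k < 6) :
    (inp k).eval M = I.real k := by
  rw [_root_.inp, RExp.eval, NExp.eval, h.cell_real (by omega)]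

/-- The number `C R ‖Φ (x i)‖`, a bound for the absolute value of the exact answer. -/
def boundR : RExp := .mul (.mul (inp 0) (inp 3)) (inp 5)

/-- Compute `precision`, `tolerance` and `factor`. -/
def setupP : Program :=
  .seq powP (.seq (setWork 0 (.div (.mul (num 8) boundR) (inp 1)))
    (.seq (setWork 1 (.div (inp 2) (.mul (.mul (num 4) (.ofNat (cell 4))) (work 0))))
      (setWork 2 (.mul (.mul (inp 5) (inp 4))
        (.sqrt (.div (.mul (num 4) (.ofNat (cell 9))) (.ofNat (cell 3))))))))

/-- The whole program. The result is left in the real cell `0`. -/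
def mainP : Program :=
  .ite (.ltR (inp 1) boundR)
    (.seq setupP (.seq (.loop (.ltN (cell 6) (cell 4)) blockP) (.setR (.lit 0) (work 3))))
    (.setR (.lit 0) (num 0))

/-- The inverse of the required precision of the phases. The constant `8` is large enough for the
estimates in `sum_error_le`. -/
noncomputable def precision (I : Mem) : ℝ := 8 * (I.real 0 * I.real 3 * I.real 5) / I.real 1

/-- The error probability that is allowed in a round is twice this number. There are at most
`2 * precision I` rounds for each vector, so the total error probability is at most `δ`. -/
noncomputable def tolerance (I : Mem) : ℝ := I.real 2 / (4 * I.nat 4 * precision I)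

/-- The factor between the overlaps and the inner products, except for `η`: the label and the norm
of the feature vector of the datum `i`, and the quotient of the amplitudes `m ^ (-1 / 2)` and `2 ^
(-(l + 2) / 2)`. -/
noncomputable def factor (l : ℕ) (I : Mem) : ℝ :=
  I.real 5 * I.real 4 * Real.sqrt (4 * 2 ^ l / I.nat 3)

theorem impl_setup (hl : I.nat 0 = l) : Impl B setupP (Sees I 0 0 0 fun _ => 0)
    (fun M => ∃ v, Sees I 0 0 (2 ^ l) v M ∧ v 0 = precision I ∧ v 1 = tolerance I ∧
      v 2 = factor l I ∧ v 3 = 0) (1 : UOp Q) (3 * l + 6) := by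
  have hb : ∀ {K : ℕ} {v : ℕ → ℝ} {M : Mem}, Sees I 0 0 K v M →
      boundR.eval M = I.real 0 * I.real 3 * I.real 5 := fun hM => by
    rw [boundR, RExp.eval, RExp.eval, hM.inp (by norm_num), hM.inp (by norm_num),
      hM.inp (by norm_num)]
  have h1 := impl_setWork (B := B) (Q := Q) (I := I) (t := 0) (a := 0) (K := 2 ^ l)
    (v := fun _ => 0) (k := 0) (e := .div (.mul (num 8) boundR) (inp 1)) (x := precision I)
    fun M hM => by
      simp [RExp.eval, num, NExp.eval, hb hM, hM.inp, precision]
  have h2 := impl_setWork (B := B) (Q := Q) (I := I) (t := 0) (a := 0) (K := 2 ^ l)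
    (v := Function.update (fun _ => 0) 0 (precision I)) (k := 1)
    (e := .div (inp 2) (.mul (.mul (num 4) (.ofNat (cell 4))) (work 0))) (x := tolerance I)
    fun M hM => by
      simp [RExp.eval, num, NExp.eval, cell, hM.inp, hM.work, hM.input, tolerance]
  have h3 := impl_setWork (B := B) (Q := Q) (I := I) (t := 0) (a := 0) (K := 2 ^ l)
    (v := Function.update (Function.update (fun _ => 0) 0 (precision I)) 1 (tolerance I)) (k := 2)
    (e := .mul (.mul (inp 5) (inp 4))
        (.sqrt (.div (.mul (num 4) (.ofNat (cell 9))) (.ofNat (cell 3))))) (x := factor l I)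
    fun M hM => by
      simp [RExp.eval, num, NExp.eval, cell, hM.inp, hM.K, hM.input, factor]
  have h4 := ((impl_pow (K := 0) hl).seq (h1.seq (h2.seq h3))).congr rfl (U' := 1) (by simp)
    (T' := 3 * l + 6) (by linarith)
  refine h4.mono (fun _ h => h) (fun M hM => ⟨_, hM, ?_⟩) le_rfl
  simp

variable {x : Fin m → Bits n} {Φ : Bits n → EuclideanSpace ℝ (Bits N)} {i : Fin m}

open Classical in
/-- If `C R ‖Φ (x i)‖` is at most the admissible error, the program answers `0`. -/
theorem leads_main_of_le {s : Branch Q} (hs : Sees I 0 0 0 (fun _ => 0) s.mem)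
    (h : I.real 0 * I.real 3 * I.real 5 ≤ I.real 1) :
    Leads B mainP s (fun u => u.mem.real 0 = 0 ∧ u.time ≤ s.time + 2) (fun u => nsq u.state)
      (nsq s.state) := by
  have h1 : Impl B mainP (Sees I 0 0 0 fun _ => 0) (fun M => M.real 0 = 0)
      (if False then 1 else 1 : UOp Q) (1 + 1) := by
    refine Impl.ite (fun M hM => ?_) (fun h => h.elim) fun _ => impl_setR _ _ fun M hM => ?_
    · simpa [BExp.holds, boundR, RExp.eval, hM.inp] using h
    · simp [Mem.setReal, num, RExp.eval, NExp.eval]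
  refine h1.leads hs fun u hu hu' hT => ⟨⟨hu, by linarith⟩, ?_⟩
  rw [hu', if_neg not_false, UOp.one_mulVec]

open Classical in
/-- Otherwise it computes a weighted sum of overlaps. -/
theorem leads_main (hI : Shape l n N i I) (hw : I.nat 4 = w) {X : Fin w → Boxes l n N}
    (hXB : ∀ t, IsBoxes B t (X t)) {vec : Fin w → EuclideanSpace ℝ (Fin m)}
    (hX : ∀ t, Realizes (X t) x Φ (vec t)) (hi : Φ (x i) ≠ 0)
    (ho : ∀ t, |overlap l x Φ (vec t) i| ≤ 1 / 2)
    (hQ : w * (2 * (l + n + (N + 3)) + 2) ≤ Q) {s : Branch Q}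
    (hs : Sees I 0 0 0 (fun _ => 0) s.mem) (hfresh : Fresh 0 s.state)
    (h : I.real 1 < I.real 0 * I.real 3 * I.real 5) (hy : 0 < tolerance I) {k : ℕ} (hk0 : 1 ≤ k)
    (hk : ∀ j < k, tolerance I * (37 / 36) ^ j < 1) (hk' : 1 ≤ tolerance I * (37 / 36) ^ k) {J : ℕ}
    (hJ : ∀ j < J, 2 ^ j < precision I) (hJ' : precision I ≤ 2 ^ J)
    (hA : 0 ≤ 1 - 2 * tolerance I * (J + 1) * w) (hB : 80 ≤ walkTime B) :
    Leads B mainP s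
      (fun u => u.time ≤ s.time + (3 * l + 9 + w * (2 * k * (walkTime B + 2) * 2 ^ J + 5)))
      (fun u => if |u.mem.real 0 - ∑ t : Fin w,
          I.real (6 + 2 * t) * I.real (7 + 2 * t) * factor l I * overlap l x Φ (vec t) i| ≤
            ∑ t : Fin w,
              |I.real (6 + 2 * t) * I.real (7 + 2 * t) * factor l I| * (Real.pi / (2 * 2 ^ J))
        then nsq u.state else 0)
      ((1 - 2 * tolerance I * (J + 1) * w) * nsq s.state) := by
  have ht : (BExp.ltR (inp 1) boundR).holds s.mem := by
    simpa [BExp.holds, boundR, RExp.eval, hs.inp] using h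
  suffices H : Leads B (.seq setupP (.seq (.loop (.ltN (cell 6) (cell 4)) blockP)
      (.setR (.lit 0) (work 3)))) (s.spend 1)
      (fun u => u.time ≤ s.time + (3 * l + 9 + w * (2 * k * (walkTime B + 2) * 2 ^ J + 5)))
      (fun u => if |u.mem.real 0 - ∑ t : Fin w,
          I.real (6 + 2 * t) * I.real (7 + 2 * t) * factor l I * overlap l x Φ (vec t) i| ≤
            ∑ t : Fin w,
              |I.real (6 + 2 * t) * I.real (7 + 2 * t) * factor l I| * (Real.pi / (2 * 2 ^ J))
        then nsq u.state else 0)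
      ((1 - 2 * tolerance I * (J + 1) * w) * nsq s.state) by
    obtain ⟨L, hE, hL⟩ := H
    exact ⟨L, Exec.iteTrue _ _ _ _ _ ht hE, hL⟩
  refine Leads.seq (mid := fun u => (∃ v, Sees I 0 0 (2 ^ l) v u.mem ∧ v 0 = precision I ∧
      v 1 = tolerance I ∧ v 2 = factor l I ∧ v 3 = 0) ∧ u.state = s.state ∧
      u.time ≤ s.time + 1 + (3 * l + 6))
    (g := fun u => (1 - 2 * tolerance I * (J + 1) * w) * nsq u.state)
    ((impl_setup hI.l).leads (s := s.spend 1) hs fun u hu hu' hT => ?_) ?_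
  · rw [UOp.one_mulVec] at hu'
    exact ⟨⟨hu, hu', hT⟩, by rw [hu']; exact le_rfl⟩
  rintro u ⟨⟨v, hM, h0, h1, h2, h3⟩, hu, hT⟩
  have key := leads_blocks hI hw hXB hX hi ho hQ hM (by rwa [hu]) h3 (by rwa [h1]) hk0
    (by rwa [h1]) (by rwa [h1]) (by rwa [h0]) (by rwa [h0]) (by rwa [h1]) hB
  rw [h1, h2] at key
  refine Leads.seq key ?_
  rintro b ⟨⟨K', a', v', hM'⟩, hbT⟩
  have hset : Impl B (.setR (.lit 0) (work 3)) (Sees I w a' K' v') (fun M => M.real 0 = v' 3)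
      (1 : UOp Q) 1 := impl_setR _ _ fun M hM => by
    simp [Mem.setReal, NExp.eval, hM.work]
  refine hset.leads hM' fun c hc hc' hcT => ⟨by linarith, ?_⟩
  rw [hM'.val, hc, hc', UOp.one_mulVec]

end Main

/-! ### The vectors of the data set -/

section Vectors

variable {m n N : ℕ} {x : Fin m → Bits n} {y : Fin m → ℤˣ}
  {Φ : Bits n → EuclideanSpace ℝ (Bits N)} {c : Bits m} {i : Fin m}

theorem bit_sq (b : Bool) : bit b ^ 2 = bit b := by cases b <;> simp [bit]

theorem bit_nonneg (b : Bool) : 0 ≤ bit b := by cases b <;> simp [bit]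

theorem bit_le_one (b : Bool) : bit b ≤ 1 := by cases b <;> simp [bit]

theorem label_sq (u : ℤˣ) : label u ^ 2 = 1 := by
  rcases Int.units_eq_one_or u with rfl | rfl <;> simp [label]

theorem abs_label (u : ℤˣ) : |label u| = 1 := by
  rcases Int.units_eq_one_or u with rfl | rfl <;> simp [label]

theorem eta_nonneg : 0 ≤ eta x Φ c := Real.sqrt_nonneg _

theorem eta_sq : eta x Φ c ^ 2 = (∑ j, bit (c j) * ‖Φ (x j)‖ ^ 2) / m :=
  Real.sq_sqrt (div_nonneg (Finset.sum_nonneg fun _ _ =>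
    mul_nonneg (bit_nonneg _) (sq_nonneg _)) (Nat.cast_nonneg m))

theorem norm_storedVector : ‖storedVector x y Φ c‖ = eta x Φ c := by
  refine (pow_left_inj₀ (norm_nonneg _) eta_nonneg two_ne_zero).1 ?_
  rw [eta_sq, EuclideanSpace.norm_sq_eq, Finset.sum_div]
  refine Finset.sum_congr rfl fun j _ => ?_
  rw [storedVector]
  simp only [Real.norm_eq_abs, sq_abs, mul_pow, div_pow]
  rw [label_sq, bit_sq, Real.sq_sqrt (Nat.cast_nonneg m)]
  ring

/-- The inequality of the arithmetic and the quadratic mean. -/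
theorem norm_featureSum_le_eta : ‖featureSum x y Φ c‖ ≤ eta x Φ c := by
  refine Real.le_sqrt_of_sq_le ?_
  have h1 : ‖∑ j, (bit (c j) * label (y j)) • Φ (x j)‖ ≤ ∑ j, bit (c j) * ‖Φ (x j)‖ := by
    refine (norm_sum_le _ _).trans (Finset.sum_le_sum fun j _ => ?_)
    rw [norm_smul, Real.norm_eq_abs, abs_mul, abs_label, mul_one, abs_of_nonneg (bit_nonneg _)]
  have h2 := sq_sum_le_card_mul_sum_sq (s := Finset.univ) (f := fun j => bit (c j) * ‖Φ (x j)‖)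
  simp only [mul_pow, bit_sq, Finset.card_univ, Fintype.card_fin] at h2
  rw [featureSum, norm_smul, mul_pow, norm_div, norm_one, Real.norm_natCast]
  by_cases hm : m = 0
  · subst hm
    simp
  have hm' : (0 : ℝ) < m := by positivity
  have h3 := (pow_le_pow_left₀ (norm_nonneg _) h1 2).trans h2
  calc (1 / (m : ℝ)) ^ 2 * ‖∑ j, (bit (c j) * label (y j)) • Φ (x j)‖ ^ 2
      ≤ (1 / (m : ℝ)) ^ 2 * (m * ∑ j, bit (c j) * ‖Φ (x j)‖ ^ 2) :=
        mul_le_mul_of_nonneg_left h3 (by positivity)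
    _ = (∑ j, bit (c j) * ‖Φ (x j)‖ ^ 2) / m := by field_simp

theorem norm_le_maxNorm (j : Fin m) : ‖Φ (x j)‖ ≤ maxNorm x Φ i :=
  Finset.le_sup' (fun j => ‖Φ (x j)‖) (Finset.mem_univ j)

theorem eta_le_maxNorm : eta x Φ c ≤ maxNorm x Φ i := by
  have hR : 0 ≤ maxNorm x Φ i := (norm_nonneg _).trans (norm_le_maxNorm i)
  have hm : (0 : ℝ) < m := by exact_mod_cast (Nat.zero_le _).trans_lt i.2
  refine Real.sqrt_le_iff.2 ⟨hR, ?_⟩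
  rw [div_le_iff₀ hm]
  calc ∑ j, bit (c j) * ‖Φ (x j)‖ ^ 2 ≤ ∑ _j : Fin m, maxNorm x Φ i ^ 2 := by
        refine Finset.sum_le_sum fun j _ => ?_
        have h1 := pow_le_pow_left₀ (norm_nonneg _) (norm_le_maxNorm (x := x) (Φ := Φ) (i := i) j) 2
        have h2 := mul_le_of_le_one_left (sq_nonneg ‖Φ (x j)‖) (bit_le_one (c j))
        linarith
    _ = maxNorm x Φ i ^ 2 * m := by simp [mul_comm]

theorem one_div_sqrt_two_pow (k : ℕ) : (1 / Real.sqrt 2) ^ k = (Real.sqrt (2 ^ k))⁻¹ := by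
  have h : Real.sqrt (2 ^ k) = Real.sqrt 2 ^ k := by
    have : (2 : ℝ) ^ k = (Real.sqrt 2 ^ k) ^ 2 := by
      rw [← pow_mul, mul_comm, pow_mul, Real.sq_sqrt (by norm_num)]
    rw [this, Real.sqrt_sq (by positivity)]
  rw [h, div_pow, one_pow, one_div]

/-- The overlap of the two prepared states is the inner product to be estimated, up to a factor. -/
theorem overlap_storedVector (l : ℕ) : overlap l x Φ (storedVector x y Φ c) i =
    Real.sqrt m * inner ℝ (featureSum x y Φ c) (Φ (x i)) / (eta x Φ c * ‖Φ (x i)‖) *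
      (Real.sqrt (2 ^ (l + 2)))⁻¹ := by
  have hm : (0 : ℝ) < m := by exact_mod_cast (Nat.zero_le _).trans_lt i.2
  have hs : Real.sqrt m * Real.sqrt m = m := Real.mul_self_sqrt hm.le
  have hs0 : Real.sqrt m ≠ 0 := (Real.sqrt_pos.2 hm).ne'
  rw [overlap, ← one_div_sqrt_two_pow, norm_storedVector, featureSum, real_inner_smul_left,
    sum_inner, Finset.mul_sum, Finset.mul_sum, Finset.sum_div, Finset.sum_mul]
  refine Finset.sum_congr rfl fun j _ => ?_
  rw [real_inner_smul_left, ← Finset.sum_mul]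
  congr 1
  have e : ∀ b, storedVector x y Φ c j / eta x Φ c * (Φ (x j) b / ‖Φ (x j)‖) *
      (Φ (x i) b / ‖Φ (x i)‖) = Real.sqrt m * (1 / m) * (bit (c j) * label (y j)) /
        (eta x Φ c * ‖Φ (x i)‖) * (Φ (x j) b * Φ (x i) b) := by
    intro b
    rw [storedVector]
    simp only
    by_cases h0 : Φ (x j) = 0
    · simp [h0]
    · have h1 : ‖Φ (x j)‖ ≠ 0 := norm_ne_zero_iff.2 h0
      have e1 : Real.sqrt m * (1 / m) = 1 / Real.sqrt m := by
        rw [eq_div_iff hs0]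
        calc Real.sqrt m * (1 / m) * Real.sqrt m = Real.sqrt m * Real.sqrt m * (1 / m) := by ring
          _ = 1 := by rw [hs, mul_one_div_cancel hm.ne']
      rw [e1]
      field_simp
  simp only [e]
  rw [← Finset.mul_sum, PiLp.inner_apply]
  simp only [RCLike.inner_apply, conj_trivial]
  rw [Finset.sum_congr rfl fun b _ => mul_comm (Φ (x j) b) (Φ (x i) b)]
  ring

theorem abs_inner_le : |inner ℝ (featureSum x y Φ c) (Φ (x i))| ≤ eta x Φ c * ‖Φ (x i)‖ :=
  (abs_real_inner_le_norm _ _).trans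
    (mul_le_mul_of_nonneg_right norm_featureSum_le_eta (norm_nonneg _))

theorem abs_overlap_le {l : ℕ} (hl : m ≤ 2 ^ l) :
    |overlap l x Φ (storedVector x y Φ c) i| ≤ 1 / 2 := by
  rw [overlap_storedVector, abs_mul, abs_div, abs_mul, abs_of_nonneg (Real.sqrt_nonneg _),
    abs_of_nonneg (mul_nonneg eta_nonneg (norm_nonneg _)), abs_inv,
    abs_of_nonneg (Real.sqrt_nonneg _), mul_div_assoc]
  have h1 : |inner ℝ (featureSum x y Φ c) (Φ (x i))| / (eta x Φ c * ‖Φ (x i)‖) ≤ 1 :=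
    div_le_one_of_le₀ abs_inner_le (mul_nonneg eta_nonneg (norm_nonneg _))
  have h2 : Real.sqrt m * (Real.sqrt (2 ^ (l + 2)))⁻¹ ≤ 1 / 2 := by
    rw [← div_eq_mul_inv, div_le_iff₀ (by positivity)]
    have h3 : Real.sqrt (2 ^ (l + 2)) = Real.sqrt (2 ^ l) * 2 := by
      rw [pow_add, Real.sqrt_mul (by positivity)]
      congr 1
      rw [Real.sqrt_eq_iff_mul_self_eq] <;> norm_num
    rw [h3]
    have : Real.sqrt m ≤ Real.sqrt (2 ^ l) := Real.sqrt_le_sqrt (by exact_mod_cast hl)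
    linarith
  calc _ ≤ Real.sqrt m * 1 * (Real.sqrt (2 ^ (l + 2)))⁻¹ := by gcongr
    _ ≤ 1 / 2 := by rwa [mul_one]

/-- The inner product to be estimated, in terms of the overlap. -/
theorem mul_overlap {l : ℕ} (hη : eta x Φ c ≠ 0) (hi : Φ (x i) ≠ 0) :
    eta x Φ c * (‖Φ (x i)‖ * label (y i) * Real.sqrt (4 * 2 ^ l / m)) *
        overlap l x Φ (storedVector x y Φ c) i =
      inner ℝ (featureSum x y Φ c) (label (y i) • Φ (x i)) := by
  have hm : (0 : ℝ) < m := by exact_mod_cast (Nat.zero_le _).trans_lt i.2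
  have h1 : Real.sqrt (4 * 2 ^ l / m) = Real.sqrt (2 ^ (l + 2)) / Real.sqrt m := by
    rw [← Real.sqrt_div (by positivity)]
    congr 2
    ring
  have hs0 : Real.sqrt m ≠ 0 := (Real.sqrt_pos.2 hm).ne'
  have hs1 : Real.sqrt (2 ^ (l + 2)) ≠ 0 := (Real.sqrt_pos.2 (by positivity)).ne'
  have hi' : ‖Φ (x i)‖ ≠ 0 := norm_ne_zero_iff.2 hi
  rw [overlap_storedVector, h1, real_inner_smul_right]
  field_simp

theorem storedVector_eq_zero (j : Fin m) (h : Φ (x j) = 0) : storedVector x y Φ c j = 0 := by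
  simp [storedVector, h]

end Vectors

/-! ### Choice of the number of rounds and trials, and the running time -/

section Time

/-- The number of passages of a loop that multiplies `y` by `r` until it reaches `b`. -/
theorem exists_pow_ge {b r y : ℝ} (hr : 1 < r) (hy : 0 < y) (hb : y < b) :
    ∃ k : ℕ, 1 ≤ k ∧ (∀ j < k, y * r ^ j < b) ∧ b ≤ y * r ^ k ∧ y * r ^ k < r * b := by
  classical
  have h : ∃ k : ℕ, b ≤ y * r ^ k := by
    obtain ⟨k, hk⟩ := pow_unbounded_of_one_lt (b / y) hr
    exact ⟨k, by rw [mul_comm]; exact ((div_lt_iff₀ hy).1 hk).le⟩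
  have h0 : 1 ≤ Nat.find h := by
    rw [Nat.one_le_iff_ne_zero]
    intro e
    have := Nat.find_spec h
    rw [e, pow_zero, mul_one] at this
    linarith
  refine ⟨Nat.find h, h0, fun j hj => not_le.1 (Nat.find_min h hj), Nat.find_spec h, ?_⟩
  obtain ⟨k, hk⟩ : ∃ k, Nat.find h = k + 1 := ⟨Nat.find h - 1, by omega⟩
  have h1 := not_le.1 (Nat.find_min h (m := k) (by omega))
  rw [hk, pow_succ]
  nlinarith

theorem log_clog_le {m : ℕ} (hm : 1 ≤ m) : (Nat.clog 2 m : ℝ) ≤ 1 + 2 * Real.log m := by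
  rcases hm.eq_or_lt with rfl | hm
  · simp
  · have h1 : 2 ^ (Nat.clog 2 m).pred < m := Nat.pow_pred_clog_lt_self (by norm_num) hm
    have h2 : ((Nat.clog 2 m).pred : ℝ) * Real.log 2 ≤ Real.log m := by
      rw [← Real.log_pow]
      exact Real.log_le_log (by positivity) (by exact_mod_cast h1.le)
    have h3 : (Nat.clog 2 m : ℝ) ≤ (Nat.clog 2 m).pred + 1 := by
      exact_mod_cast (by rw [Nat.pred_eq_sub_one]; omega :
        Nat.clog 2 m ≤ (Nat.clog 2 m).pred + 1)
    have h4 := Real.log_two_gt_d9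
    have h5 : (0 : ℝ) ≤ (Nat.clog 2 m).pred := Nat.cast_nonneg _
    nlinarith

end Time

/-! ### Correctness of the program within the required time -/

section Final

/-- The arithmetic of the running time: `D` is the time of a step of the walk, `k` the number of
trials in a round, `P` the largest power of the walk operator, `b` the inverse of the precision, `r`
the factor `max 1 (log (1 / δ))` and `L` the logarithm in the bound. -/
theorem total_time_le {A q F r T L b w l h k P D : ℝ} {κ : ℕ} (hL : 1 ≤ L) (hl : l ≤ 3 * L)
    (hh : h ≤ 2 * F) (hF : 1 ≤ F) (hq : q ≤ |A| * (2 * L) ^ κ) (hr : 1 ≤ r) (hw : 1 ≤ w)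
    (hb : 1 ≤ b) (hT : r * b * w * F ≤ 8 * T) (hk : k ≤ 223 * (r * L)) (hP0 : 0 ≤ P)
    (hP : P ≤ 2 * b) (hD0 : 0 ≤ D) (hD : D = 40 * (l + h) + 80 + 6 * q + 2 * F) :
    3 * l + 9 + w * (2 * k * (D + 2) * P + 5) ≤
      (7136 * (300 + 6 * |A| * 2 ^ κ) + 100) * (1 + T) * L ^ (κ + 2) := by
  set M := L ^ (κ + 1) with hM
  set K := 300 + 6 * |A| * 2 ^ κ with hK
  have hA := abs_nonneg A
  have hLM : L ≤ M := le_self_pow₀ hL (by omega)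
  have hM1 : 1 ≤ M := hL.trans hLM
  have hκM : L ^ κ ≤ M := pow_le_pow_right₀ hL (by omega)
  have hMF : M ≤ F * M := le_mul_of_one_le_left (by linarith) hF
  have hFM : F ≤ F * M := le_mul_of_one_le_right (by linarith) hM1
  have hK0 : 0 ≤ K := by positivity
  have hD' : D + 2 ≤ K * (F * M) := by
    have h1 : q ≤ |A| * 2 ^ κ * (F * M) := by
      refine hq.trans ?_
      rw [mul_pow, ← mul_assoc]
      exact mul_le_mul_of_nonneg_left (hκM.trans hMF) (by positivity)
    rw [hD, hK]
    linarith
  have hwT : w ≤ 8 * T := by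
    refine le_trans ?_ hT
    have h1 : 1 ≤ r * b := one_le_mul_of_one_le_of_one_le hr hb
    calc w ≤ r * b * w := le_mul_of_one_le_left (by linarith) h1
      _ ≤ r * b * w * F := le_mul_of_one_le_right (by positivity) hF
  have hT0 : 0 ≤ T := by linarith
  have hmain : w * (2 * k * (D + 2) * P) ≤ 7136 * K * T * L ^ (κ + 2) := by
    calc w * (2 * k * (D + 2) * P)
        ≤ w * (2 * (223 * (r * L)) * (K * (F * M)) * (2 * b)) := by gcongr
      _ = 892 * K * (L * M) * (r * b * w * F) := by ring
      _ ≤ 892 * K * (L * M) * (8 * T) := by gcongr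
      _ = 7136 * K * T * L ^ (κ + 2) := by
        rw [hM]
        ring
  have hL2 : 1 ≤ L ^ (κ + 2) := one_le_pow₀ hL
  have hL3 : L ≤ L ^ (κ + 2) := le_self_pow₀ hL (by omega)
  have h5 : T ≤ T * L ^ (κ + 2) := le_mul_of_one_le_right hT0 hL2
  have h6 : 0 ≤ K * L ^ (κ + 2) := by positivity
  linarith

/-- The number of trials is logarithmic in the inverse of the error probability. -/
theorem trials_le {k : ℕ} {y : ℝ} (hy : 0 < y) (hy1 : y ≤ 1) (h : y * (37 / 36) ^ k < 37 / 36) :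
    (k : ℝ) ≤ 1 + 37 * Real.log (1 / y) := by
  have h1 : (1 : ℝ) / 37 ≤ Real.log (37 / 36) := by
    have := Real.one_sub_inv_le_log_of_pos (show (0 : ℝ) < 37 / 36 by norm_num)
    norm_num at this ⊢
    exact this
  have h2 : Real.log (y * (37 / 36) ^ k) ≤ Real.log (37 / 36) :=
    Real.log_le_log (by positivity) h.le
  rw [Real.log_mul hy.ne' (by positivity), Real.log_pow] at h2
  rw [one_div, Real.log_inv]
  have h3 := Real.log_nonpos hy.le hy1
  by_cases hk : (k : ℝ) ≤ 1
  · linarith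
  · push Not at hk
    nlinarith

variable {l n N m w i : ℕ} {C ε δ R yi nu : ℝ} {α η : Fin w → ℝ}

theorem inputMem_alpha (t : Fin w) :
    (inputMem l n N m w i C ε δ R yi nu α η).real (6 + 2 * t) = α t := by
  have h1 : (2 * (t : ℕ)) / 2 = t := by omega
  rw [add_comm]
  simp [inputMem]

theorem inputMem_eta (t : Fin w) :
    (inputMem l n N m w i C ε δ R yi nu α η).real (7 + 2 * t) = η t := by
  have h1 : (2 * (t : ℕ) + 1) / 2 = t := by omega
  have e : 7 + 2 * (t : ℕ) = 2 * t + 1 + 6 := by ring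
  rw [e]
  simp [inputMem, h1]

theorem sees_inputMem : Sees (inputMem l n N m w i C ε δ R yi nu α η) 0 0 0 (fun _ => 0)
    (inputMem l n N m w i C ε δ R yi nu α η) := by
  refine ⟨fun _ _ => rfl, rfl, rfl, rfl, funext fun j => ?_⟩
  split_ifs with h
  · rfl
  · change ¬ j < 6 + 2 * w at h
    obtain ⟨a, rfl⟩ : ∃ a, j = a + 6 := ⟨j - 6, by omega⟩
    have : ¬ a / 2 < w := by omega
    simp [inputMem, this]

theorem nsq_start {Q : ℕ} (M : Mem) : nsq (start Q M).state = 1 := by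
  simp only [nsq, start]
  rw [Finset.sum_eq_single (zeros (Fin Q))] <;> simp +contextual

theorem fresh_start {Q : ℕ} (M : Mem) : Fresh 0 (start Q M).state := by
  intro r _ b hb
  simp only [start] at hb
  have : b = zeros (Fin Q) := by
    by_contra h
    simp [h] at hb
  rw [this, zeros]

end Final

section Final

/-- The total error that is caused by the errors of the phases. -/
theorem sum_error_le {w l m : ℕ} {J : ℕ} {α η : Fin w → ℝ} {C R nu u ε : ℝ} (hα : ∀ t, 0 ≤ α t)
    (hC : ∑ t, α t ≤ C) (hη : ∀ t, 0 ≤ η t) (hηR : ∀ t, η t ≤ R) (hR : 0 ≤ R) (hnu : 0 ≤ nu)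
    (hu : |u| = 1) (hε : 0 < ε) (hm : 1 ≤ m) (hl : 2 ^ l ≤ 2 * m)
    (hb : 8 * (C * R * nu) / ε ≤ 2 ^ J) :
    ∑ t, |α t * η t * (nu * u * Real.sqrt (4 * 2 ^ l / m))| * (Real.pi / (2 * 2 ^ J)) ≤ ε := by
  have hm' : (0 : ℝ) < m := by exact_mod_cast hm
  have h1 : Real.sqrt (4 * 2 ^ l / m) ≤ 3 := by
    rw [Real.sqrt_le_left (by norm_num), div_le_iff₀ hm']
    have : (2 : ℝ) ^ l ≤ 2 * m := by exact_mod_cast hl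
    linarith
  have h2 : Real.pi / (2 * 2 ^ J) ≤ 2 / 2 ^ J := by
    rw [div_le_div_iff₀ (by positivity) (by positivity)]
    have := Real.pi_le_four
    have h3 : (0 : ℝ) < 2 ^ J := by positivity
    nlinarith
  have h4 : ∀ t, |α t * η t * (nu * u * Real.sqrt (4 * 2 ^ l / m))| * (Real.pi / (2 * 2 ^ J)) ≤
      α t * (R * (nu * 3) * (2 / 2 ^ J)) := by
    intro t
    have hπ := Real.pi_pos
    rw [abs_mul, abs_mul, abs_mul, abs_mul, hu, abs_of_nonneg (hα t), abs_of_nonneg (hη t),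
      abs_of_nonneg hnu, abs_of_nonneg (Real.sqrt_nonneg _), mul_one]
    calc α t * η t * (nu * Real.sqrt (4 * 2 ^ l / m)) * (Real.pi / (2 * 2 ^ J))
        ≤ α t * R * (nu * 3) * (2 / 2 ^ J) := by
          have := hα t
          have := hη t
          have := hηR t
          gcongr
      _ = _ := by ring
  -- in total the errors are at most `6 * (C * R * nu) / 2 ^ J`
  refine (Finset.sum_le_sum fun t _ => h4 t).trans ?_
  rw [← Finset.sum_mul]
  have h5 : 0 ≤ R * (nu * 3) * (2 / 2 ^ J) := by positivity
  refine (mul_le_mul_of_nonneg_right hC h5).trans ?_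
  have h6 : (0 : ℝ) < 2 ^ J := by positivity
  have e : C * (R * (nu * 3) * (2 / 2 ^ J)) = 6 * (C * R * nu) / 2 ^ J := by ring
  rw [e, div_le_iff₀ h6]
  rw [div_le_iff₀ hε] at hb
  nlinarith

/-- The logarithm that appears in the bound of the running time dominates the other logarithms. -/
theorem log_bounds {m d T : ℝ} (hm : 1 ≤ m) (hd : 0 ≤ d) (hT : 0 ≤ T) :
    1 ≤ Real.log (3 + m + d + T) ∧ Real.log m ≤ Real.log (3 + m + d + T) ∧
      0 ≤ Real.log (2 + m * d) ∧ Real.log (2 + m * d) ≤ 2 * Real.log (3 + m + d + T) ∧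
      (0 < T → Real.log T ≤ Real.log (3 + m + d + T)) := by
  have hmd : 0 ≤ m * d := by positivity
  refine ⟨?_, Real.log_le_log (by linarith) (by linarith), Real.log_nonneg (by linarith), ?_,
    fun h => Real.log_le_log h (by linarith)⟩
  · rw [Real.le_log_iff_exp_le (by linarith)]
    linarith [Real.exp_one_lt_d9]
  · have e : 2 * Real.log (3 + m + d + T) = Real.log ((3 + m + d + T) ^ 2) := by
      rw [Real.log_pow]
      norm_num
    rw [e]
    exact Real.log_le_log (by linarith) (by nlinarith)

theorem two_pow_clog_le {m : ℕ} (hm : 1 ≤ m) : 2 ^ Nat.clog 2 m ≤ 2 * m := by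
  rcases hm.eq_or_lt with rfl | hm
  · simp
  · have h1 : 2 ^ (Nat.clog 2 m).pred < m := Nat.pow_pred_clog_lt_self (by norm_num) hm
    have h2 : 0 < Nat.clog 2 m := Nat.clog_pos (by norm_num) hm
    obtain ⟨k, hk⟩ : ∃ k, Nat.clog 2 m = k + 1 := ⟨Nat.clog 2 m - 1, by omega⟩
    rw [hk, Nat.pred_succ] at h1
    rw [hk, pow_succ]
    omega

end Final

section Final

/-- The number of trials in a round, in terms of the logarithm in the bound of the running time: the
tolerance is `δ` divided by a multiple of `T`. -/
theorem trials_le_log {M : ℕ} {y δ w b T L : ℝ} (hδ : 0 < δ) (hwb : 0 < 4 * w * b)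
    (hy : y = δ / (4 * w * b)) (hy0 : 0 < y) (hy1 : y ≤ 1) (hM : y * (37 / 36) ^ M < 37 / 36)
    (hwbT : w * b ≤ 8 * T) (hL : 1 ≤ L) (hLT : 0 < T → Real.log T ≤ L) :
    (M : ℝ) ≤ 223 * (max 1 (Real.log (1 / δ)) * L) := by
  have hT : 0 < T := by linarith
  refine (trials_le hy0 hy1 hM).trans ?_
  have hr := le_max_left 1 (Real.log (1 / δ))
  have h1 : Real.log (1 / y) ≤ max 1 (Real.log (1 / δ)) + (4 + L) := by
    have e1 : 1 / y = 1 / δ * (4 * w * b) := by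
      rw [hy, one_div_div, div_eq_inv_mul, one_div]
    rw [e1, Real.log_mul (by positivity) hwb.ne']
    refine add_le_add (le_max_right _ _) ?_
    have h2 : Real.log (4 * w * b) ≤ Real.log (2 ^ 5 * T) := Real.log_le_log hwb (by linarith)
    rw [Real.log_mul (by norm_num) hT.ne', Real.log_pow] at h2
    have h3 := Real.log_two_lt_d9
    have h4 := hLT hT
    push_cast at h2
    linarith
  have h5 : max 1 (Real.log (1 / δ)) ≤ max 1 (Real.log (1 / δ)) * L :=
    le_mul_of_one_le_right (by linarith) hL
  have h6 : L ≤ max 1 (Real.log (1 / δ)) * L := le_mul_of_one_le_left (by linarith) hr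
  linarith

/-- The program answers correctly with the required probability and within the required time. -/
theorem leads_answer {m n d N l : ℕ} {x : Fin m → Bits n} {y : Fin m → ℤˣ}
    {Φ : Bits n → EuclideanSpace ℝ (Bits N)} {W : Finset (Bits m)} (hW : W.Nonempty)
    (e : Fin W.card ≃ W) {α : Bits m → ℝ} {C ε δ : ℝ} {i : Fin m} {B : BlackBoxes l n N W.card}
    {A : ℝ} {κ : ℕ} (hml : m ≤ 2 ^ l) (hlm : 2 ^ l ≤ 2 * m) (hlog : (l : ℝ) ≤ 1 + 2 * Real.log m)
    (hα : ∀ c ∈ W, 0 ≤ α c) (hC : ∑ c ∈ W, α c ≤ C) (hΨ : ∀ c ∈ W, featureSum x y Φ c ≠ 0)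
    (hε : 0 < ε) (hδ : 0 < δ) (hδ1 : δ < 1) (hload : LoadsData B.load x)
    (hprep : ∀ t, PreparesVector (B.prep t) (storedVector x y Φ (e t))) (hq0 : 0 ≤ B.queryTime)
    (hq : B.queryTime ≤ A * Real.log (2 + m * d) ^ κ) (hfeat : IsQuantumFeatureMap B.feat Φ)
    (hF : 1 ≤ B.featTime) (hnN : ((n + N : ℕ) : ℝ) ≤ 2 * B.featTime) {R Ψmin T : ℝ}
    (hR : R = maxNorm x Φ i) (hΨmin : Ψmin = W.inf' hW fun c => ‖featureSum x y Φ c‖)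
    (hT : T = max 1 (Real.log (1 / δ)) / ε * (C * R ^ 3 * W.card / Ψmin) * B.featTime) :
    ∃ f : Branch (W.card * (2 * (l + n + (N + 3)) + 2)) → ℝ, Leads B mainP
      (start _ (inputMem l n N m W.card i C ε δ R (label (y i)) ‖Φ (x i)‖ (fun t => α (e t))
        fun t => eta x Φ (e t)))
      (fun s => s.time ≤ (7136 * (300 + 6 * |A| * 2 ^ κ) + 100) * (1 + T) *
          Real.log (3 + m + d + T) ^ (κ + 2) ∧
        f s ≤ if |s.mem.real 0 - ∑ c ∈ W, α c *
          inner ℝ (featureSum x y Φ c) (label (y i) • Φ (x i))| ≤ ε then s.weight else 0)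
      f (1 - δ) := by
  have hm : 1 ≤ m := (Nat.zero_le _).trans_lt i.2
  have hmR : (1 : ℝ) ≤ m := by exact_mod_cast hm
  have hw1 : (1 : ℝ) ≤ W.card := by exact_mod_cast hW.card_pos
  have hnuR : ‖Φ (x i)‖ ≤ R := hR ▸ norm_le_maxNorm i
  have hR0 : 0 ≤ R := (norm_nonneg _).trans hnuR
  have hC0 : 0 ≤ C := (Finset.sum_nonneg hα).trans hC
  have hΨpos : 0 < Ψmin := by
    rw [hΨmin, Finset.lt_inf'_iff]
    exact fun c hc => norm_pos_iff.2 (hΨ c hc)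
  have hΨR : Ψmin ≤ R := by
    obtain ⟨c, hc⟩ := hW
    rw [hΨmin, hR]
    exact (Finset.inf'_le _ hc).trans (norm_featureSum_le_eta.trans eta_le_maxNorm)
  have hr1 : 1 ≤ max 1 (Real.log (1 / δ)) := le_max_left _ _
  have hT0 : 0 ≤ T := by
    rw [hT]
    positivity
  obtain ⟨hL1, hLm, hLd0, hLd, hLT⟩ := log_bounds hmR (Nat.cast_nonneg d) hT0
  set Λ := Real.log (3 + m + d + T) with hΛ
  set I := inputMem l (n) N m W.card i C ε δ R (label (y i)) ‖Φ (x i)‖ (fun t => α (e t))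
    (fun t => eta x Φ (e t)) with hI
  set Q := W.card * (2 * (l + n + (N + 3)) + 2) with hQ
  set S := ∑ c ∈ W, α c * inner ℝ (featureSum x y Φ c) (label (y i) • Φ (x i)) with hS
  have hKpos : (100 : ℝ) ≤ 7136 * (300 + 6 * |A| * 2 ^ κ) + 100 := by
    have : (0 : ℝ) ≤ 7136 * (300 + 6 * |A| * 2 ^ κ) := by positivity
    linarith
  have hs := sees_inputMem (l := l) (n := n) (N := N) (m := m) (w := W.card) (i := i) (C := C)
    (ε := ε) (δ := δ) (R := R) (yi := label (y i)) (nu := ‖Φ (x i)‖) (α := fun t => α (e t))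
    (η := fun t => eta x Φ (e t))
  by_cases hcase : C * R * ‖Φ (x i)‖ ≤ ε
  · -- every inner product is small, and the answer `0` is good enough
    refine ⟨fun u => nsq u.state, (leads_main_of_le (s := start Q I) hs hcase).mono ?_ ?_⟩
    · rw [nsq_start]
      linarith
    · rintro u ⟨hu, huT⟩
      refine ⟨⟨?_, ?_⟩, le_rfl⟩
      · have h0 : (start Q I).time = 0 := rfl
        have h1 : 1 ≤ Λ ^ (κ + 2) := one_le_pow₀ hL1
        have h2 : (100 : ℝ) ≤ (7136 * (300 + 6 * |A| * 2 ^ κ) + 100) * (1 + T) := by nlinarith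
        nlinarith
      · have h1 : |S| ≤ ε := by
          refine le_trans ?_ hcase
          refine (Finset.abs_sum_le_sum_abs _ _).trans ?_
          have h2 : ∀ c ∈ W, |α c * inner ℝ (featureSum x y Φ c) (label (y i) • Φ (x i))| ≤
              α c * (R * ‖Φ (x i)‖) := by
            intro c hc
            rw [abs_mul, abs_of_nonneg (hα c hc), real_inner_smul_right, abs_mul, abs_label,
              one_mul]
            refine mul_le_mul_of_nonneg_left (abs_inner_le.trans ?_) (hα c hc)
            exact mul_le_mul_of_nonneg_right (hR ▸ eta_le_maxNorm) (norm_nonneg _)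
          refine (Finset.sum_le_sum h2).trans ?_
          rw [← Finset.sum_mul, mul_assoc]
          exact mul_le_mul_of_nonneg_right hC (by positivity)
        rw [hu, zero_sub, abs_neg, if_pos h1]
        exact le_rfl
  · push Not at hcase
    -- in particular the feature vector of the datum `i` does not vanish
    have hi : Φ (x i) ≠ 0 := by
      intro h
      rw [h, norm_zero, mul_zero] at hcase
      linarith
    have hb : precision I = 8 * (C * R * ‖Φ (x i)‖) / ε := rfl
    have hb1 : 8 < precision I := by
      rw [hb, lt_div_iff₀ hε]
      linarith
    have hy : tolerance I = δ / (4 * W.card * precision I) := rfl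
    have hwb : 0 < 4 * W.card * precision I := by positivity
    have hy0 : 0 < tolerance I := by
      rw [hy]
      positivity
    have hy1 : tolerance I < 1 := by
      rw [hy, div_lt_one hwb]
      nlinarith
    obtain ⟨J, -, hJ, hJ', hJ2⟩ := exists_pow_ge (b := precision I) (r := 2) (y := 1)
      (by norm_num) (by norm_num) (by linarith)
    simp only [one_mul] at hJ hJ' hJ2
    obtain ⟨M, hM0, hM, hM', hM2⟩ := exists_pow_ge (b := 1) (r := 37 / 36) (y := tolerance I)
      (by norm_num) hy0 hy1
    rw [mul_one] at hM2
    have hJ3 : (J : ℝ) + 1 ≤ 2 * precision I := by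
      have : J + 1 ≤ 2 ^ J := Nat.lt_two_pow_self
      have h2 : (J : ℝ) + 1 ≤ 2 ^ J := by exact_mod_cast this
      linarith
    -- there are `J + 1 ≤ 2 ^ J ≤ 2 * precision I` rounds for each vector
    have hfail : 2 * tolerance I * (J + 1) * W.card ≤ δ := by
      calc 2 * tolerance I * (J + 1) * W.card ≤
          2 * tolerance I * (2 * precision I) * W.card := by gcongr
        _ = tolerance I * (4 * W.card * precision I) := by ring
        _ = δ := by rw [hy, div_mul_cancel₀ _ hwb.ne']
    have hB : walkTime B = 40 * ((l : ℝ) + (n + N : ℕ)) + 80 + 6 * B.queryTime +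
        2 * B.featTime := by
      rw [walkTime]
      push_cast
      ring
    have hB80 : 80 ≤ walkTime B := by
      rw [hB]
      have : (0 : ℝ) ≤ (l : ℝ) + (n + N : ℕ) := by positivity
      linarith
    have hbnd := leads_main (I := I) (i := i) (B := B) (x := x) (Φ := Φ) (Q := Q)
      (X := fun t => ⟨⟨B.load, hload.1⟩, ⟨B.prep t, (hprep t).1⟩, ⟨B.feat, hfeat.1⟩⟩)
      (vec := fun t => storedVector x y Φ (e t)) ⟨rfl, rfl, rfl, rfl⟩ rfl
      (fun t => ⟨rfl, rfl, rfl⟩)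
      (fun t => ⟨hload, hprep t, hfeat, fun j => storedVector_eq_zero j⟩) hi
      (fun t => abs_overlap_le hml) le_rfl (s := start Q I) hs
      (fresh_start I) hcase hy0 hM0 hM hM' hJ hJ' (by linarith) hB80
    refine ⟨_, hbnd.mono ?_ fun u hu => ⟨⟨hu.trans ?_, ?_⟩, le_rfl⟩⟩
    · rw [nsq_start]
      linarith
    · have h0 : (start Q I).time = 0 := rfl
      rw [h0, zero_add]
      have hT8 : max 1 (Real.log (1 / δ)) * precision I * W.card * B.featTime ≤ 8 * T := by
        -- the quotient `R / Ψmin` is at least one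
        have h1 : C * R * ‖Φ (x i)‖ * W.card ≤ C * R ^ 3 * W.card / Ψmin := by
          rw [le_div_iff₀ hΨpos]
          calc C * R * ‖Φ (x i)‖ * W.card * Ψmin ≤ C * R * R * W.card * R := by gcongr
            _ = C * R ^ 3 * W.card := by ring
        rw [hT, hb]
        calc max 1 (Real.log (1 / δ)) * (8 * (C * R * ‖Φ (x i)‖) / ε) * W.card * B.featTime
            = 8 * (max 1 (Real.log (1 / δ)) / ε * (C * R * ‖Φ (x i)‖ * W.card) * B.featTime) := by
              ring
          _ ≤ 8 * (max 1 (Real.log (1 / δ)) / ε * (C * R ^ 3 * W.card / Ψmin) * B.featTime) := by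
              gcongr
      have hwbT : W.card * precision I ≤ 8 * T := by
        refine le_trans ?_ hT8
        have h1 : 1 ≤ max 1 (Real.log (1 / δ)) * B.featTime :=
          one_le_mul_of_one_le_of_one_le hr1 hF
        calc W.card * precision I ≤
            max 1 (Real.log (1 / δ)) * B.featTime * (W.card * precision I) :=
              le_mul_of_one_le_left (by positivity) h1
          _ = _ := by ring
      have hMle := trials_le_log hδ (by linarith) hy hy0 hy1.le hM2 hwbT hL1 hLT
      refine total_time_le hL1 (l := l) (h := (n + N : ℕ)) (q := B.queryTime)
        (F := B.featTime) (by linarith [hlog]) hnN hF ?_ hr1 hw1 (by linarith) hT8 hMle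
        (by positivity) hJ2.le (by linarith) hB
      refine hq.trans ?_
      exact mul_le_mul (le_abs_self A) (pow_le_pow_left₀ hLd0 hLd κ) (pow_nonneg hLd0 κ)
        (abs_nonneg A)
    · have hfac : factor l I = ‖Φ (x i)‖ * label (y i) * Real.sqrt (4 * 2 ^ l / m) := rfl
      have hsumW : ∀ g : Bits m → ℝ, ∑ c ∈ W, g c = ∑ t, g (e t) := fun g => by
        rw [← Finset.sum_coe_sort W g, ← e.sum_comp]
      have h1 : ∑ t : Fin W.card, I.real (6 + 2 * t) * I.real (7 + 2 * t) * factor l I *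
          overlap l x Φ (storedVector x y Φ (e t)) i = S := by
        rw [hS, hsumW]
        refine Finset.sum_congr rfl fun t _ => ?_
        have hη : eta x Φ (e t : Bits m) ≠ 0 :=
          ((norm_pos_iff.2 (hΨ _ (e t).2)).trans_le norm_featureSum_le_eta).ne'
        rw [hI, inputMem_alpha, inputMem_eta, ← hI, hfac, ← mul_overlap hη hi]
        ring
      have h2 : ∑ t : Fin W.card, |I.real (6 + 2 * t) * I.real (7 + 2 * t) * factor l I| *
          (Real.pi / (2 * 2 ^ J)) ≤ ε := by
        rw [hfac, hI]
        simp only [inputMem_alpha, inputMem_eta]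
        refine sum_error_le (fun t => hα _ (e t).2) (by rw [← hsumW α]; exact hC)
          (fun t => eta_nonneg) (fun t => hR ▸ eta_le_maxNorm) hR0 (norm_nonneg _)
          (abs_label _) hε hm hlm hJ'
      rw [h1]
      split_ifs with h3 h4 h4
      · exact le_rfl
      · exact absurd (h3.trans h2) h4
      · exact nsq_nonneg _
      · exact le_rfl

end Final

theorem mainTheorem5 :
    ∃ P : Program, ∀ (A : ℝ) (κ : ℕ), ∃ (K : ℝ) (p : ℕ),
      ∀ (m d k N : ℕ)
        -- the data set and the feature map
        (x : Fin m → Bits (d * k)) (y : Fin m → ℤˣ)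
        (Φ : Bits (d * k) → EuclideanSpace ℝ (Bits N))
        -- the set `W`, an enumeration of it, the coefficients and the index `i`
        (W : Finset (Bits m)) (hW : W.Nonempty) (e : Fin W.card ≃ W)
        (α : Bits m → ℝ) (C ε δ : ℝ) (i : Fin m)
        (B : BlackBoxes (Nat.clog 2 m) (d * k) N W.card),
      (∀ c ∈ W, 0 ≤ α c) → ∑ c ∈ W, α c ≤ C →
      (∀ c ∈ W, featureSum x y Φ c ≠ 0) →
      0 < ε → 0 < δ → δ < 1 →
      -- the black boxes
      LoadsData B.load x →
      (∀ t, PreparesVector (B.prep t) (storedVector x y Φ (e t))) →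
      0 ≤ B.queryTime → B.queryTime ≤ A * Real.log (2 + m * d) ^ κ →
      IsQuantumFeatureMap B.feat Φ →
      1 ≤ B.featTime → ((d * k + N : ℕ) : ℝ) ≤ 2 * B.featTime →
      ∀ (R Ψmin T : ℝ), R = maxNorm x Φ i →
        Ψmin = W.inf' hW (fun c => ‖featureSum x y Φ c‖) →
        T = max 1 (Real.log (1 / δ)) / ε * (C * R ^ 3 * W.card / Ψmin) * B.featTime →
      ∃ (Q : ℕ) (L : List (Branch Q)),
        Exec B P
          (start Q (inputMem (Nat.clog 2 m) (d * k) N m W.card i C ε δ R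
            (label (y i)) ‖Φ (x i)‖ (fun t => α (e t)) (fun t => eta x Φ (e t)))) L ∧
        (∀ s ∈ L, s.time ≤ K * (1 + T) * Real.log (3 + m + d + T) ^ p) ∧
        1 - δ ≤ probability L (fun s =>
          |s.mem.real 0 - ∑ c ∈ W, α c * inner ℝ (featureSum x y Φ c) (label (y i) • Φ (x i))|
            ≤ ε) := by
  classical
  refine ⟨mainP, fun A κ => ⟨7136 * (300 + 6 * |A| * 2 ^ κ) + 100, κ + 2, ?_⟩⟩
  intro m d k N x y Φ W hW e α C ε δ i B hα hC hΨ hε hδ hδ1 hload hprep hq0 hq hfeat hF hnN R Ψmin T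
    hR hΨmin hT
  have hm : 1 ≤ m := (Nat.zero_le _).trans_lt i.2
  obtain ⟨f, L, hE, hL, hsum⟩ := leads_answer hW e (Nat.le_pow_clog (by norm_num) m)
    (two_pow_clog_le hm) (log_clog_le hm) hα hC hΨ hε hδ hδ1 hload hprep hq0 hq hfeat hF hnN hR
    hΨmin hT
  refine ⟨_, L, hE, fun s hs => (hL s hs).1, hsum.trans ?_⟩
  refine (List.sum_le_sum fun s hs => (hL s hs).2).trans (le_of_eq ?_)
  unfold probability
  congr 2
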